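/- Let $0<j_2<j_1<1$ be constants and $\rho=\log(1/j_1)/\log(1/j_2)$. For finite sets $A,B$ that are not both empty let $J(A,B)=|A\cap B|/|A\cup B|$ be their Jaccard similarity. There are constants $k\in\mathbb{N}$, $c>0$, $p>0$ and a query program $P$ for the word RAM, all depending only on $j_1,j_2$, such that the following holds. Let $U=\{0,\dots,u-1\}$ and let $\mathcal C=(A_1,\dots,A_n)$, $n\ge 1$, be a collection of $n$ subsets of $U$. On a word RAM with words of $k\cdot\lceil\log_2(n+u+1)\rceil$ bits there is a randomized data structure for $\mathcal C$, that is, a random initial content of a memory of $S$ words with $$S\le c\Bigl(n^{1+\rho}+\sum_{A\in\mathcal C}|A|\Bigr)$$ (this includes the working memory of the queries and all stored random bits), such that for every nonempty set $Q\subseteq U$, given as an array of its elements in any order: 1. for every outcome of the random content, the program $P$ on the query $Q$ uses only these $S$ words, a fixed number of registers and read-only access to the array of $Q$, and halts after at most $c\,(n^{\rho}\log n+|Q|)$ elementary operations; 2. if there is a set $A_0\in\mathcal C$ with $J(A_0,Q)\ge j_1$, then with probability at least $p$ the program returns (the index of) a set $A\in\mathcal C$ with $J(A,Q)>j_2$.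 -/

import Mathlib

/-- Jaccard similarity `|A ∩ B| / |A ∪ B|` (only used when `A ∪ B` is nonempty). -/
noncomputable def jaccard {α : Type*} [DecidableEq α] (A B : Finset α) : ℝ :=
  ((A ∩ B).card : ℝ) / ((A ∪ B).card : ℝ)

/-! ### A word RAM

Words are natural numbers below a word bound `W`, and every operation returns its result modulo `W`.
The machine has registers, a random access memory of exactly `S` words (reading or writing outside
of it crashes), and a read-only input array. Programs are finite structured programs; every
elementary operation costs one unit of time. -/
namespace WordRAM

/-- Binary word operations; subtraction is truncated at `0`, comparisons return `0` or `1`. -/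
inductive BinOp
  | add | sub | mul | div | mod | lt | eq

/-- The value of a word operation, modulo the word bound `W`. -/
def BinOp.eval (W : ℕ) : BinOp → ℕ → ℕ → ℕ
  | .add, a, b => (a + b) % W
  | .sub, a, b => (a - b) % W
  | .mul, a, b => (a * b) % W
  | .div, a, b => (a / b) % W
  | .mod, a, b => (a % b) % W
  | .lt, a, b => (if a < b then 1 else 0) % W
  | .eq, a, b => (if a = b then 1 else 0) % W

/-- Expressions: literals, registers, length of the input, the input word at an index, the memory
word at an address, and binary operations. -/
inductive Exp
  | lit (k : ℕ)
  | reg (x : ℕ)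
  | inputLen
  | input (e : Exp)
  | load (e : Exp)
  | op (o : BinOp) (a b : Exp)

/-- Time to evaluate an expression: one unit per node. -/
def Exp.cost : Exp → ℕ
  | .lit _ => 1
  | .reg _ => 1
  | .inputLen => 1
  | .input e => e.cost + 1
  | .load e => e.cost + 1
  | .op _ a b => a.cost + b.cost + 1

/-- Programs. A condition holds if its value is not `0`. -/
inductive Prog
  | skip
  | assign (x : ℕ) (e : Exp)
  | store (addr e : Exp)
  | seq (p q : Prog)
  | ite (e : Exp) (p q : Prog)
  | while (e : Exp) (p : Prog)

/-- A state of a machine whose memory has `S` words. -/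
structure State (S : ℕ) where
  /-- contents of the registers -/
  reg : ℕ → ℕ
  /-- contents of the memory -/
  mem : Fin S → ℕ

/-- The value of an expression; `none` means an access outside the memory or the input. -/
def Exp.eval (W : ℕ) (inp : List ℕ) {S : ℕ} (s : State S) : Exp → Option ℕ
  | .lit k => some (k % W)
  | .reg x => some (s.reg x)
  | .inputLen => some (inp.length % W)
  | .input e => (Exp.eval W inp s e).bind fun i => (inp[i]?).map fun a => a % W
  | .load e => (Exp.eval W inp s e).bind fun i => if h : i < S then some (s.mem ⟨i, h⟩) else none
  | .op o a b =>
      (Exp.eval W inp s a).bind fun x => (Exp.eval W inp s b).map fun y => o.eval W x y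

/-- `Exec W inp p s s' t`: with word bound `W` and input `inp`, the program `p` started in the
state `s` halts in the state `s'` after `t` units of time, without a crash. -/
inductive Exec (W : ℕ) (inp : List ℕ) {S : ℕ} : Prog → State S → State S → ℕ → Prop
  | skip (s : State S) : Exec W inp .skip s s 1
  | assign (x : ℕ) (e : Exp) (s : State S) (v : ℕ) (hv : e.eval W inp s = some v) :
      Exec W inp (.assign x e) s ⟨Function.update s.reg x v, s.mem⟩ (e.cost + 1)
  | store (a e : Exp) (s : State S) (i : Fin S) (v : ℕ)
      (hi : a.eval W inp s = some (i : ℕ)) (hv : e.eval W inp s = some v) :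
      Exec W inp (.store a e) s ⟨s.reg, Function.update s.mem i v⟩ (a.cost + e.cost + 1)
  | seq (p q : Prog) (s s' s'' : State S) (t t' : ℕ)
      (hp : Exec W inp p s s' t) (hq : Exec W inp q s' s'' t') :
      Exec W inp (.seq p q) s s'' (t + t')
  | iteTrue (e : Exp) (p q : Prog) (s s' : State S) (v t : ℕ)
      (hv : e.eval W inp s = some v) (hne : v ≠ 0) (hp : Exec W inp p s s' t) :
      Exec W inp (.ite e p q) s s' (e.cost + 1 + t)
  | iteFalse (e : Exp) (p q : Prog) (s s' : State S) (t : ℕ)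
      (hv : e.eval W inp s = some 0) (hq : Exec W inp q s s' t) :
      Exec W inp (.ite e p q) s s' (e.cost + 1 + t)
  | whileTrue (e : Exp) (p : Prog) (s s' s'' : State S) (v t t' : ℕ)
      (hv : e.eval W inp s = some v) (hne : v ≠ 0) (hp : Exec W inp p s s' t)
      (hw : Exec W inp (.while e p) s' s'' t') :
      Exec W inp (.while e p) s s'' (e.cost + 1 + t + t')
  | whileFalse (e : Exp) (p : Prog) (s : State S) (hv : e.eval W inp s = some 0) :
      Exec W inp (.while e p) s s (e.cost + 1)

/-- Execution is deterministic: final state and running time are determined by the start. -/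
theorem Exec.unique {W : ℕ} {inp : List ℕ} {S : ℕ} {p : Prog} {s s₁ s₂ : State S} {t₁ t₂ : ℕ}
    (h₁ : Exec W inp p s s₁ t₁) (h₂ : Exec W inp p s s₂ t₂) : s₁ = s₂ ∧ t₁ = t₂ := by
  induction h₁ generalizing s₂ t₂ with
  | skip => cases h₂; exact ⟨rfl, rfl⟩
  | assign x e s v hv =>
    cases h₂ with
    | assign _ _ _ v' hv' =>
      rw [hv] at hv'; cases hv'; exact ⟨rfl, rfl⟩
  | store a e s i v hi hv =>
    cases h₂ with
    | store _ _ _ i' v' hi' hv' =>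
      rw [hv] at hv'; cases hv'
      rw [hi] at hi'
      have : i = i' := Fin.ext (Option.some.inj hi')
      subst this; exact ⟨rfl, rfl⟩
  | seq p q s s' s'' t t' _ _ ihp ihq =>
    cases h₂ with
    | seq _ _ _ r _ _ _ hp' hq' =>
      obtain ⟨rfl, rfl⟩ := ihp hp'
      obtain ⟨rfl, rfl⟩ := ihq hq'
      exact ⟨rfl, rfl⟩
  | iteTrue e p q s s' v t hv hne _ ih =>
    cases h₂ with
    | iteTrue _ _ _ _ _ _ _ _ _ h' => obtain ⟨rfl, rfl⟩ := ih h'; exact ⟨rfl, rfl⟩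
    | iteFalse _ _ _ _ _ _ hv' _ => rw [hv] at hv'; exact absurd (Option.some.inj hv') hne
  | iteFalse e p q s s' t hv _ ih =>
    cases h₂ with
    | iteTrue _ _ _ _ _ _ _ hv' hne' _ =>
      rw [hv] at hv'; exact absurd (Option.some.inj hv').symm hne'
    | iteFalse _ _ _ _ _ _ _ h' => obtain ⟨rfl, rfl⟩ := ih h'; exact ⟨rfl, rfl⟩
  | whileTrue e p s s' s'' v t t' hv hne _ _ ihp ihw =>
    cases h₂ with
    | whileTrue _ _ _ r _ _ _ _ _ _ hp' hw' =>
      obtain ⟨rfl, rfl⟩ := ihp hp'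
      obtain ⟨rfl, rfl⟩ := ihw hw'
      exact ⟨rfl, rfl⟩
    | whileFalse _ _ _ hv' => rw [hv] at hv'; exact absurd (Option.some.inj hv') hne
  | whileFalse e p s hv =>
    cases h₂ with
    | whileTrue _ _ _ _ _ _ _ _ hv' hne' _ _ =>
      rw [hv] at hv'; exact absurd (Option.some.inj hv').symm hne'
    | whileFalse _ _ _ _ => exact ⟨rfl, rfl⟩

/-- The start of a query: registers are `0` and the memory holds the stored image. -/
def start {S W : ℕ} (M : Fin S → Fin W) : State S := ⟨fun _ => 0, fun a => (M a : ℕ)⟩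

/-- On the memory image `M` and the query `q` (the array of its elements), the program `P` halts
after `t` units of time with `out` in register `0`. -/
def Answers {S W u : ℕ} (P : Prog) (M : Fin S → Fin W) (q : List (Fin u)) (out t : ℕ) : Prop :=
  ∃ s : State S, Exec W (q.map fun a => (a : ℕ)) P (start M) s t ∧ s.reg 0 = out

end WordRAM

/-! The data structure is locality-sensitive hashing with min-wise sketches. Every slot (at first,
think of an element) has a random bin and a random rank, and the sketch of a set holds the smallest
rank in each bin. The sketches of A and Q agree in a bin iff the element of A ∪ Q of smallest rank
there exists and lies in A ∩ Q. By symmetry, the probability of agreement in k given bins is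
proportional to the number of injections of k bins into A ∩ Q, with a factor that depends only on A
∪ Q (`card_minIn_eq`). Hence it is at most J^k (`pr_agree_le`), and nearly J^k if A ∩ Q and A ∪ Q
are large (`le_pr_agree`).

A table compares 3K bins, K from each of three chunks. Every chunk offers m functions with K bins
each, and all m^3 combinations are tables. With n j₂^(3K) ≤ 1 and m j₁^K ≥ 1 there are O(n^ρ)
tables, and O(n^ρ) expected collisions with dissimilar sets, those of similarity at most j₂. The
second moment method shows that a similar set collides in some table with probability at least 1/32
(`pr_exists_collide`). The tables share their bins, so that O(n^(ρ/3) log n) bins suffice. A further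
T = O(log n) bins verify the candidates: all dissimilar sets fail by a Chernoff bound
(`pr_le_verCount`), and one given similar set passes by Chebyshev's inequality (`pr_verCount_lt`).
Sets of intermediate similarity may fail too and clog the scan. It therefore stops after Φ = O(n^ρ)
rejected candidates and returns the ζ-th of them, for a random ζ; since at most Φ/2 candidates are
dissimilar, this is right with probability at least 1/2 (`card_bad_le`).

Sketches are accurate only if the union has at least r = O(n^(ρ/3) log² n) slots. A query with r or
more elements takes one slot per element. For a smaller query every element is replaced by a block
of r slots, which preserves similarities and costs time O(r²); only sets of size O(r) can be similar
to it, so the blocks need O(n r²) slots. Three chunks make r² = O(n^(2ρ/3) log⁴ n) = O(n^ρ); with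
two, the logarithms would remain. Elements of the query outside the stored sets get fresh slots from
a pool, and a query too large for the pool is similar to no set.

Once the random choices are fixed, a two-level perfect hash table (`exists_dict`) maps elements to
blocks, serves as a trie that turns K values of a sketch into one class number, and lists the sets
in every bucket. The program is verified in a Hoare logic with time bounds (`queryProg_spec`).
`exists_memory` joins it with the combinatorics, `pr_slotSuccess` gives the probability, and
`exists_tuned` the parameters. -/

namespace WordRAM

/-! ### A program logic with time bounds -/

instance : Add Exp := ⟨.op .add⟩
instance : Sub Exp := ⟨.op .sub⟩
instance : Mul Exp := ⟨.op .mul⟩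
instance : Div Exp := ⟨.op .div⟩
instance : Mod Exp := ⟨.op .mod⟩

/-- The state with registers `r` whose memory is the restriction of `f` to the first `S` words. -/
def st (S : ℕ) (r f : ℕ → ℕ) : State S := ⟨r, fun a => f a⟩

/-- In the state `st S r f` the expression `e` has the value `v`. -/
def Ev (W : ℕ) (inp : List ℕ) (S : ℕ) (r f : ℕ → ℕ) (e : Exp) (v : ℕ) : Prop :=
  e.eval W inp (st S r f) = some v

/-- Total correctness with a time bound: started in `st S r f`, the program `p` halts within `B`
units of time in a state satisfying `Post`. -/
def Tr (W : ℕ) (inp : List ℕ) (S : ℕ) (p : Prog) (r f : ℕ → ℕ) (B : ℕ)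
    (Post : (ℕ → ℕ) → (ℕ → ℕ) → Prop) : Prop :=
  ∃ r' f' t, Exec W inp p (st S r f) (st S r' f') t ∧ t ≤ B ∧ Post r' f'

section Ev

variable {W : ℕ} {inp : List ℕ} {S : ℕ} {r f : ℕ → ℕ}

theorem Ev.lit {k : ℕ} (h : k < W) : Ev W inp S r f (.lit k) k := by
  simp [Ev, Exp.eval, Nat.mod_eq_of_lt h]

theorem Ev.reg {x v : ℕ} (h : r x = v) : Ev W inp S r f (.reg x) v := by
  simp [Ev, Exp.eval, st, h]

theorem Ev.inputLen (h : inp.length < W) : Ev W inp S r f .inputLen inp.length := by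
  simp [Ev, Exp.eval, Nat.mod_eq_of_lt h]

theorem Ev.input {e : Exp} {i : ℕ} (he : Ev W inp S r f e i) (hi : i < inp.length)
    (hW : inp[i] < W) : Ev W inp S r f (.input e) inp[i] := by
  unfold Ev at he ⊢
  simp [Exp.eval, he, hi, Nat.mod_eq_of_lt hW]

theorem Ev.load {e : Exp} {i v : ℕ} (he : Ev W inp S r f e i) (hi : i < S) (hv : f i = v) :
    Ev W inp S r f (.load e) v := by
  unfold Ev at he ⊢
  simp only [Exp.eval, he, Option.bind_some]
  simp [hi, st, hv]

theorem Ev.op {o : BinOp} {a b : Exp} {x y v : ℕ} (ha : Ev W inp S r f a x)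
    (hb : Ev W inp S r f b y) (hv : o.eval W x y = v) : Ev W inp S r f (.op o a b) v := by
  unfold Ev at ha hb ⊢
  simp [Exp.eval, ha, hb, hv]

theorem Ev.add {a b : Exp} {x y : ℕ} (ha : Ev W inp S r f a x) (hb : Ev W inp S r f b y)
    (h : x + y < W) : Ev W inp S r f (a + b) (x + y) :=
  Ev.op ha hb (Nat.mod_eq_of_lt h)

theorem Ev.sub {a b : Exp} {x y : ℕ} (ha : Ev W inp S r f a x) (hb : Ev W inp S r f b y)
    (h : x < W) : Ev W inp S r f (a - b) (x - y) :=
  Ev.op ha hb (Nat.mod_eq_of_lt ((Nat.sub_le x y).trans_lt h))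

theorem Ev.mul {a b : Exp} {x y : ℕ} (ha : Ev W inp S r f a x) (hb : Ev W inp S r f b y)
    (h : x * y < W) : Ev W inp S r f (a * b) (x * y) :=
  Ev.op ha hb (Nat.mod_eq_of_lt h)

theorem Ev.div {a b : Exp} {x y : ℕ} (ha : Ev W inp S r f a x) (hb : Ev W inp S r f b y)
    (h : x < W) : Ev W inp S r f (a / b) (x / y) :=
  Ev.op ha hb (Nat.mod_eq_of_lt ((Nat.div_le_self x y).trans_lt h))

theorem Ev.mod {a b : Exp} {x y : ℕ} (ha : Ev W inp S r f a x) (hb : Ev W inp S r f b y)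
    (h : x < W) : Ev W inp S r f (a % b) (x % y) :=
  Ev.op ha hb (Nat.mod_eq_of_lt ((Nat.mod_le x y).trans_lt h))

theorem Ev.lt {a b : Exp} {x y : ℕ} (ha : Ev W inp S r f a x) (hb : Ev W inp S r f b y)
    (h : 1 < W) : Ev W inp S r f (.op .lt a b) (if x < y then 1 else 0) :=
  Ev.op ha hb (Nat.mod_eq_of_lt (by split_ifs <;> omega))

theorem Ev.eq {a b : Exp} {x y : ℕ} (ha : Ev W inp S r f a x) (hb : Ev W inp S r f b y)
    (h : 1 < W) : Ev W inp S r f (.op .eq a b) (if x = y then 1 else 0) :=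
  Ev.op ha hb (Nat.mod_eq_of_lt (by split_ifs <;> omega))

theorem Ev.congr {e : Exp} {v v' : ℕ} (h : Ev W inp S r f e v) (hv : v = v') :
    Ev W inp S r f e v' := hv ▸ h

end Ev

section Tr

variable {W : ℕ} {inp : List ℕ} {S : ℕ} {r f : ℕ → ℕ} {B : ℕ}
  {Post : (ℕ → ℕ) → (ℕ → ℕ) → Prop}

theorem Tr.mono {p : Prog} {B' : ℕ} {Post' : (ℕ → ℕ) → (ℕ → ℕ) → Prop}
    (h : Tr W inp S p r f B Post) (hB : B ≤ B') (hP : ∀ r' f', Post r' f' → Post' r' f') :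
    Tr W inp S p r f B' Post' := by
  obtain ⟨r', f', t, h1, h2, h3⟩ := h
  exact ⟨r', f', t, h1, h2.trans hB, hP _ _ h3⟩

theorem Tr.skip (h : Post r f) (hB : 1 ≤ B) : Tr W inp S .skip r f B Post :=
  ⟨r, f, 1, .skip _, hB, h⟩

theorem Tr.assign {x v : ℕ} {e : Exp} (he : Ev W inp S r f e v)
    (h : Post (Function.update r x v) f) (hB : e.cost + 1 ≤ B) :
    Tr W inp S (.assign x e) r f B Post :=
  ⟨_, f, _, .assign x e _ v he, hB, h⟩

theorem Tr.store {i v : ℕ} {a e : Exp} (ha : Ev W inp S r f a i) (hi : i < S)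
    (he : Ev W inp S r f e v) (h : Post r (Function.update f i v))
    (hB : a.cost + e.cost + 1 ≤ B) : Tr W inp S (.store a e) r f B Post := by
  refine ⟨r, Function.update f i v, _, ?_, hB, h⟩
  have := Exec.store (W := W) (inp := inp) a e (st S r f) ⟨i, hi⟩ v ha he
  convert this using 1
  unfold st
  congr 1
  funext j
  by_cases hj : j = ⟨i, hi⟩
  · subst hj; simp
  · have : (j : ℕ) ≠ i := fun h => hj (Fin.ext h)
    simp [hj, this]

theorem Tr.seq {p q : Prog} (B₁ B₂ : ℕ)
    (h : Tr W inp S p r f B₁ fun r' f' => Tr W inp S q r' f' B₂ Post) (hB : B₁ + B₂ ≤ B) :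
    Tr W inp S (.seq p q) r f B Post := by
  obtain ⟨r', f', t, h1, h2, r'', f'', t', h3, h4, h5⟩ := h
  exact ⟨r'', f'', t + t', .seq _ _ _ _ _ _ _ h1 h3, by omega, h5⟩

theorem Tr.assign_seq {x v : ℕ} {e : Exp} {q : Prog} (B₂ : ℕ) (he : Ev W inp S r f e v)
    (h : Tr W inp S q (Function.update r x v) f B₂ Post) (hB : e.cost + 1 + B₂ ≤ B) :
    Tr W inp S (.seq (.assign x e) q) r f B Post :=
  Tr.seq (e.cost + 1) B₂ (Tr.assign he h le_rfl) hB

theorem Tr.ite {e : Exp} {p q : Prog} {c : Prop} [Decidable c] (B₁ : ℕ)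
    (he : Ev W inp S r f e (if c then 1 else 0))
    (hp : c → Tr W inp S p r f B₁ Post) (hq : ¬ c → Tr W inp S q r f B₁ Post)
    (hB : e.cost + 1 + B₁ ≤ B) : Tr W inp S (.ite e p q) r f B Post := by
  by_cases hc : c
  · rw [if_pos hc] at he
    obtain ⟨r', f', t, h1, h2, h3⟩ := hp hc
    exact ⟨r', f', _, .iteTrue e p q _ _ 1 t he one_ne_zero h1, by omega, h3⟩
  · rw [if_neg hc] at he
    obtain ⟨r', f', t, h1, h2, h3⟩ := hq hc
    exact ⟨r', f', _, .iteFalse e p q _ _ t he h1, by omega, h3⟩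

/-- The index of the invariant is a variant: it falls in every round and so bounds the number of
rounds. The extra round in the time bound pays for the last test of the condition. -/
theorem Tr.while {e : Exp} {p : Prog} (I : ℕ → (ℕ → ℕ) → (ℕ → ℕ) → Prop)
    (hstep : ∀ k r f, I k r f →
      (∃ v, Ev W inp S r f e v ∧ v ≠ 0 ∧ Tr W inp S p r f B fun r' f' => ∃ k' < k, I k' r' f') ∨
      (Ev W inp S r f e 0 ∧ Post r f)) (k : ℕ) (hI : I k r f) :
    Tr W inp S (.while e p) r f ((k + 1) * (e.cost + 1 + B)) Post := by
  induction k using Nat.strong_induction_on generalizing r f with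
  | _ k ih =>
    rcases hstep k r f hI with ⟨v, hv, hne, r', f', t, h1, h2, k', hk', hI'⟩ | ⟨h0, hP⟩
    · obtain ⟨r'', f'', t', h3, h4, h5⟩ := ih k' hk' hI'
      refine ⟨r'', f'', _, .whileTrue e p _ _ _ v t t' hv hne h1 h3, ?_, h5⟩
      have : (k' + 1) * (e.cost + 1 + B) ≤ k * (e.cost + 1 + B) := Nat.mul_le_mul_right _ hk'
      rw [Nat.succ_mul]
      omega
    · refine ⟨r, f, _, .whileFalse e p _ h0, ?_, hP⟩
      rw [Nat.succ_mul]
      omega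

theorem Tr.for {i : ℕ} {lim : Exp} {p : Prog} {N : ℕ} (I : ℕ → (ℕ → ℕ) → (ℕ → ℕ) → Prop)
    (hW : 1 < W)
    (hlim : ∀ k r f, k ≤ N → I k r f → r i = k ∧ Ev W inp S r f lim N)
    (hbody : ∀ k r f, k < N → I k r f → Tr W inp S p r f B (I (k + 1))) (hI : I 0 r f) :
    Tr W inp S (.while (.op .lt (.reg i) lim) p) r f ((N + 1) * (lim.cost + 3 + B)) (I N) := by
  have h := Tr.while (W := W) (inp := inp) (S := S) (r := r) (f := f) (B := B) (Post := I N)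
    (e := .op .lt (.reg i) lim) (p := p)
    (fun k r f => k ≤ N ∧ I (N - k) r f) ?_ N ⟨le_rfl, by simpa using hI⟩
  · refine h.mono (le_of_eq ?_) fun _ _ h => h
    simp [Exp.cost]
    ring
  · rintro k r f ⟨hk, hI⟩
    obtain ⟨h1, h2⟩ := hlim _ r f (by omega) hI
    have h3 := Ev.lt (Ev.reg h1) h2 hW
    rcases Nat.eq_zero_or_pos k with rfl | hpos
    · right
      simp only [Nat.sub_zero, lt_irrefl, if_false] at h3
      exact ⟨h3, by simpa using hI⟩
    · left
      refine ⟨1, ?_, one_ne_zero, ?_⟩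
      · rwa [if_pos (by omega)] at h3
      · refine (hbody _ r f (by omega) hI).mono le_rfl fun r' f' h' => ⟨k - 1, by omega, by omega, ?_⟩
        rwa [show N - (k - 1) = N - k + 1 by omega]

end Tr

/-! ### The memory header and lookups in the hash table -/

/-- The constants of a query, stored in the first words of the memory. -/
structure Params where
  -- Hash table: prime `P`, multiplier `a`, number `s` of buckets, addresses `D1`, `D2` of the two
  -- levels. `Z` is the base of the keys. Addresses: slots `hs`, sketch `wb` and classes `cb` of the
  -- query, verification sketches `ver`. Each of three chunks has `m` functions of `K` bins, so `G =
  -- 3 m` groups of bins and `L = m ^ 3` tables. `Φ` caps the rejected candidates and `ζ` is the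
  -- random index below it. Verification uses `T` bins, from bin `vb` on, and the threshold `Θ`.
  -- Queries shorter than `thr` are small; `pool0`, `pool1` are the first fresh slots of the two
  -- modes and `qmax0` is the largest size of a query in mode `0`.
  (P a s D1 D2 Z hs wb cb m K L Φ ζ T Θ ver n thr pool0 qmax0 pool1 G vb : ℕ)

/-- The header of the memory. -/
def Params.hdr (p : Params) : List ℕ :=
  [p.P, p.a, p.s, p.D1, p.D2, p.Z, p.hs, p.wb, p.cb, p.m, p.K, p.L, p.Φ, p.ζ, p.T, p.Θ, p.ver, p.n,
    p.thr, p.pool0, p.qmax0, p.pool1, p.G, p.vb]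

/-- Registers `20` to `43` hold the header. -/
def Params.Held (p : Params) (r : ℕ → ℕ) : Prop := ∀ i < 24, r (20 + i) = p.hdr.getD i 0

theorem Params.Held.congr {p : Params} {r r' : ℕ → ℕ} (h : p.Held r)
    (hr : ∀ x, 20 ≤ x → r' x = r x) : p.Held r' := fun i hi => by
  rw [hr _ (by omega), h i hi]

theorem Params.Held.update {p : Params} {r : ℕ → ℕ} {x v : ℕ} (h : p.Held r)
    (hx : x < 20) : p.Held (Function.update r x v) :=
  h.congr fun y hy => Function.update_of_ne (by omega) _ _

/-- Reading the header into registers. -/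
def loadHdr : ℕ → Prog
  | 0 => .skip
  | k + 1 => .seq (loadHdr k) (.assign (20 + k) (.load (.lit k)))

section

variable {W : ℕ} {inp : List ℕ} {S : ℕ} {r f : ℕ → ℕ}

theorem loadHdr_spec (k : ℕ) (hS : k ≤ S) (hW : k ≤ W) :
    Tr W inp S (loadHdr k) r f (1 + 3 * k) fun r' f' =>
      f' = f ∧ (∀ i < k, r' (20 + i) = f i) ∧ ∀ x < 20, r' x = r x := by
  induction k with
  | zero => exact Tr.skip ⟨rfl, by simp, fun _ _ => rfl⟩ le_rfl
  | succ k ih =>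
    refine Tr.seq (1 + 3 * k) 3 ((ih (by omega) (by omega)).mono le_rfl ?_) (by omega)
    rintro r' f' ⟨rfl, h1, h2⟩
    refine Tr.assign (Ev.load (Ev.lit (by omega)) (by omega) rfl) ⟨rfl, ?_, ?_⟩ (by simp [Exp.cost])
    · intro i hi
      rcases Nat.lt_succ_iff_lt_or_eq.1 hi with h | rfl
      · rw [Function.update_of_ne (by omega), h1 i h]
      · simp
    · intro x hx
      rw [Function.update_of_ne (by omega), h2 x hx]

/-- The memory `μ` below the address `lim` holds a two-level hash table for the function `F`. -/
structure DictOK (μ : ℕ → ℕ) (lim P a s D1 D2 : ℕ) (F : ℕ → ℕ) : Prop where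
  a_lt : a < P
  look : ∀ x < P, ∃ off ab mb, μ (D1 + 3 * (a * x % P % s)) = off ∧
    μ (D1 + 3 * (a * x % P % s) + 1) = ab ∧ μ (D1 + 3 * (a * x % P % s) + 2) = mb ∧
    D1 + 3 * (a * x % P % s) + 2 < lim ∧ ab < P ∧ D2 + 2 * (off + ab * x % P % mb) + 1 < lim ∧
    ((μ (D2 + 2 * (off + ab * x % P % mb)) = x ∧
        μ (D2 + 2 * (off + ab * x % P % mb) + 1) = F x) ∨
      (μ (D2 + 2 * (off + ab * x % P % mb)) ≠ x ∧ F x = 0))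

/-- Looks up the key in register `1`, with the result in register `3`. -/
def lookup : Prog :=
  .seq (.assign 2 (.reg 23 + .lit 3 * (.reg 21 * .reg 1 % .reg 20 % .reg 22)))
    (.seq (.assign 2 (.reg 24 + .lit 2 * (.load (.reg 2) +
        .load (.reg 2 + .lit 1) * .reg 1 % .reg 20 % .load (.reg 2 + .lit 2))))
      (.ite (.op .eq (.load (.reg 2)) (.reg 1)) (.assign 3 (.load (.reg 2 + .lit 1)))
        (.assign 3 (.lit 0))))

theorem lookup_spec {p : Params} {μ F : ℕ → ℕ} (hd : DictOK μ p.wb p.P p.a p.s p.D1 p.D2 F)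
    (hf : ∀ a < p.wb, f a = μ a) (hwS : p.wb ≤ S) (hS : S < W) (hP : p.P * p.P < W)
    (hr : p.Held r) (hx : r 1 < p.P) :
    Tr W inp S lookup r f 50 fun r' f' =>
      f' = f ∧ r' 3 = F (r 1) ∧ ∀ x, x ≠ 2 → x ≠ 3 → r' x = r x := by
  obtain ⟨off, ab, mb, h1, h2, h3, h4, h5, h6, h7⟩ := hd.look _ hx
  have ha := hd.a_lt
  set X := r 1 with hX
  set b := p.a * X % p.P % p.s with hb
  -- Both products in the hash functions stay below `P * P < W`, so the machine computes them
  -- without wrap-around.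
  have hax : p.a * X < W := (Nat.mul_le_mul ha.le hx.le).trans_lt hP
  have habx : ab * X < W := (Nat.mul_le_mul h5.le hx.le).trans_lt hP
  have e0 : r 20 = p.P := hr 0 (by norm_num)
  have e1 : r 21 = p.a := hr 1 (by norm_num)
  have e2 : r 22 = p.s := hr 2 (by norm_num)
  have e3 : r 23 = p.D1 := hr 3 (by norm_num)
  have e4 : r 24 = p.D2 := hr 4 (by norm_num)
  refine Tr.assign_seq 38 (v := p.D1 + 3 * b) (Ev.add (.reg e3) (Ev.mul (.lit (by omega))
    (Ev.mod (Ev.mod (Ev.mul (.reg e1) (.reg rfl) hax) (.reg e0) hax) (.reg e2)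
      ((Nat.mod_le _ _).trans_lt hax)) (by omega)) (by omega)) ?_ (by decide)
  have q2 : Function.update r 2 (p.D1 + 3 * b) 2 = p.D1 + 3 * b := by simp
  refine Tr.assign_seq 12 (v := p.D2 + 2 * (off + ab * X % p.P % mb)) (Ev.add (.reg (by simpa using e4))
    (Ev.mul (.lit (by omega)) (Ev.add (Ev.load (.reg q2) (by omega) (by rw [hf _ (by omega), h1]))
      (Ev.mod (Ev.mod (Ev.mul (Ev.load (Ev.add (.reg q2) (.lit (by omega)) (by omega)) (by omega)
        (by rw [hf _ (by omega), h2])) (.reg (by simp [hX])) habx) (.reg (by simpa using e0)) habx)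
        (Ev.load (Ev.add (.reg q2) (.lit (by omega)) (by omega)) (by omega)
        (by rw [hf _ (by omega), h3])) ((Nat.mod_le _ _).trans_lt habx)) (by omega)) (by omega))
    (by omega)) ?_ (by decide)
  set cell := p.D2 + 2 * (off + ab * X % p.P % mb) with hcell
  set r2 := Function.update (Function.update r 2 (p.D1 + 3 * b)) 2 cell with hr2
  have q2 : r2 2 = cell := by simp [hr2]
  have q1 : r2 1 = X := by simp [hr2, hX]
  refine Tr.ite 5 (Ev.eq (Ev.load (.reg q2) (by omega) (hf _ (by omega)))
    (.reg q1) (by omega)) (fun hc => ?_) (fun hc => ?_) (by decide)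
  · refine Tr.assign (v := F X) (Ev.load (Ev.add (.reg q2) (.lit (by omega)) (by omega)) (by omega)
      ?_) ⟨rfl, by simp, fun x h2 h3 => ?_⟩ (by decide)
    · rw [hf _ (by omega)]
      rcases h7 with h7 | h7
      · exact h7.2
      · exact absurd hc h7.1
    · simp [hr2, h2, h3]
  · refine Tr.assign (v := F X) ?_ ⟨rfl, by simp, fun x h2 h3 => ?_⟩ (by decide)
    · rcases h7 with h7 | h7
      · exact absurd h7.1 hc
      · exact (Ev.lit (by omega)).congr h7.2.symm
    · simp [hr2, h2, h3]

end

/-! ### Keys and the sketch of the query -/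

/-- A key made of six digits in base `Z`. -/
def enc (Z k a b c d e : ℕ) : ℕ := ((((k * Z + a) * Z + b) * Z + c) * Z + d) * Z + e

theorem enc_lt {Z k a b c d e : ℕ} (hk : k < Z) (ha : a < Z) (hb : b < Z) (hc : c < Z) (hd : d < Z)
    (he : e < Z) : enc Z k a b c d e < Z ^ 6 := by
  have step : ∀ x y n : ℕ, x < Z ^ n → y < Z → x * Z + y < Z ^ (n + 1) := by
    intro x y n hx hy
    have : (x + 1) * Z ≤ Z ^ n * Z := Nat.mul_le_mul_right _ hx
    rw [pow_succ]
    linarith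
  unfold enc
  exact step _ _ 5 (step _ _ 4 (step _ _ 3 (step _ _ 2 (step _ _ 1 (by simpa using hk) ha) hb) hc) hd) he

/-- The expression computing `enc`; the base is in register `25`. -/
def encE (k a b c d e : Exp) : Exp :=
  ((((k * .reg 25 + a) * .reg 25 + b) * .reg 25 + c) * .reg 25 + d) * .reg 25 + e

/-- The smallest rank of an element of `X` in the bin `l`, or `M` if there is none. -/
def sketch (bin rk : ℕ → ℕ) (M : ℕ) (X : Finset ℕ) (l : ℕ) : ℕ :=
  (X.filter fun x => bin x = l).fold min M rk

theorem sketch_insert (bin rk : ℕ → ℕ) (M : ℕ) (X : Finset ℕ) (x l : ℕ) :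
    sketch bin rk M (insert x X) l =
      if bin x = l then min (rk x) (sketch bin rk M X l) else sketch bin rk M X l := by
  unfold sketch
  rw [Finset.filter_insert]
  split_ifs
  · rw [Finset.fold_insert_idem]
  · rfl

section

variable {W : ℕ} {inp : List ℕ} {S : ℕ} {r f : ℕ → ℕ}

/-- In the Horner scheme no intermediate value exceeds the final one, which is below `Z ^ 6 ≤ W`; so
nothing wraps around. -/
theorem Ev.enc {Z k a b c d e : ℕ} {ke ae be ce de ee : Exp} (hZ : r 25 = Z) (hW : Z ^ 6 ≤ W)
    (hk : Ev W inp S r f ke k) (ha : Ev W inp S r f ae a) (hb : Ev W inp S r f be b)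
    (hc : Ev W inp S r f ce c) (hd : Ev W inp S r f de d) (he : Ev W inp S r f ee e)
    (hk' : k < Z) (ha' : a < Z) (hb' : b < Z) (hc' : c < Z) (hd' : d < Z) (he' : e < Z) :
    Ev W inp S r f (encE ke ae be ce de ee) (enc Z k a b c d e) := by
  have hlt := (enc_lt hk' ha' hb' hc' hd' he').trans_le hW
  have step : ∀ x y, (x + y) * Z < W → x + y < W := fun x y h =>
    (Nat.le_mul_of_pos_right _ (by omega)).trans_lt h
  have step' : ∀ x y, x + y < W → x < W := fun x y h => by omega
  unfold WordRAM.enc at hlt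
  have h5 := step' _ _ hlt
  have h4 := step _ _ h5
  have h4' := step' _ _ h4
  have h3 := step _ _ h4'
  have h3' := step' _ _ h3
  have h2 := step _ _ h3'
  have h2' := step' _ _ h2
  have h1 := step _ _ h2'
  have h1' := step' _ _ h1
  exact (((((((((hk.mul (.reg hZ) h1').add ha h1).mul (.reg hZ) h2').add hb h2).mul
    (.reg hZ) h3').add hc h3).mul (.reg hZ) h4').add hd h4).mul (.reg hZ) h5).add he hlt

/-- The memory `μ` holds a similarity search structure: the dictionary `F`, the bins and ranks of
`M` slots, the verification sketches `vs` of `N` sets, and room for the work of a query. -/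
structure Img (p : Params) (W S M t N : ℕ) (μ F bin rk : ℕ → ℕ) (vs : ℕ → ℕ → ℕ) : Prop where
  dict : DictOK μ p.wb p.P p.a p.s p.D1 p.D2 F
  hdr : ∀ i < 24, μ i = p.hdr.getD i 0
  le_wb : 24 ≤ p.wb
  le_cb : p.wb + t ≤ p.cb
  le_S : p.cb + p.G ≤ S
  S_lt : S < p.Z
  ZP : p.Z ^ 6 ≤ p.P
  PW : p.P * p.P < W
  slot : ∀ x < M, μ (p.hs + 2 * x) = bin x ∧ μ (p.hs + 2 * x + 1) = rk x ∧
    p.hs + 2 * x + 1 < p.wb ∧ bin x < t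
  M_lt : M < p.Z
  init : ∀ l < t, μ (p.wb + l) = M
  G_eq : p.G = 3 * p.m
  vb_eq : p.vb = p.G * p.K
  t_eq : t = p.vb + p.T
  L_eq : p.L = p.m * p.m * p.m
  L_lt : p.L < p.Z
  ver : ∀ i < N, ∀ e < p.T, μ (p.ver + (i * p.T + e)) = vs i e ∧ p.ver + (i * p.T + e) < p.wb
  F_lt : ∀ x, F x < p.Z
  Φ_lt : p.Φ < p.Z
  ζ_lt : p.ζ < p.Φ
  K_lt : p.K < p.Z

namespace Img

variable {p : Params} {M t N : ℕ} {μ F bin rk : ℕ → ℕ} {vs : ℕ → ℕ → ℕ}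

theorem two_lt (h : Img p W S M t N μ F bin rk vs) : 24 < p.Z := by
  have := h.S_lt; have := h.le_S; have := h.le_cb; have := h.le_wb; omega

theorem ZZ_lt (h : Img p W S M t N μ F bin rk vs) : p.Z * p.Z < W := by
  have h2 := h.two_lt
  have h1 : p.Z * p.Z ≤ p.Z ^ 6 := by
    rw [← sq]; exact Nat.pow_le_pow_right (by omega) (by norm_num)
  have h3 := h.ZP
  have h4 := h.PW
  have h5 : p.P ≤ p.P * p.P := Nat.le_mul_self _
  omega

theorem Z6_le (h : Img p W S M t N μ F bin rk vs) : p.Z ^ 6 ≤ W := by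
  have h3 := h.ZP
  have h4 := h.PW
  have h5 : p.P ≤ p.P * p.P := Nat.le_mul_self _
  omega

theorem Z_lt (h : Img p W S M t N μ F bin rk vs) : 2 * p.Z < W := by
  have h2 := h.two_lt
  have h1 := h.ZZ_lt
  have : 2 * p.Z ≤ p.Z * p.Z := Nat.mul_le_mul_right _ (by omega)
  omega

end Img

/-- Inserts the slots `R₆, …, R₆ + R₁₁ - 1` into the sketch of the query. -/
def insertBlock : Prog :=
  .seq (.assign 7 (.lit 0)) (.while (.op .lt (.reg 7) (.reg 11))
    (.seq (.assign 8 (.load (.reg 26 + .lit 2 * (.reg 6 + .reg 7))))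
      (.seq (.assign 9 (.load (.reg 26 + .lit 2 * (.reg 6 + .reg 7) + .lit 1)))
        (.seq (.ite (.op .lt (.reg 9) (.load (.reg 27 + .reg 8)))
            (.store (.reg 27 + .reg 8) (.reg 9)) .skip)
          (.assign 7 (.reg 7 + .lit 1))))))

variable {p : Params} {M t N : ℕ} {μ F bin rk : ℕ → ℕ} {vs : ℕ → ℕ → ℕ}

theorem insertBlock_spec (h : Img p W S M t N μ F bin rk vs) (hr : p.Held r)
    (hf : ∀ a < p.wb, f a = μ a) (X : Finset ℕ) (hX : ∀ l < t, f (p.wb + l) = sketch bin rk M X l)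
    {R base : ℕ} (hR : r 11 = R) (hb : r 6 = base) (hM : base + R ≤ M) :
    Tr W inp S insertBlock r f (2 + (R + 1) * 50) fun r' f' =>
      (∀ x, x ≠ 7 → x ≠ 8 → x ≠ 9 → r' x = r x) ∧ (∀ a < p.wb, f' a = μ a) ∧
      ∀ l < t, f' (p.wb + l) = sketch bin rk M (X ∪ Finset.Ico base (base + R)) l := by
  have hMZ := h.M_lt
  have hZW := h.Z_lt
  have hSZ := h.S_lt
  have h24 := h.two_lt
  have hcS := h.le_S
  have hcb := h.le_cb
  refine Tr.assign_seq ((R + 1) * 50) (Ev.lit (by omega)) ?_ (by simp [Exp.cost])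
  refine (Tr.for (i := 7) (lim := .reg 11) (N := R) (B := 46) (fun k r' f' => r' 7 = k ∧
      (∀ x, x ≠ 7 → x ≠ 8 → x ≠ 9 → r' x = r x) ∧ (∀ a < p.wb, f' a = μ a) ∧
      ∀ l < t, f' (p.wb + l) = sketch bin rk M (X ∪ Finset.Ico base (base + k)) l) (by omega)
      ?_ ?_ ?_).mono (by simp [Exp.cost]) fun r' f' h => h.2
  · rintro k r' f' - ⟨h1, h2, -⟩
    exact ⟨h1, .reg (by rw [h2 11 (by decide) (by decide) (by decide), hR])⟩
  · rintro k r' f' hk ⟨h1, h2, h3, h4⟩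
    have e6 : r' 6 = base := by rw [h2 6 (by decide) (by decide) (by decide), hb]
    have hr' : ∀ x, 20 ≤ x → r' x = r x := fun x hx => h2 x (by omega) (by omega) (by omega)
    have e26 : r' 26 = p.hs := (hr.congr hr') 6 (by norm_num)
    have e27 : r' 27 = p.wb := (hr.congr hr') 7 (by norm_num)
    obtain ⟨s1, s2, s3, s4⟩ := h.slot (base + k) (by omega)
    refine Tr.assign_seq 36 (v := bin (base + k)) (Ev.load (Ev.add (.reg e26) (Ev.mul (.lit (by omega))
      (Ev.add (.reg e6) (.reg h1) (by omega)) (by omega)) (by omega)) (by omega)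
      (by rw [h3 _ (by omega), s1])) ?_ (by decide)
    refine Tr.assign_seq 24 (v := rk (base + k)) (Ev.load (Ev.add (Ev.add (.reg (by simpa using e26))
      (Ev.mul (.lit (by omega))
      (Ev.add (.reg (by simpa using e6)) (.reg (by simpa using h1)) (by omega)) (by omega)) (by omega))
      (.lit (by omega)) (by omega)) (by omega)
      (by rw [h3 _ (by omega), s2])) ?_ (by decide)
    refine Tr.seq (B := 24) 13 4 ?_ (by decide)
    set r2 := Function.update (Function.update r' 8 (bin (base + k))) 9 (rk (base + k)) with hr2
    have hcell : Ev W inp S r2 f' (.reg 27 + .reg 8) (p.wb + bin (base + k)) :=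
      Ev.add (.reg (by simpa [hr2] using e27)) (.reg (by simp [hr2])) (by omega)
    have key : ∀ l, sketch bin rk M (X ∪ Finset.Ico base (base + (k + 1))) l =
        if bin (base + k) = l then min (rk (base + k)) (sketch bin rk M (X ∪ Finset.Ico base (base + k)) l)
        else sketch bin rk M (X ∪ Finset.Ico base (base + k)) l := by
      intro l
      rw [← sketch_insert, ← Finset.union_insert, ← add_assoc, Finset.insert_Ico_right_eq_Ico_add_one (by omega)]
    have fin : ∀ f'' : ℕ → ℕ, (∀ a < p.wb, f'' a = μ a) →
        (∀ l < t, f'' (p.wb + l) = sketch bin rk M (X ∪ Finset.Ico base (base + (k + 1))) l) →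
        Tr W inp S (.assign 7 (.reg 7 + .lit 1)) r2 f'' 4 fun r' f' => r' 7 = k + 1 ∧
      (∀ x, x ≠ 7 → x ≠ 8 → x ≠ 9 → r' x = r x) ∧ (∀ a < p.wb, f' a = μ a) ∧
      ∀ l < t, f' (p.wb + l) = sketch bin rk M (X ∪ Finset.Ico base (base + (k + 1))) l := by
      intro f'' g1 g2
      refine Tr.assign (Ev.add (.reg (by simpa [hr2] using h1)) (.lit (by omega)) (by omega))
        ⟨by simp, ?_, g1, g2⟩ (by decide)
      intro x h7 h8 h9
      simp [hr2, h7, h8, h9, h2]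
    refine Tr.ite 5 (Ev.lt (.reg (v := rk (base + k)) (by simp [hr2])) (Ev.load hcell (by omega) (h4 _ s4)) (by omega))
      (fun hc => ?_) (fun hc => ?_) (by decide)
    · refine Tr.store hcell (by omega) (Ev.reg (v := rk (base + k)) (by simp [hr2])) (fin _ ?_ ?_) (by decide)
      · intro a ha
        rw [Function.update_of_ne (by omega), h3 a ha]
      · intro l hl
        rw [key]
        split_ifs with hl'
        · subst hl'; simp [hc.le]
        · rw [Function.update_of_ne (by omega), h4 l hl]
    · refine Tr.skip (fin _ h3 ?_) (by decide)
      intro l hl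
      rw [key]
      split_ifs with hl'
      · subst hl'; rw [h4 _ hl, min_eq_right (not_lt.1 hc)]
      · exact h4 l hl
  · refine ⟨by simp, ?_, hf, by simpa using hX⟩
    intro x h7 _ _
    simp [h7]

/-- The first slot of the `i`-th element of the query. -/
def blockBase (F : ℕ → ℕ) (Z mode pool R : ℕ) (inp : List ℕ) (i : ℕ) : ℕ :=
  if F (enc Z 0 mode (inp.getD i 0) 0 0 0) = 0 then pool + R * i
  else F (enc Z 0 mode (inp.getD i 0) 0 0 0) - 1

/-- The slots of the first `i` elements of the query. -/
def slotsOf (F : ℕ → ℕ) (Z mode pool R : ℕ) (inp : List ℕ) (i : ℕ) : Finset ℕ :=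
  (Finset.range i).biUnion fun j =>
    Finset.Ico (blockBase F Z mode pool R inp j) (blockBase F Z mode pool R inp j + R)

/-- Computes the sketch of the query. -/
def sketchProg : Prog :=
  .seq (.assign 4 (.lit 0)) (.while (.op .lt (.reg 4) .inputLen)
    (.seq (.assign 1 (encE (.lit 0) (.reg 10) (.input (.reg 4)) (.lit 0) (.lit 0) (.lit 0)))
      (.seq lookup
        (.seq (.ite (.op .eq (.reg 3) (.lit 0)) (.assign 6 (.reg 12 + .reg 11 * .reg 4))
            (.assign 6 (.reg 3 - .lit 1)))
          (.seq insertBlock (.assign 4 (.reg 4 + .lit 1)))))))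

/-- The dictionary holds the first slot of a known element plus one, so that `0` means unknown. An
unknown element gets the fresh block whose number is its position in the query. The time is
proportional to the number of inserted slots. -/
theorem sketchProg_spec (h : Img p W S M t N μ F bin rk vs) (hr : p.Held r)
    (hf : ∀ a < S, f a = μ a) {R mode pool : ℕ} (hR : r 11 = R) (hmode : r 10 = mode)
    (hpool : r 12 = pool) (hmodeZ : mode < p.Z) (hlen : inp.length < p.Z) (hR0 : 0 < R)
    (hinp : ∀ x ∈ inp, x < p.Z)
    (hM : ∀ i < inp.length, blockBase F p.Z mode pool R inp i + R ≤ M) :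
    Tr W inp S sketchProg r f (2 + (inp.length + 1) * (150 + (R + 1) * 50)) fun r' f' =>
      (∀ x, (x = 0 ∨ 10 ≤ x) → r' x = r x) ∧ (∀ a < p.wb, f' a = μ a) ∧
      ∀ l < t, f' (p.wb + l) = sketch bin rk M (slotsOf F p.Z mode pool R inp inp.length) l := by
  have hMZ := h.M_lt
  have hZW := h.Z_lt
  have hSZ := h.S_lt
  have h24 := h.two_lt
  have hcS := h.le_S
  have hcb := h.le_cb
  refine Tr.assign_seq ((inp.length + 1) * (150 + (R + 1) * 50)) (Ev.lit (by omega)) ?_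
    (by simp [Exp.cost])
  refine (Tr.for (i := 4) (lim := .inputLen) (N := inp.length) (B := 146 + (R + 1) * 50)
    (fun k r' f' => r' 4 = k ∧
      (∀ x, (x = 0 ∨ 10 ≤ x) → r' x = r x) ∧ (∀ a < p.wb, f' a = μ a) ∧
      ∀ l < t, f' (p.wb + l) = sketch bin rk M (slotsOf F p.Z mode pool R inp k) l) (by omega)
      ?_ ?_ ?_).mono (Nat.mul_le_mul_left _ (by simp [Exp.cost]; omega)) fun r' f' h => h.2
  · rintro k r' f' - ⟨h1, -⟩
    exact ⟨h1, .inputLen (by omega)⟩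
  · rintro k r' f' hk ⟨h1, h2, h3, h4⟩
    have hH : p.Held r' := hr.congr fun x hx => h2 x (by omega)
    have hq : inp[k] < p.Z := hinp _ (List.getElem_mem hk)
    have hg : inp.getD k 0 = inp[k] := by simp [hk]
    refine Tr.assign_seq (v := enc p.Z 0 mode (inp.getD k 0) 0 0 0) (110 + (R + 1) * 50)
      (Ev.enc (hH 5 (by norm_num)) h.Z6_le (.lit (by omega))
      (.reg (by rw [h2 10 (by omega), hmode])) (by rw [hg]; exact Ev.input (.reg h1) hk (by omega))
      (.lit (by omega)) (.lit (by omega)) (.lit (by omega)) (by omega) hmodeZ (by omega)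
      (by omega) (by omega) (by omega)) ?_ (by
        have : (encE (.lit 0) (.reg 10) (.input (.reg 4)) (.lit 0) (.lit 0) (.lit 0)).cost ≤ 30 := by decide
        omega)
    set key := enc p.Z 0 mode (inp.getD k 0) 0 0 0 with hkey
    have hkP : key < p.P := (enc_lt (by omega) hmodeZ (by omega) (by omega) (by omega)
      (by omega)).trans_le h.ZP
    refine Tr.seq 50 (60 + (R + 1) * 50) ((lookup_spec h.dict h3 (by omega) (by omega) h.PW
      (hH.update (by norm_num)) (by simpa using hkP)).mono le_rfl ?_) (by omega)
    rintro r2 f2 ⟨rfl, g1, g2⟩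
    rw [Function.update_self] at g1
    have g2' : ∀ x, x ≠ 1 → x ≠ 2 → x ≠ 3 → r2 x = r' x := fun x a b c => by
      rw [g2 x b c, Function.update_of_ne a]
    have e11 : r2 11 = R := by rw [g2' 11 (by decide) (by decide) (by decide), h2 11 (by omega), hR]
    have e12 : r2 12 = pool := by
      rw [g2' 12 (by decide) (by decide) (by decide), h2 12 (by omega), hpool]
    have e4 : r2 4 = k := by rw [g2' 4 (by decide) (by decide) (by decide), h1]
    have hbb := hM k hk
    have hbase : blockBase F p.Z mode pool R inp k = if F key = 0 then pool + R * k else F key - 1 := rfl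
    have main : Tr W inp S (.seq insertBlock (.assign 4 (.reg 4 + .lit 1)))
        (Function.update r2 6 (blockBase F p.Z mode pool R inp k)) f2 (10 + (R + 1) * 50)
        fun r' f' => r' 4 = k + 1 ∧
      (∀ x, (x = 0 ∨ 10 ≤ x) → r' x = r x) ∧ (∀ a < p.wb, f' a = μ a) ∧
      ∀ l < t, f' (p.wb + l) = sketch bin rk M (slotsOf F p.Z mode pool R inp (k + 1)) l := by
      refine Tr.seq (2 + (R + 1) * 50) 4 ((insertBlock_spec h ?_ h3 _ h4 (R := R)
        (base := blockBase F p.Z mode pool R inp k) (by simpa using e11) (by simp) hbb).mono le_rfl ?_)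
        (by omega)
      · exact (hH.congr fun x hx => g2' x (by omega) (by omega) (by omega)).update (by norm_num)
      · rintro r3 f3 ⟨i1, i2, i3⟩
        refine Tr.assign (v := k + 1) (Ev.add (.reg ?_) (.lit (by omega)) (by omega))
          ⟨by simp, ?_, i2, ?_⟩ (by decide)
        · rw [i1 4 (by decide) (by decide) (by decide), Function.update_of_ne (by decide), e4]
        · intro x hx
          rw [Function.update_of_ne (by omega), i1 x (by omega) (by omega) (by omega),
            Function.update_of_ne (by omega), g2' x (by omega) (by omega) (by omega), h2 x hx]
        · intro l hl
          rw [i3 l hl]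
          congr 1
          rw [slotsOf, slotsOf, Finset.range_add_one, Finset.biUnion_insert, Finset.union_comm]
    refine Tr.seq 12 (20 + (R + 1) * 50) ?_ (by omega)
    refine Tr.ite 8 (Ev.eq (.reg g1) (.lit (by omega)) (by omega)) (fun hc => ?_) (fun hc => ?_)
      (by decide)
    · rw [if_pos hc] at hbase
      have : R * k ≤ pool + R * k := Nat.le_add_left _ _
      exact Tr.assign (v := blockBase F p.Z mode pool R inp k) ((Ev.add (.reg e12) (Ev.mul (.reg e11)
        (.reg e4) (by omega)) (by omega)).congr hbase.symm) (main.mono (by omega) fun _ _ h => h)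
        (by decide)
    · rw [if_neg hc] at hbase
      have := h.F_lt key
      exact Tr.assign (v := blockBase F p.Z mode pool R inp k) ((Ev.sub (.reg g1) (.lit (by omega))
        (by omega)).congr hbase.symm) (main.mono (by omega) fun _ _ h => h)
        (by decide)
  · refine ⟨by simp, ?_, fun a ha => hf a (by omega), ?_⟩
    · intro x hx
      rw [Function.update_of_ne (by omega)]
    · intro l hl
      -- The stored image already has the default `M` in every bin, which is the sketch of the empty
      -- set; no time goes into clearing.
      rw [hf _ (by omega), h.init l hl]
      simp [slotsOf, sketch]

end

/-! ### Classes, verification and the scan of the candidates -/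

/-- The class of the `l`-prefix of the `g`-th chunk of the sketch `b`. -/
def cls (F : ℕ → ℕ) (Z : ℕ) (b : ℕ → ℕ) (K g : ℕ) : ℕ → ℕ
  | 0 => 1
  | l + 1 => F (enc Z 1 g l (cls F Z b K g l) (b (g * K + l)) 0)

theorem cls_lt {F : ℕ → ℕ} {Z : ℕ} (hF : ∀ x, F x < Z) (hZ : 1 < Z) (b : ℕ → ℕ) (K g l : ℕ) :
    cls F Z b K g l < Z := by
  cases l with
  | zero => exact hZ
  | succ l => exact hF _

/-- Computes the classes of all chunks. -/
def classProg : Prog :=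
  .seq (.assign 4 (.lit 0)) (.while (.op .lt (.reg 4) (.reg 42))
    (.seq (.assign 3 (.lit 1)) (.seq (.assign 5 (.lit 0))
      (.seq (.while (.op .lt (.reg 5) (.reg 30))
        (.seq (.assign 1 (encE (.lit 1) (.reg 4) (.reg 5) (.reg 3)
            (.load (.reg 27 + (.reg 4 * .reg 30 + .reg 5))) (.lit 0)))
          (.seq lookup (.assign 5 (.reg 5 + .lit 1)))))
        (.seq (.store (.reg 28 + .reg 4) (.reg 3)) (.assign 4 (.reg 4 + .lit 1)))))))

/-- The number of verification bins where the stored sketch of the set `x` agrees with `b`. -/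
def agreeCount (vs : ℕ → ℕ → ℕ) (b : ℕ → ℕ) (vb T x : ℕ) : ℕ :=
  ((Finset.range T).filter fun e => vs x e = b (vb + e)).card

/-- Counts the agreements of the candidate with the query. -/
def countProg : Prog :=
  .seq (.assign 8 (.lit 0)) (.seq (.assign 7 (.lit 0)) (.while (.op .lt (.reg 7) (.reg 34))
    (.seq (.ite (.op .eq (.load (.reg 36 + ((.reg 3 - .lit 1) * .reg 34 + .reg 7)))
        (.load (.reg 27 + (.reg 43 + .reg 7)))) (.assign 8 (.reg 8 + .lit 1)) .skip)
      (.assign 7 (.reg 7 + .lit 1)))))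

/-- Scans the candidates. -/
def scanProg : Prog :=
  .seq (.assign 4 (.lit 0)) (.seq (.assign 5 (.lit 0)) (.seq (.assign 6 (.lit 0))
    (.while (.op .lt (.reg 4) (.reg 31) * .op .lt (.reg 6) (.reg 32))
      (.seq (.assign 1 (encE (.lit 2) (.reg 4) (.load (.reg 28 + .reg 4 % .reg 29))
          (.load (.reg 28 + (.reg 29 + .reg 4 / .reg 29 % .reg 29)))
          (.load (.reg 28 + (.reg 29 + .reg 29 + .reg 4 / (.reg 29 * .reg 29) % .reg 29)))
          (.reg 5)))
        (.seq lookup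
          (.ite (.op .eq (.reg 3) (.lit 0))
            (.seq (.assign 4 (.reg 4 + .lit 1)) (.assign 5 (.lit 0)))
            (.seq countProg
              (.ite (.op .lt (.reg 8) (.reg 35))
                (.seq (.ite (.op .eq (.reg 6) (.reg 33))
                    (.assign 0 ((.reg 3 - .lit 1) % .reg 37)) .skip)
                  (.seq (.assign 6 (.reg 6 + .lit 1)) (.assign 5 (.reg 5 + .lit 1))))
                (.seq (.assign 0 ((.reg 3 - .lit 1) % .reg 37)) (.assign 4 (.reg 31)))))))))))

section

variable {W : ℕ} {inp : List ℕ} {S : ℕ} {r f : ℕ → ℕ}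
  {p : Params} {M t N : ℕ} {μ F bin rk : ℕ → ℕ} {vs : ℕ → ℕ → ℕ}

theorem classProg_spec (h : Img p W S M t N μ F bin rk vs) (hr : p.Held r)
    (hf : ∀ a < p.wb, f a = μ a) {b : ℕ → ℕ} (hb : ∀ l < t, f (p.wb + l) = b l)
    (hbZ : ∀ l < t, b l < p.Z) :
    Tr W inp S classProg r f (2 + (p.G + 1) * (40 + (p.K + 1) * 100)) fun r' f' =>
      (∀ x, (x = 0 ∨ 10 ≤ x) → r' x = r x) ∧ (∀ a < p.wb, f' a = μ a) ∧
      (∀ l < t, f' (p.wb + l) = b l) ∧ ∀ g < p.G, f' (p.cb + g) = cls F p.Z b p.K g p.K := by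
  have hZW := h.Z_lt
  have hSZ := h.S_lt
  have h24 := h.two_lt
  have hcS := h.le_S
  have hcb := h.le_cb
  have hKZ := h.K_lt
  refine Tr.assign_seq ((p.G + 1) * (40 + (p.K + 1) * 100)) (Ev.lit (by omega)) ?_
    (by simp [Exp.cost])
  refine (Tr.for (i := 4) (lim := .reg 42) (N := p.G) (B := 36 + (p.K + 1) * 100)
    (fun k r' f' => r' 4 = k ∧
      (∀ x, (x = 0 ∨ 10 ≤ x) → r' x = r x) ∧ (∀ a < p.wb, f' a = μ a) ∧
      (∀ l < t, f' (p.wb + l) = b l) ∧ ∀ g < k, f' (p.cb + g) = cls F p.Z b p.K g p.K) (by omega)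
      ?_ ?_ ?_).mono (Nat.mul_le_mul_left _ (by simp [Exp.cost]; omega)) fun r' f' h => h.2
  · rintro k r' f' - ⟨h1, h2, -⟩
    exact ⟨h1, .reg (by rw [h2 42 (by omega)]; exact hr 22 (by norm_num))⟩
  · rintro g r1 f1 hg ⟨h1, h2, h3, h4, h5⟩
    refine Tr.assign_seq (34 + (p.K + 1) * 100) (Ev.lit (k := 1) (by omega)) ?_
      (by simp [Exp.cost]; omega)
    refine Tr.assign_seq (32 + (p.K + 1) * 100) (Ev.lit (k := 0) (by omega)) ?_
      (by simp [Exp.cost]; omega)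
    refine Tr.seq ((p.K + 1) * 100) 20 ?_ (by omega)
    refine (Tr.for (i := 5) (lim := .reg 30) (N := p.K) (B := 96)
      (fun l r' f' => r' 5 = l ∧ r' 3 = cls F p.Z b p.K g l ∧ r' 4 = g ∧ f' = f1 ∧
      (∀ x, (x = 0 ∨ 10 ≤ x) → r' x = r x)) (by omega)
      ?_ ?_ ?_).mono (Nat.mul_le_mul_left _ (by simp [Exp.cost])) ?_
    · rintro k r' f' - ⟨i1, -, -, -, i2⟩
      exact ⟨i1, .reg (by rw [i2 30 (by omega)]; exact hr 10 (by norm_num))⟩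
    · rintro l r2 f2 hl ⟨i1, i2, i3, rfl, i4⟩
      have hH : p.Held r2 := hr.congr fun x hx => i4 x (by omega)
      have hidx : g * p.K + l < p.vb := by
        have h1 : (g + 1) * p.K ≤ p.G * p.K := Nat.mul_le_mul_right _ hg
        rw [h.vb_eq]
        linarith
      have hvt : p.vb ≤ t := by rw [h.t_eq]; omega
      have e30 : r2 30 = p.K := hH 10 (by norm_num)
      have e27 : r2 27 = p.wb := hH 7 (by norm_num)
      have hc := cls_lt h.F_lt (by omega : 1 < p.Z) b p.K g l
      have hbl := hbZ (g * p.K + l) (by omega)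
      refine Tr.assign_seq (v := enc p.Z 1 g l (cls F p.Z b p.K g l) (b (g * p.K + l)) 0) 60
        (Ev.enc (hH 5 (by norm_num)) h.Z6_le (.lit (by omega)) (.reg i3) (.reg i1) (.reg i2)
          (Ev.load (Ev.add (.reg e27) (Ev.add (Ev.mul (.reg i3)
            (.reg e30) (by omega)) (.reg i1) (by omega)) (by omega)) (by omega)
            (h4 _ (by omega))) (.lit (by omega)) (by omega) (by omega)
          (by omega) hc hbl (by omega)) ?_ (by decide)
      set key := enc p.Z 1 g l (cls F p.Z b p.K g l) (b (g * p.K + l)) 0 with hkey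
      have hkP : key < p.P := (enc_lt (by omega) (by omega) (by omega) hc hbl
        (by omega)).trans_le h.ZP
      refine Tr.seq 50 4 ((lookup_spec h.dict h3 (by omega) (by omega) h.PW
        (hH.update (by norm_num)) (by simpa using hkP)).mono le_rfl ?_) (by omega)
      rintro r3 f3 ⟨rfl, g1, g2⟩
      rw [Function.update_self] at g1
      refine Tr.assign (Ev.add (.reg (v := l) ?_) (.lit (by omega)) (by omega))
        ⟨by simp, ?_, ?_, rfl, ?_⟩ (by decide)
      · rw [g2 5 (by decide) (by decide), Function.update_of_ne (by decide), i1]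
      · rw [Function.update_of_ne (by decide), g1]; rfl
      · rw [Function.update_of_ne (by decide), g2 4 (by decide) (by decide),
          Function.update_of_ne (by decide), i3]
      · intro x hx
        rw [Function.update_of_ne (by omega), g2 x (by omega) (by omega),
          Function.update_of_ne (by omega), i4 x hx]
    · refine ⟨by simp, by simp [cls], by simpa using h1, rfl, ?_⟩
      intro x hx
      rw [Function.update_of_ne (by omega), Function.update_of_ne (by omega), h2 x hx]
    · rintro r2 f2 ⟨-, i2, i3, rfl, i4⟩
      have hH : p.Held r2 := hr.congr fun x hx => i4 x (by omega)
      refine Tr.seq 5 4 ?_ (by omega)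
      refine Tr.store (i := p.cb + g) (Ev.add (.reg (hH 8 (by norm_num))) (.reg i3)
        (by show p.cb + g < W; omega)) (by omega) (.reg i2) ?_ (by decide)
      refine Tr.assign (Ev.add (.reg i3) (.lit (by omega)) (by omega))
        ⟨by simp, ?_, ?_, ?_, ?_⟩ (by decide)
      · intro x hx
        rw [Function.update_of_ne (by omega), i4 x hx]
      · intro a ha
        rw [Function.update_of_ne (by omega), h3 a ha]
      · intro l hl
        rw [Function.update_of_ne (by omega), h4 l hl]
      · intro g' hg'
        rcases Nat.lt_succ_iff_lt_or_eq.1 hg' with hlt | rfl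
        · rw [Function.update_of_ne (by omega), h5 g' hlt]
        · simp
  · refine ⟨by simp, ?_, hf, hb, by simp⟩
    intro x hx
    rw [Function.update_of_ne (by omega)]

theorem countProg_spec (h : Img p W S M t N μ F bin rk vs) (hr : p.Held r)
    (hf : ∀ a < p.wb, f a = μ a) {b : ℕ → ℕ} (hb : ∀ l < t, f (p.wb + l) = b l)
    {i : ℕ} (hi : i < N) (h3 : r 3 = i + 1) :
    Tr W inp S countProg r f (4 + (p.T + 1) * 40) fun r' f' =>
      f' = f ∧ r' 8 = agreeCount vs b p.vb p.T i ∧ ∀ x, x ≠ 7 → x ≠ 8 → r' x = r x := by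
  have hZW := h.Z_lt
  have hSZ := h.S_lt
  have h24 := h.two_lt
  have hcS := h.le_S
  have hcb := h.le_cb
  have hTt := h.t_eq
  refine Tr.assign_seq (2 + (p.T + 1) * 40) (Ev.lit (by omega)) ?_ (by simp [Exp.cost]; omega)
  refine Tr.assign_seq ((p.T + 1) * 40) (Ev.lit (by omega)) ?_ (by simp [Exp.cost])
  refine (Tr.for (i := 7) (lim := .reg 34) (N := p.T) (B := 36)
    (fun k r' f' => r' 7 = k ∧ f' = f ∧ r' 8 = agreeCount vs b p.vb k i ∧
      ∀ x, x ≠ 7 → x ≠ 8 → r' x = r x) (by omega)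
      ?_ ?_ ?_).mono (Nat.mul_le_mul_left _ (by simp [Exp.cost])) fun r' f' h => h.2
  · rintro k r' f' - ⟨h1, -, -, h2⟩
    exact ⟨h1, .reg (by rw [h2 34 (by omega) (by omega)]; exact hr 14 (by norm_num))⟩
  · rintro k r1 f1 hk ⟨h1, rfl, h8, h2⟩
    have hH : p.Held r1 := hr.congr fun x hx => h2 x (by omega) (by omega)
    obtain ⟨v1, v2⟩ := h.ver i hi k hk
    have e3 : r1 3 = i + 1 := by rw [h2 3 (by omega) (by omega), h3]
    -- The index `i` is bounded only through the address containing `i * T`, which is of use if `T ≠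
    -- 0`; here `k < T`.
    have hN : i + 1 < W ∨ p.T = 0 := by
      by_cases h0 : p.T = 0
      · exact .inr h0
      · left
        have := Nat.le_mul_of_pos_right i (Nat.pos_of_ne_zero h0)
        omega
    have hk8 : agreeCount vs b p.vb k i ≤ k := (Finset.card_filter_le _ _).trans (by simp)
    have hadd : agreeCount vs b p.vb (k + 1) i =
        if vs i k = b (p.vb + k) then agreeCount vs b p.vb k i + 1 else agreeCount vs b p.vb k i := by
      unfold agreeCount
      rw [Finset.range_add_one, Finset.filter_insert]
      split_ifs
      · rw [Finset.card_insert_of_notMem (by simp)]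
      · rfl
    have fin : ∀ c : ℕ, c = agreeCount vs b p.vb (k + 1) i → ∀ r2 : ℕ → ℕ, r2 8 = c →
        (∀ x, x ≠ 8 → r2 x = r1 x) →
        Tr W inp S (.assign 7 (.reg 7 + .lit 1)) r2 f1 4 (fun r' f' => r' 7 = k + 1 ∧ f' = f1 ∧
          r' 8 = agreeCount vs b p.vb (k + 1) i ∧ ∀ x, x ≠ 7 → x ≠ 8 → r' x = r x) := by
      rintro c rfl r2 h8 hx
      refine Tr.assign (Ev.add (.reg (by rw [hx 7 (by omega), h1])) (.lit (by omega)) (by omega))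
        ⟨by simp, rfl, ?_, ?_⟩ (by decide)
      · rw [Function.update_of_ne (by omega), h8]
      · intro x h7 h8
        rw [Function.update_of_ne h7, hx x h8, h2 x h7 h8]
    refine Tr.seq 26 4 ?_ (by omega)
    refine Tr.ite (c := vs i k = b (p.vb + k)) 8 (Ev.eq
      (Ev.load (i := p.ver + (i * p.T + k)) (Ev.add (.reg (hH 16 (by norm_num))) (Ev.add (Ev.mul
        ((Ev.sub (.reg e3) (.lit (by omega)) (by omega)).congr (v' := i) (by omega)) (.reg (hH 14 (by norm_num)))
        (by show i * p.T < W; omega)) (.reg h1) (by show i * p.T + k < W; omega))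
        (by show p.ver + (i * p.T + k) < W; omega)) (by omega) (by rw [hf _ v2, v1]))
      (Ev.load (i := p.wb + (p.vb + k)) (Ev.add (.reg (hH 7 (by norm_num))) (Ev.add
        (.reg (hH 23 (by norm_num))) (.reg h1) (by show p.vb + k < W; omega))
        (by show p.wb + (p.vb + k) < W; omega)) (by omega)
      (hb _ (by omega))) (by omega)) (fun hc => ?_) (fun hc => ?_) (by decide)
    · rw [if_pos hc] at hadd
      refine Tr.assign (Ev.add (.reg h8) (.lit (by omega)) (by omega)) (fin _ hadd.symm _ (by simp) ?_) (by decide)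
      intro x hx
      rw [Function.update_of_ne hx]
    · rw [if_neg hc] at hadd
      exact Tr.skip (fin _ hadd.symm _ h8 fun _ _ => rfl) (by decide)
  · refine ⟨by simp, rfl, by simp [agreeCount], ?_⟩
    intro x h7 h8
    rw [Function.update_of_ne h7, Function.update_of_ne h8]

end

/-- The candidates of the tables `τ, …, L - 1`. -/
def candsFrom (cands : ℕ → List ℕ) (L τ : ℕ) : List ℕ := (List.range' τ (L - τ)).flatMap cands

theorem candsFrom_of_lt {cands : ℕ → List ℕ} {L τ : ℕ} (h : τ < L) :
    candsFrom cands L τ = cands τ ++ candsFrom cands L (τ + 1) := by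
  unfold candsFrom
  rw [show L - τ = (L - (τ + 1)) + 1 by omega, List.range'_succ, List.flatMap_cons]

theorem candsFrom_self {cands : ℕ → List ℕ} {L : ℕ} : candsFrom cands L L = [] := by
  simp [candsFrom]

section

variable {W : ℕ} {inp : List ℕ} {S : ℕ} {r f : ℕ → ℕ}
  {p : Params} {M t N : ℕ} {μ F bin rk : ℕ → ℕ} {vs : ℕ → ℕ → ℕ}

/-- Every round moves on to the next table, rejects a candidate or accepts one. So there are at most
`L + Φ` rounds, each with `T` comparisons, however many candidates exist. The three alternatives are
the ways to stop: a candidate was accepted, `Φ` of them were rejected, or the tables are exhausted.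
-/
theorem scanProg_spec (h : Img p W S M t N μ F bin rk vs) (hr : p.Held r)
    (hf : ∀ a < p.wb, f a = μ a) {b : ℕ → ℕ} (hb : ∀ l < t, f (p.wb + l) = b l)
    {z : ℕ → ℕ} (hz : ∀ g < p.G, f (p.cb + g) = z g) (hzZ : ∀ g < p.G, z g < p.Z)
    {cands : ℕ → List ℕ} (hN : ∀ τ < p.L, ∀ x ∈ cands τ, x < N)
    (hlen : ∀ τ < p.L, (cands τ).length < p.Z)
    (hF : ∀ τ < p.L, ∀ j ≤ (cands τ).length, F (enc p.Z 2 τ (z (τ % p.m))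
      (z (p.m + τ / p.m % p.m)) (z (p.m + p.m + τ / (p.m * p.m) % p.m)) j) =
      ((cands τ)[j]?.map (· + 1)).getD 0) :
    Tr W inp S scanProg r f (6 + (p.L + p.Φ + 1) * (300 + (p.T + 1) * 40)) fun r' _ =>
      (∃ x ∈ candsFrom cands p.L 0, p.Θ ≤ agreeCount vs b p.vb p.T x ∧ r' 0 = x % p.n) ∨
      (p.Φ ≤ (candsFrom cands p.L 0).length ∧
        ∃ x, (candsFrom cands p.L 0)[p.ζ]? = some x ∧ r' 0 = x % p.n) ∨
      ∀ x ∈ candsFrom cands p.L 0, agreeCount vs b p.vb p.T x < p.Θ := by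
  have hZW := h.Z_lt
  have hZZ := h.ZZ_lt
  have hSZ := h.S_lt
  have h24 := h.two_lt
  have hcS := h.le_S
  have hcb := h.le_cb
  have hLZ := h.L_lt
  have hΦZ := h.Φ_lt
  have hζ := h.ζ_lt
  set E := candsFrom cands p.L 0 with hE
  set Post : (ℕ → ℕ) → (ℕ → ℕ) → Prop := fun r' _ =>
      (∃ x ∈ E, p.Θ ≤ agreeCount vs b p.vb p.T x ∧ r' 0 = x % p.n) ∨
      (p.Φ ≤ E.length ∧ ∃ x, E[p.ζ]? = some x ∧ r' 0 = x % p.n) ∨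
      ∀ x ∈ E, agreeCount vs b p.vb p.T x < p.Θ with hPost
  set BB := (p.L + p.Φ + 1) * (300 + (p.T + 1) * 40) with hBB
  refine Tr.assign_seq (4 + BB) (Ev.lit (by omega)) ?_ (by simp [Exp.cost]; omega)
  refine Tr.assign_seq (2 + BB) (Ev.lit (by omega)) ?_ (by simp [Exp.cost]; omega)
  refine Tr.assign_seq BB (Ev.lit (by omega)) ?_ (by simp [Exp.cost])
  -- Register `4` is the table, `5` the position in its bucket, `6` the number of rejected
  -- candidates. `done` lists the rejected ones, a prefix of `E`; register `0` holds the answer for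
  -- position `ζ` as soon as `done` reaches beyond it.
  refine (Tr.while (fun k r' f' => (∀ x, 10 ≤ x → r' x = r x) ∧ f' = f ∧ r' 4 ≤ p.L ∧ r' 6 ≤ p.Φ ∧
      (p.L - r' 4) + (p.Φ - r' 6) = k ∧ ((r' 4 = p.L ∧ Post r' f') ∨ ∃ done : List ℕ,
        done.length = r' 6 ∧ E = done ++ (candsFrom cands p.L (r' 4)).drop (r' 5) ∧
        (r' 4 < p.L → r' 5 ≤ (cands (r' 4)).length) ∧
        (∀ x ∈ done, agreeCount vs b p.vb p.T x < p.Θ) ∧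
        ∀ x, done[p.ζ]? = some x → r' 0 = x % p.n))
      (B := 290 + (p.T + 1) * 40) ?_ (p.L + p.Φ) ?_).mono
      (Nat.mul_le_mul_left _ (by simp [Exp.cost]; omega)) fun r' f' h => h
  · rintro k r1 f1 ⟨h1, rfl, hτL, hcΦ, hk, hst⟩
    have hH : p.Held r1 := hr.congr fun x hx => h1 x (by omega)
    have e31 : r1 31 = p.L := hH 11 (by norm_num)
    have e32 : r1 32 = p.Φ := hH 12 (by norm_num)
    have hcond := Ev.mul (Ev.lt (W := W) (inp := inp) (S := S) (r := r1) (f := f1) (.reg (x := 4) rfl)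
      (.reg e31) (by omega)) (Ev.lt (.reg (x := 6) rfl) (.reg e32) (by omega))
      (by split_ifs <;> omega)
    by_cases hgo : r1 4 < p.L ∧ r1 6 < p.Φ
    swap
    · right
      refine ⟨hcond.congr (by
        split_ifs with c1 c2
        · exact absurd ⟨c1, c2⟩ hgo
        all_goals simp), ?_⟩
      rcases hst with ⟨-, h⟩ | ⟨done, d1, d2, d3, d4, d5⟩
      · exact h
      · by_cases hL : r1 4 < p.L
        · have hΦ : r1 6 = p.Φ := by
            by_contra hne
            exact hgo ⟨hL, by omega⟩
          refine .inr (.inl ⟨?_, ?_⟩)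
          · rw [d2, List.length_append]; omega
          · have hlt : p.ζ < done.length := by omega
            refine ⟨done[p.ζ], ?_, d5 _ (by simp [hlt])⟩
            rw [d2, List.getElem?_append_left hlt]; simp [hlt]
        · rw [show r1 4 = p.L by omega, candsFrom_self] at d2
          refine .inr (.inr ?_)
          rw [d2]
          simpa using d4
    left
    obtain ⟨hτ, hcnt⟩ := hgo
    refine ⟨1, hcond.congr (by simp [hτ, hcnt]), one_ne_zero, ?_⟩
    rcases hst with ⟨h, -⟩ | ⟨done, d1, d2, d3, d4, d5⟩
    · omega
    replace d3 := d3 hτ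
    set τ := r1 4 with hτdef
    have hm : 0 < p.m := by
      rcases Nat.eq_zero_or_pos p.m with h0 | h0
      · rw [h.L_eq, h0] at hτ; omega
      · exact h0
    have hG := h.G_eq
    have e25 : r1 25 = p.Z := hH 5 (by norm_num)
    have e28 : r1 28 = p.cb := hH 8 (by norm_num)
    have e29 : r1 29 = p.m := hH 9 (by norm_num)
    have m1 : τ % p.m < p.m := Nat.mod_lt _ hm
    have m2 : τ / p.m % p.m < p.m := Nat.mod_lt _ hm
    have m3 : τ / (p.m * p.m) % p.m < p.m := Nat.mod_lt _ hm
    have t2 : τ / p.m ≤ τ := Nat.div_le_self _ _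
    have t3 : τ / (p.m * p.m) ≤ τ := Nat.div_le_self _ _
    have hmm : p.m * p.m < W := (Nat.mul_le_mul (by omega : p.m ≤ p.Z) (by omega : p.m ≤ p.Z)).trans_lt hZZ
    have hj : r1 5 < p.Z := d3.trans_lt (hlen τ hτ)
    have z1 := hzZ (τ % p.m) (by omega)
    have z2 := hzZ (p.m + τ / p.m % p.m) (by omega)
    have z3 := hzZ (p.m + p.m + τ / (p.m * p.m) % p.m) (by omega)
    refine Tr.assign_seq (v := enc p.Z 2 τ (z (τ % p.m))
      (z (p.m + τ / p.m % p.m)) (z (p.m + p.m + τ / (p.m * p.m) % p.m)) (r1 5))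
      (200 + (p.T + 1) * 40) (Ev.enc e25 h.Z6_le (.lit (by omega)) (.reg hτdef.symm)
        (Ev.load (Ev.add (.reg e28) (Ev.mod (.reg hτdef.symm) (.reg e29) (by omega)) (by omega)) (by omega)
          (hz _ (by omega)))
        (Ev.load (Ev.add (.reg e28) (Ev.add (.reg e29) (Ev.mod (Ev.div (.reg hτdef.symm) (.reg e29) (by omega))
          (.reg e29) (by omega)) (by omega)) (by omega)) (by omega)
          (hz _ (by omega)))
        (Ev.load (Ev.add (.reg e28) (Ev.add (Ev.add (.reg e29) (.reg e29) (by omega))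
          (Ev.mod (Ev.div (.reg hτdef.symm) (Ev.mul (.reg e29) (.reg e29) hmm) (by omega))
          (.reg e29) (by omega)) (by omega)) (by omega)) (by omega)
          (hz _ (by omega)))
        (.reg rfl) (by omega) (by omega) z1 z2 z3 hj) ?_ ?_
    swap
    · have : (encE (.lit 2) (.reg 4) (.load (.reg 28 + .reg 4 % .reg 29))
          (.load (.reg 28 + (.reg 29 + .reg 4 / .reg 29 % .reg 29)))
          (.load (.reg 28 + (.reg 29 + .reg 29 + .reg 4 / (.reg 29 * .reg 29) % .reg 29)))
          (.reg 5)).cost ≤ 80 := by decide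
      omega
    have hFv := hF τ hτ _ d3
    set key := enc p.Z 2 τ (z (τ % p.m))
      (z (p.m + τ / p.m % p.m)) (z (p.m + p.m + τ / (p.m * p.m) % p.m)) (r1 5) with hkey
    have hkP : key < p.P := (enc_lt (by omega) (by omega) z1 z2 z3 hj).trans_le h.ZP
    refine Tr.seq 50 (150 + (p.T + 1) * 40) ((lookup_spec h.dict hf (by omega) (by omega) h.PW
        (hH.update (by norm_num)) (by simpa using hkP)).mono le_rfl ?_) (by omega)
    rintro r2 f2 ⟨rfl, g1, g2⟩
    rw [Function.update_self, hFv] at g1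
    have g2' : ∀ x, x ≠ 1 → x ≠ 2 → x ≠ 3 → r2 x = r1 x := fun x a b c => by
      rw [g2 x b c, Function.update_of_ne a]
    have q4 : r2 4 = τ := g2' 4 (by decide) (by decide) (by decide)
    have q5 : r2 5 = r1 5 := g2' 5 (by decide) (by decide) (by decide)
    have q6 : r2 6 = r1 6 := g2' 6 (by decide) (by decide) (by decide)
    have q0 : r2 0 = r1 0 := g2' 0 (by decide) (by decide) (by decide)
    have q10 : ∀ x, 10 ≤ x → r2 x = r x := fun x hx => by
      rw [g2' x (by omega) (by omega) (by omega), h1 x hx]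
    refine Tr.ite (100 + (p.T + 1) * 40) (Ev.eq (.reg g1) (.lit (by omega)) (by omega))
      (fun hc => ?_) (fun hc => ?_) (by simp [Exp.cost]; omega)
    -- Candidates are stored plus one, so the value `0` marks the end of the bucket.
    · have hlast : r1 5 = (cands τ).length := by
        by_contra hne
        have hlt : r1 5 < (cands τ).length := by omega
        simp [hlt] at hc
      refine Tr.assign_seq 2 (Ev.add (.reg q4) (.lit (by omega)) (by omega)) ?_
        (by simp [Exp.cost]; omega)
      refine Tr.assign (Ev.lit (k := 0) (by omega)) ?_ (by simp [Exp.cost])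
      refine ⟨k - 1, by omega, ?_, rfl, by simp; omega, by simp [q6]; omega, by simp [q6]; omega,
        .inr ⟨done, by simp [d1, q6], ?_, by simp, d4, ?_⟩⟩
      · intro x hx
        simp [show x ≠ 5 by omega, show x ≠ 4 by omega, q10 x hx]
      · rw [d2, candsFrom_of_lt hτ, hlast]
        simp
      · intro x hx
        simpa [q0] using d5 x hx
    · have hlt : r1 5 < (cands τ).length := by
        by_contra hge
        rw [List.getElem?_eq_none (by omega)] at hc
        simp at hc
      set x := (cands τ)[r1 5] with hxdef
      have g3 : r2 3 = x + 1 := by rw [g1]; simp [hlt, hxdef]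
      have hxN : x < N := hN τ hτ _ (List.getElem_mem hlt)
      have hxZ : x + 1 < W := by
        have h1 := h.F_lt key
        rw [hFv] at h1
        simp [hlt] at h1
        rw [← hxdef] at h1
        omega
      have hE' : E = (done ++ [x]) ++ (candsFrom cands p.L τ).drop (r1 5 + 1) := by
        rw [d2, List.append_assoc]
        congr 1
        have hlt' : r1 5 < (candsFrom cands p.L τ).length := by
          rw [candsFrom_of_lt hτ, List.length_append]; omega
        rw [List.drop_eq_getElem_cons hlt']
        simp only [candsFrom_of_lt hτ, List.singleton_append]
        rw [List.getElem_append_left hlt]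
      have hxE : x ∈ E := by rw [hE']; simp
      have hH2 : p.Held r2 := hr.congr fun x hx => q10 x (by omega)
      refine Tr.seq (4 + (p.T + 1) * 40) 90 ((countProg_spec h hH2 hf hb hxN g3).mono le_rfl ?_)
        (by omega)
      rintro r3 f3 ⟨rfl, i8, i2⟩
      have hH3 : p.Held r3 := hH2.congr fun x hx => i2 x (by omega) (by omega)
      have s3 : r3 3 = x + 1 := by rw [i2 3 (by omega) (by omega), g3]
      have s4 : r3 4 = τ := by rw [i2 4 (by omega) (by omega), q4]
      have s5 : r3 5 = r1 5 := by rw [i2 5 (by omega) (by omega), q5]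
      have s6 : r3 6 = r1 6 := by rw [i2 6 (by omega) (by omega), q6]
      have s0 : r3 0 = r1 0 := by rw [i2 0 (by omega) (by omega), q0]
      have s10 : ∀ x, 10 ≤ x → r3 x = r x := fun x hx => by
        rw [i2 x (by omega) (by omega), q10 x hx]
      have e31 : r3 31 = p.L := hH3 11 (by norm_num)
      have e33 : r3 33 = p.ζ := hH3 13 (by norm_num)
      have e35 : r3 35 = p.Θ := hH3 15 (by norm_num)
      have e37 : r3 37 = p.n := hH3 17 (by norm_num)
      have hout : Ev W inp S r3 f3 ((.reg 3 - .lit 1) % .reg 37) (x % p.n) :=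
        Ev.mod ((Ev.sub (.reg s3) (.lit (by omega)) (by omega)).congr (by omega)) (.reg e37) (by omega)
      refine Tr.ite 80 (Ev.lt (.reg i8) (.reg e35) (by omega)) (fun hc' => ?_) (fun hc' => ?_)
        (by decide)
      · have fin : ∀ r4 : ℕ → ℕ, (∀ x, x ≠ 0 → r4 x = r3 x) →
            (r1 6 = p.ζ → r4 0 = x % p.n) → (r1 6 ≠ p.ζ → r4 0 = r1 0) →
            Tr W inp S (.seq (.assign 6 (.reg 6 + .lit 1)) (.assign 5 (.reg 5 + .lit 1))) r4 f3 10
            fun r' f' => ∃ k' < k, (∀ x, 10 ≤ x → r' x = r x) ∧ f' = f3 ∧ r' 4 ≤ p.L ∧ r' 6 ≤ p.Φ ∧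
            (p.L - r' 4) + (p.Φ - r' 6) = k' ∧ ((r' 4 = p.L ∧ Post r' f') ∨ ∃ done : List ℕ,
            done.length = r' 6 ∧ E = done ++ (candsFrom cands p.L (r' 4)).drop (r' 5) ∧
            (r' 4 < p.L → r' 5 ≤ (cands (r' 4)).length) ∧
            (∀ x ∈ done, agreeCount vs b p.vb p.T x < p.Θ) ∧
            ∀ x, done[p.ζ]? = some x → r' 0 = x % p.n) := by
          intro r4 a1 a2 a3
          have u4 : r4 4 = τ := by rw [a1 4 (by omega), s4]
          have u5 : r4 5 = r1 5 := by rw [a1 5 (by omega), s5]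
          have u6 : r4 6 = r1 6 := by rw [a1 6 (by omega), s6]
          refine Tr.assign_seq 4 (Ev.add (.reg u6) (.lit (by omega)) (by omega)) ?_ (by decide)
          refine Tr.assign (Ev.add (.reg (by simpa using u5)) (.lit (by omega)) (by omega)) ?_ (by decide)
          refine ⟨k - 1, by omega, ?_, rfl, by simp [u4]; omega, by simp; omega, by simp [u4]; omega,
            .inr ⟨done ++ [x], by simp [d1], by simpa [u4] using hE', ?_, ?_, ?_⟩⟩
          · intro y hy
            rw [Function.update_of_ne (by omega), Function.update_of_ne (by omega), a1 y (by omega), s10 y hy]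
          · intro _; simp [u4]; omega
          · intro y hy
            rcases List.mem_append.1 hy with hy | hy
            · exact d4 y hy
            · rw [List.mem_singleton.1 hy]; exact hc'
          · intro y hy
            rw [Function.update_of_ne (by omega), Function.update_of_ne (by omega)]
            rcases lt_trichotomy p.ζ done.length with hl | hl | hl
            · rw [List.getElem?_append_left hl] at hy
              rw [a3 (by omega), d5 y hy]
            · rw [hl, List.getElem?_concat_length] at hy
              rw [a2 (by omega), Option.some.inj hy]
            · rw [List.getElem?_eq_none (by simp; omega)] at hy
              simp at hy
        refine Tr.seq 30 10 ?_ (by omega)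
        refine Tr.ite 20 (Ev.eq (.reg s6) (.reg e33) (by omega)) (fun hz => ?_) (fun hz => ?_) (by decide)
        · exact Tr.assign hout (fin _ (fun y hy => by rw [Function.update_of_ne hy]) (by simp)
            fun hn => absurd hz hn) (by decide)
        · exact Tr.skip (fin _ (fun _ _ => rfl) (fun hn => absurd hn hz) fun _ => s0) (by decide)
      -- Acceptance sets the table counter to `L`, which ends the loop.
      · refine Tr.assign_seq 10 hout ?_ (by decide)
        refine Tr.assign (Ev.reg (v := p.L) (by simpa using e31)) ?_ (by decide)
        refine ⟨p.Φ - r1 6, by omega, ?_, rfl, by simp, by simp [s6]; omega, by simp [s6],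
          .inl ⟨by simp, .inl ⟨x, hxE, by omega, by simp⟩⟩⟩
        intro y hy
        rw [Function.update_of_ne (by omega), Function.update_of_ne (by omega), s10 y hy]
  · refine ⟨?_, rfl, by simp, by simp, by simp, .inr ⟨[], by simp, by simp [hE], by simp, by simp, by simp⟩⟩
    intro x hx
    rw [Function.update_of_ne (by omega), Function.update_of_ne (by omega), Function.update_of_ne (by omega)]

end

/-! ### The complete query program -/

/-- The query program. -/
def queryProg : Prog :=
  .seq (loadHdr 24) (.seq
    (.ite (.op .lt .inputLen (.reg 38))
      (.seq (.assign 10 (.lit 1)) (.seq (.assign 11 (.reg 38)) (.seq (.assign 12 (.reg 41))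
        (.assign 13 (.reg 38)))))
      (.seq (.assign 10 (.lit 0)) (.seq (.assign 11 (.lit 1)) (.seq (.assign 12 (.reg 39))
        (.assign 13 (.reg 40))))))
    (.ite (.op .lt (.reg 13) .inputLen) .skip (.seq sketchProg (.seq classProg scanProg))))

/-- The sketch of the query. -/
def querySketch (p : Params) (F bin rk : ℕ → ℕ) (M mode pool R : ℕ) (inp : List ℕ) : ℕ → ℕ :=
  sketch bin rk M (slotsOf F p.Z mode pool R inp inp.length)

theorem sketch_le (bin rk : ℕ → ℕ) (M : ℕ) (X : Finset ℕ) (l : ℕ) : sketch bin rk M X l ≤ M :=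
  Finset.fold_min_le _ |>.2 (.inl le_rfl)

section

variable {W : ℕ} {inp : List ℕ} {S : ℕ} {f : ℕ → ℕ}
  {p : Params} {M t N : ℕ} {μ F bin rk : ℕ → ℕ} {vs : ℕ → ℕ → ℕ}

theorem queryProg_spec (h : Img p W S M t N μ F bin rk vs) (hf : ∀ a < S, f a = μ a)
    (hlen : inp.length < p.Z) (hinp : ∀ x ∈ inp, x < p.Z) (hthr : 0 < p.thr)
    {mode pool R qmax : ℕ}
    (hmode : (mode, R, pool, qmax) =
      if inp.length < p.thr then (1, p.thr, p.pool1, p.thr) else (0, 1, p.pool0, p.qmax0))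
    (hM : inp.length ≤ qmax → ∀ i < inp.length, blockBase F p.Z mode pool R inp i + R ≤ M)
    {b z : ℕ → ℕ} (hb : b = querySketch p F bin rk M mode pool R inp)
    (hz : z = fun g => cls F p.Z b p.K g p.K)
    {cands : ℕ → List ℕ} (hN : ∀ τ < p.L, ∀ x ∈ cands τ, x < N)
    (hclen : ∀ τ < p.L, (cands τ).length < p.Z)
    (hF : ∀ τ < p.L, ∀ j ≤ (cands τ).length, F (enc p.Z 2 τ (z (τ % p.m))
      (z (p.m + τ / p.m % p.m)) (z (p.m + p.m + τ / (p.m * p.m) % p.m)) j) =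
      ((cands τ)[j]?.map (· + 1)).getD 0) :
    Tr W inp S queryProg (fun _ => 0) f (200 + (if inp.length ≤ qmax then
        (inp.length + 1) * (150 + (R + 1) * 50) else 0) +
        (p.G + 1) * (40 + (p.K + 1) * 100) + (p.L + p.Φ + 1) * (300 + (p.T + 1) * 40)) fun r' _ =>
      inp.length ≤ qmax →
      (∃ x ∈ candsFrom cands p.L 0, p.Θ ≤ agreeCount vs b p.vb p.T x ∧ r' 0 = x % p.n) ∨
      (p.Φ ≤ (candsFrom cands p.L 0).length ∧
        ∃ x, (candsFrom cands p.L 0)[p.ζ]? = some x ∧ r' 0 = x % p.n) ∨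
      ∀ x ∈ candsFrom cands p.L 0, agreeCount vs b p.vb p.T x < p.Θ := by
  have hZW := h.Z_lt
  have hSZ := h.S_lt
  have h24 := h.two_lt
  have hcS := h.le_S
  have hcb := h.le_cb
  have hwb := h.le_wb
  set A := if inp.length ≤ qmax then (inp.length + 1) * (150 + (R + 1) * 50) else 0 with hA
  set B := (p.G + 1) * (40 + (p.K + 1) * 100) with hB
  set C := (p.L + p.Φ + 1) * (300 + (p.T + 1) * 40) with hC
  refine Tr.seq 80 (120 + A + B + C) ((loadHdr_spec 24 (by omega) (by omega)).mono (by omega) ?_)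
    (by omega)
  rintro r1 f1 ⟨rfl, h1, h2⟩
  have hH : p.Held r1 := fun i hi => by rw [h1 i hi, hf _ (by omega), h.hdr i hi]
  have e38 : r1 38 = p.thr := hH 18 (by norm_num)
  have e39 : r1 39 = p.pool0 := hH 19 (by norm_num)
  have e40 : r1 40 = p.qmax0 := hH 20 (by norm_num)
  have e41 : r1 41 = p.pool1 := hH 21 (by norm_num)
  have key : ∀ r2 : ℕ → ℕ, p.Held r2 → r2 10 = mode → r2 11 = R → r2 12 = pool → r2 13 = qmax →
      mode < p.Z → 0 < R →
      Tr W inp S (.ite (.op .lt (.reg 13) .inputLen) .skip (.seq sketchProg (.seq classProg scanProg)))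
      r2 f1 (20 + A + B + C) fun r' _ =>
      inp.length ≤ qmax →
      (∃ x ∈ candsFrom cands p.L 0, p.Θ ≤ agreeCount vs b p.vb p.T x ∧ r' 0 = x % p.n) ∨
      (p.Φ ≤ (candsFrom cands p.L 0).length ∧
        ∃ x, (candsFrom cands p.L 0)[p.ζ]? = some x ∧ r' 0 = x % p.n) ∨
      ∀ x ∈ candsFrom cands p.L 0, agreeCount vs b p.vb p.T x < p.Θ := by
    intro r2 H2 e10 e11 e12 e13 hmZ hR0
    refine Tr.ite (16 + A + B + C) (Ev.lt (.reg e13) (.inputLen (by omega)) (by omega))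
      (fun hc => ?_) (fun hc => ?_) (by simp [Exp.cost]; omega)
    -- A query too long for the pool of fresh slots is given up at once; the postcondition claims
    -- nothing about it.
    · exact Tr.skip (fun h => absurd h (by omega)) (by omega)
    have hc' : inp.length ≤ qmax := by omega
    rw [if_pos hc'] at hA
    refine Tr.seq (2 + A) (8 + B + C) ((sketchProg_spec h H2 hf e11 e10 e12 hmZ hlen hR0 hinp
      (hM hc')).mono (by omega) ?_) (by omega)
    rintro r3 f3 ⟨i1, i2, i3⟩
    have H3 : p.Held r3 := H2.congr fun x hx => i1 x (by omega)
    have hbe : ∀ l, sketch bin rk M (slotsOf F p.Z mode pool R inp inp.length) l = b l := fun l => by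
      rw [hb]; rfl
    have hbZ : ∀ l < t, b l < p.Z := fun l _ => by
      rw [← hbe]; exact (sketch_le _ _ _ _ _).trans_lt h.M_lt
    refine Tr.seq (2 + B) (6 + C) ((classProg_spec h H3 i2 (fun l hl => (i3 l hl).trans (hbe l))
      hbZ).mono (by omega) ?_) (by omega)
    rintro r4 f4 ⟨j1, j2, j3, j4⟩
    have H4 : p.Held r4 := H3.congr fun x hx => j1 x (by omega)
    exact (scanProg_spec h H4 j2 j3 (z := z) (fun g hg => by rw [j4 g hg, hz])
      (fun g hg => by rw [hz]; exact cls_lt h.F_lt (by omega) _ _ _ _) hN hclen hF).mono (by omega)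
      fun _ _ h _ => h
  refine Tr.seq 40 (20 + A + B + C) ?_ (by omega)
  refine Tr.ite 20 (Ev.lt (.inputLen (by omega)) (.reg e38) (by omega))
      (fun hc => ?_) (fun hc => ?_) (by decide)
  · rw [if_pos hc] at hmode
    simp only [Prod.mk.injEq] at hmode
    obtain ⟨rfl, rfl, rfl, rfl⟩ := hmode
    refine Tr.assign_seq 15 (Ev.lit (k := 1) (by omega)) ?_ (by decide)
    refine Tr.assign_seq 10 (Ev.reg (v := p.thr) (by simpa using e38)) ?_ (by decide)
    refine Tr.assign_seq 5 (Ev.reg (v := p.pool1) (by simpa using e41)) ?_ (by decide)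
    refine Tr.assign (Ev.reg (v := p.thr) (by simpa using e38)) (key _ ?_ (by simp) (by simp) (by simp)
      (by simp) (by omega) hthr) (by decide)
    exact (((hH.update (by norm_num)).update (by norm_num)).update (by norm_num)).update (by norm_num)
  · rw [if_neg hc] at hmode
    simp only [Prod.mk.injEq] at hmode
    obtain ⟨rfl, rfl, rfl, rfl⟩ := hmode
    refine Tr.assign_seq 15 (Ev.lit (k := 0) (by omega)) ?_ (by decide)
    refine Tr.assign_seq 10 (Ev.lit (k := 1) (by omega)) ?_ (by decide)
    refine Tr.assign_seq 5 (Ev.reg (v := p.pool0) (by simpa using e39)) ?_ (by decide)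
    refine Tr.assign (Ev.reg (v := p.qmax0) (by simpa using e40)) (key _ ?_ (by simp) (by simp) (by simp)
      (by simp) (by omega) one_pos) (by decide)
    exact (((hH.update (by norm_num)).update (by norm_num)).update (by norm_num)).update (by norm_num)

theorem Tr.answers {W S : ℕ} {inp : List ℕ} {P : Prog} {f : ℕ → ℕ} {B : ℕ}
    {Post : (ℕ → ℕ) → (ℕ → ℕ) → Prop} (h : Tr W inp S P (fun _ => 0) f B Post) {u : ℕ}
    (q : List (Fin u)) (hq : inp = q.map Fin.val) (M : Fin S → Fin W)
    (hM : ∀ a : Fin S, (M a : ℕ) = f a) :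
    ∃ out t, Answers P M q out t ∧ t ≤ B ∧ ∃ r' f', Post r' f' ∧ r' 0 = out := by
  obtain ⟨r', f', t, h1, h2, h3⟩ := h
  refine ⟨r' 0, t, ⟨st S r' f', ?_, rfl⟩, h2, r', f', h3, rfl⟩
  convert h1 using 1
  · rw [hq, List.map_id', List.map_eq_flatMap]
    rfl
  · unfold start st
    congr 1
    funext a
    exact hM a

end

/-! ### Universal hashing and static dictionaries -/

/-- The hash function `x ↦ (a x mod P) mod m`. -/
def hsh (P m a x : ℕ) : ℕ := a * x % P % m

/-- A collision makes the difference of the two residues a positive multiple of `m` below `P`, which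
leaves `(P - 1) / m` values. Since `P` is prime and `x ≠ y`, the difference determines `a`. -/
theorem card_collide_lt (P : ℕ) [Fact P.Prime] (m x y : ℕ) (hxy : x < P) (hy : y < P)
    (hne : x ≠ y) :
    ((Finset.range P).filter fun a => a * y % P < a * x % P ∧ hsh P m a x = hsh P m a y).card ≤
      (P - 1) / m := by
  have hP : 0 < P := (Fact.out : P.Prime).pos
  rw [show (P - 1) / m = (Finset.Icc 1 ((P - 1) / m)).card by simp]
  have hdvd : ∀ a, a * y % P < a * x % P → hsh P m a x = hsh P m a y →
      m ∣ a * x % P - a * y % P := fun a h1 h2 =>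
    (Nat.modEq_iff_dvd' h1.le).1 h2.symm
  refine Finset.card_le_card_of_injOn (fun a => (a * x % P - a * y % P) / m) ?_ ?_
  · intro a ha
    simp only [Finset.coe_filter, Set.mem_ofPred_eq] at ha
    obtain ⟨-, h1, h2⟩ := ha
    have hd := hdvd a h1 h2
    have hlt : a * x % P < P := Nat.mod_lt _ hP
    simp only [Finset.coe_Icc, Set.mem_Icc]
    have hm : 0 < m := Nat.pos_of_ne_zero fun h0 => by
      rw [h0, zero_dvd_iff] at hd; omega
    exact ⟨Nat.div_pos (Nat.le_of_dvd (by omega) hd) hm, Nat.div_le_div_right (by omega)⟩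
  · intro a ha a' ha' h
    simp only [Finset.coe_filter, Set.mem_ofPred_eq, Finset.mem_range] at ha ha'
    obtain ⟨h0, h1, h2⟩ := ha
    obtain ⟨h0', h1', h2'⟩ := ha'
    have hd := hdvd a h1 h2
    have hd' := hdvd a' h1' h2'
    have heq : a * x % P - a * y % P = a' * x % P - a' * y % P := by
      rw [← Nat.div_mul_cancel hd, ← Nat.div_mul_cancel hd']
      exact congrArg (· * m) h
    have heq' : a * x % P + a' * y % P = a' * x % P + a * y % P := by omega
    have hz : (a : ZMod P) * x + a' * y = a' * x + a * y := by
      have := congrArg (Nat.cast (R := ZMod P)) heq'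
      simpa using this
    have hz' : ((a : ZMod P) - a') * (x - y) = 0 := by linear_combination hz
    have hcast : ∀ {c d : ℕ}, c < P → d < P → (c : ZMod P) = d → c = d := by
      intro c d hc hd h
      rw [ZMod.natCast_eq_natCast_iff'] at h
      rwa [Nat.mod_eq_of_lt hc, Nat.mod_eq_of_lt hd] at h
    rcases mul_eq_zero.1 hz' with h | h
    · exact hcast h0 h0' (sub_eq_zero.1 h)
    · exact absurd (hcast hxy hy (sub_eq_zero.1 h)) hne

theorem card_collide (P : ℕ) [Fact P.Prime] (m x y : ℕ) (hx : x < P) (hy : y < P) (hne : x ≠ y) :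
    m * ((Finset.Ico 1 P).filter fun a => hsh P m a x = hsh P m a y).card ≤ 2 * (P - 1) := by
  have h1 := card_collide_lt P m x y hx hy hne
  have h2 := card_collide_lt P m y x hy hx hne.symm
  have hsub : ((Finset.Ico 1 P).filter fun a => hsh P m a x = hsh P m a y) ⊆
      ((Finset.range P).filter fun a => a * y % P < a * x % P ∧ hsh P m a x = hsh P m a y) ∪
      ((Finset.range P).filter fun a => a * x % P < a * y % P ∧ hsh P m a y = hsh P m a x) := by
    intro a ha
    simp only [Finset.mem_filter, Finset.mem_Ico, Finset.mem_union, Finset.mem_range] at ha ⊢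
    obtain ⟨⟨ha0, ha1⟩, h⟩ := ha
    rcases lt_trichotomy (a * y % P) (a * x % P) with hlt | heq | hlt
    · exact .inl ⟨ha1, hlt, h⟩
    · exfalso
      have hz : (a : ZMod P) * y = a * x := by
        have := congrArg (Nat.cast (R := ZMod P)) heq
        simpa using this
      have ha' : (a : ZMod P) ≠ 0 := by
        intro h0
        rw [ZMod.natCast_eq_zero_iff] at h0
        exact absurd (Nat.le_of_dvd (by omega) h0) (by omega)
      have := mul_left_cancel₀ ha' hz
      rw [ZMod.natCast_eq_natCast_iff'] at this
      rw [Nat.mod_eq_of_lt hx, Nat.mod_eq_of_lt hy] at this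
      exact hne this.symm
    · exact .inr ⟨ha1, hlt, h.symm⟩
  have h3 := (Finset.card_le_card hsub).trans (Finset.card_union_le _ _)
  calc _ ≤ m * ((P - 1) / m + (P - 1) / m) := Nat.mul_le_mul_left _ (by omega)
    _ = 2 * (m * ((P - 1) / m)) := by ring
    _ ≤ _ := Nat.mul_le_mul_left _ (Nat.mul_div_le _ _)

/-- Averaging: summed over all `a` in `[1, P)`, the colliding ordered pairs are bounded by
`card_collide`, so some `a` does not exceed the mean. -/
theorem exists_hash (P : ℕ) [Fact P.Prime] (m : ℕ) (X : Finset ℕ) (hX : ∀ x ∈ X, x < P) :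
    ∃ a < P, m * (X.offDiag.filter fun x => hsh P m a x.1 = hsh P m a x.2).card ≤
      2 * (X.card * X.card - X.card) := by
  have hP := (Fact.out : P.Prime).two_le
  by_contra! hcon
  have h1 : ∑ a ∈ Finset.Ico 1 P, m * (X.offDiag.filter fun x => hsh P m a x.1 = hsh P m a x.2).card =
      ∑ x ∈ X.offDiag, m * ((Finset.Ico 1 P).filter fun a => hsh P m a x.1 = hsh P m a x.2).card := by
    simp_rw [← Finset.mul_sum, Finset.card_filter]
    rw [Finset.sum_comm]
  have h2 : ∑ x ∈ X.offDiag, m * ((Finset.Ico 1 P).filter fun a => hsh P m a x.1 = hsh P m a x.2).card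
      ≤ ∑ x ∈ X.offDiag, 2 * (P - 1) := by
    refine Finset.sum_le_sum fun x hx => ?_
    rw [Finset.mem_offDiag] at hx
    exact card_collide P m _ _ (hX _ hx.1) (hX _ hx.2.1) hx.2.2
  have h3 : ∑ a ∈ Finset.Ico 1 P, 2 * (X.card * X.card - X.card) <
      ∑ a ∈ Finset.Ico 1 P, m * (X.offDiag.filter fun x => hsh P m a x.1 = hsh P m a x.2).card := by
    refine Finset.sum_lt_sum_of_nonempty ⟨1, by simp; omega⟩ fun a ha => hcon a ?_
    exact (Finset.mem_Ico.1 ha).2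
  rw [h1] at h3
  have h4 := h3.trans_le h2
  simp only [Finset.sum_const, Nat.card_Ico, smul_eq_mul, Finset.offDiag_card] at h4
  linarith [Nat.mul_comm (P - 1) (2 * (X.card * X.card - X.card)), h4,
    show (P - 1) * (2 * (X.card * X.card - X.card)) = (X.card * X.card - X.card) * (2 * (P - 1)) by ring]

/-- The scheme of Fredman, Komlós and Szemerédi: the first level has few collisions, and every
bucket gets an injective hash function into a table of quadratic size. The tables are given before
the memory `μ`, so that they can be placed at any addresses. -/
theorem exists_dict (P : ℕ) [Fact P.Prime] (X : Finset ℕ) (hX : ∀ x ∈ X, x < P) (f : ℕ → ℕ) :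
    ∃ (a c : ℕ) (top cell : ℕ → ℕ), a < P ∧ c ≤ 7 * (X.card + 1) ∧ (∀ i, top i ≤ P + c) ∧
      (∀ i, cell i ≤ P ∨ ∃ x ∈ X, cell i = f x) ∧
      ∀ (μ : ℕ → ℕ) (lim D1 D2 : ℕ), (∀ i < 3 * (X.card + 1), μ (D1 + i) = top i) →
        (∀ i < 2 * c, μ (D2 + i) = cell i) → D1 + 3 * (X.card + 1) ≤ lim → D2 + 2 * c ≤ lim →
        DictOK μ lim P a (X.card + 1) D1 D2 fun x => if x ∈ X then f x else 0 := by
  classical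
  set s := X.card + 1 with hs
  have hs0 : 0 < s := Nat.succ_pos _
  obtain ⟨a, haP, ha⟩ := exists_hash P s X hX
  let bk : ℕ → Finset ℕ := fun b => X.filter fun x => hsh P s a x = b
  -- For a bucket of `k` keys, `2 k² + 1` cells exceed the `2 (k² - k)` allowed by `exists_hash`, so
  -- some multiplier has no collision at all.
  let mb : ℕ → ℕ := fun b => 2 * ((bk b).card * (bk b).card) + 1
  have hinj : ∀ b, ∃ ab < P, ∀ x ∈ bk b, ∀ y ∈ bk b, hsh P (mb b) ab x = hsh P (mb b) ab y → x = y := by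
    intro b
    obtain ⟨ab, h1, h2⟩ := exists_hash P (mb b) (bk b) fun x hx => hX x (Finset.mem_filter.1 hx).1
    refine ⟨ab, h1, fun x hx y hy hxy => ?_⟩
    by_contra hne
    have hpos : 0 < ((bk b).offDiag.filter fun x => hsh P (mb b) ab x.1 = hsh P (mb b) ab x.2).card :=
      Finset.card_pos.2 ⟨(x, y), Finset.mem_filter.2 ⟨Finset.mem_offDiag.2 ⟨hx, hy, hne⟩, hxy⟩⟩
    have h3 := (Nat.le_mul_of_pos_right (mb b) hpos).trans h2
    simp only [mb] at h3
    omega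
  choose ab habP hab using hinj
  let off : ℕ → ℕ := fun b => ∑ i ∈ Finset.range b, mb i
  let idx : ℕ → ℕ := fun x => off (hsh P s a x) + hsh P (mb (hsh P s a x)) (ab (hsh P s a x)) x
  have hmb0 : ∀ b, 0 < mb b := fun b => Nat.succ_pos _
  have hoff : ∀ {b b'}, b < b' → off b + mb b ≤ off b' := by
    intro b b' h
    rw [← Finset.sum_range_succ]
    exact Finset.sum_le_sum_of_subset (Finset.range_mono h)
  have hidx : ∀ x, off (hsh P s a x) ≤ idx x ∧ idx x < off (hsh P s a x) + mb (hsh P s a x) := fun x =>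
    ⟨Nat.le_add_right _ _, Nat.add_lt_add_left (Nat.mod_lt _ (hmb0 _)) _⟩
  have hidx_inj : ∀ x ∈ X, ∀ y ∈ X, idx x = idx y → x = y := by
    intro x hx y hy h
    have hb : hsh P s a x = hsh P s a y := by
      by_contra hne
      have h1 := hidx x
      have h2 := hidx y
      rcases lt_or_gt_of_ne hne with h3 | h3
      · have := hoff h3; omega
      · have := hoff h3; omega
    refine hab (hsh P s a x) x (by simp [bk, hx]) y (by simp [bk, hy, hb]) ?_
    have h' : off (hsh P s a x) + hsh P (mb (hsh P s a x)) (ab (hsh P s a x)) x =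
      off (hsh P s a y) + hsh P (mb (hsh P s a y)) (ab (hsh P s a y)) y := h
    rw [← hb] at h'
    omega
  -- An unused cell gets the key `P`, which no query for `x < P` matches.
  let key : ℕ → ℕ := fun i => if h : ∃ x ∈ X, idx x = i then h.choose else P
  let val : ℕ → ℕ := fun i => if h : ∃ x ∈ X, idx x = i then f h.choose else 0
  have hkey : ∀ x < P, (key (idx x) = x ∧ val (idx x) = if x ∈ X then f x else 0) ∨
      (key (idx x) ≠ x ∧ (if x ∈ X then f x else 0) = 0) := by
    intro x hx
    by_cases h : ∃ y ∈ X, idx y = idx x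
    · have e1 : key (idx x) = h.choose := dif_pos h
      have e2 : val (idx x) = f h.choose := dif_pos h
      obtain ⟨c1, c2⟩ := h.choose_spec
      by_cases hxX : x ∈ X
      · have e3 := hidx_inj _ c1 _ hxX c2
        left
        rw [e1, e2, if_pos hxX, e3]
        exact ⟨rfl, rfl⟩
      · right
        rw [e1, if_neg hxX]
        exact ⟨fun h' => hxX (h' ▸ c1), rfl⟩
    · right
      have e1 : key (idx x) = P := dif_neg h
      rw [e1, if_neg fun hxX => h ⟨x, hxX, rfl⟩]
      exact ⟨by omega, rfl⟩
  -- The squares of the bucket sizes count the ordered pairs with equal hash value: `|X|` on the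
  -- diagonal and at most `2 |X|` off it. Doubling this and adding one cell per bucket gives `6 |X|
  -- + s`.
  have hsum : off s ≤ 7 * s := by
    have e1 : ∑ b ∈ Finset.range s, (bk b).card * (bk b).card =
        ((X ×ˢ X).filter fun x => hsh P s a x.1 = hsh P s a x.2).card := by
      rw [Finset.card_eq_sum_card_fiberwise (f := fun x => hsh P s a x.1) (t := Finset.range s)]
      · refine Finset.sum_congr rfl fun b _ => ?_
        rw [← Finset.card_product]
        congr 1
        ext ⟨x, y⟩
        simp only [bk, Finset.mem_product, Finset.mem_filter]
        constructor
        · rintro ⟨⟨h1, h2⟩, h3, h4⟩; exact ⟨⟨⟨h1, h3⟩, by rw [h2, h4]⟩, h2⟩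
        · rintro ⟨⟨⟨h1, h3⟩, h4⟩, h2⟩; exact ⟨⟨h1, h2⟩, h3, by rw [← h4, h2]⟩
      · intro x _
        exact Finset.mem_coe.2 (Finset.mem_range.2 (Nat.mod_lt _ hs0))
    have e2 : ((X ×ˢ X).filter fun x => hsh P s a x.1 = hsh P s a x.2).card ≤
        X.card + (X.offDiag.filter fun x => hsh P s a x.1 = hsh P s a x.2).card := by
      rw [← Finset.diag_union_offDiag, Finset.filter_union]
      refine (Finset.card_union_le _ _).trans (Nat.add_le_add_right ?_ _)
      exact (Finset.card_filter_le _ _).trans (by simp)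
    have e3 : (X.offDiag.filter fun x => hsh P s a x.1 = hsh P s a x.2).card ≤ 2 * X.card := by
      refine Nat.le_of_mul_le_mul_left (ha.trans ?_) hs0
      have : X.card * X.card - X.card ≤ s * X.card := by
        rw [hs, Nat.succ_mul]; omega
      linarith
    have e4 : off s = 2 * (∑ b ∈ Finset.range s, (bk b).card * (bk b).card) + s := by
      simp only [off, mb, Finset.sum_add_distrib, ← Finset.mul_sum]
      simp
    rw [e4, e1]
    omega
  have hoffs : ∀ b < s, off b + mb b ≤ off s := fun b hb => hoff hb
  refine ⟨a, off s, fun i => if i / 3 < s then (if i % 3 = 0 then off (i / 3) else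
    if i % 3 = 1 then ab (i / 3) else mb (i / 3)) else 0,
    fun i => if i % 2 = 0 then key (i / 2) else val (i / 2), haP, hsum, ?_, ?_, ?_⟩
  · intro i
    dsimp only
    split_ifs with h1 h2 h3
    · have := hoffs _ h1; omega
    · have := habP (i / 3); omega
    · have := hoffs _ h1; omega
    · omega
  · intro i
    dsimp only
    split_ifs with h1
    · left
      by_cases h : ∃ x ∈ X, idx x = i / 2
      · rw [show key (i / 2) = h.choose from dif_pos h]
        exact (hX _ h.choose_spec.1).le
      · rw [show key (i / 2) = P from dif_neg h]
    · by_cases h : ∃ x ∈ X, idx x = i / 2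
      · exact .inr ⟨h.choose, h.choose_spec.1, dif_pos h⟩
      · left
        rw [show val (i / 2) = 0 from dif_neg h]; omega
  · intro μ lim D1 D2 h1 h2 h3 h4
    dsimp only at h1 h2
    refine ⟨haP, fun x hx => ?_⟩
    have hb : a * x % P % s < s := Nat.mod_lt _ hs0
    have hof := hoffs _ hb
    have hi := hidx x
    have hie : idx x = off (a * x % P % s) + ab (a * x % P % s) * x % P % mb (a * x % P % s) := rfl
    change off (a * x % P % s) ≤ idx x ∧ idx x < off (a * x % P % s) + mb (a * x % P % s) at hi
    refine ⟨off (a * x % P % s), ab (a * x % P % s), mb (a * x % P % s), ?_, ?_, ?_, ?_, habP _, ?_, ?_⟩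
    · rw [h1 _ (by omega)]
      rw [if_pos (by omega), if_pos (by omega), Nat.mul_div_cancel_left _ (by norm_num)]
    · rw [add_assoc, h1 _ (by omega)]
      rw [if_pos (by omega), if_neg (by omega), if_pos (by omega),
        show (3 * (a * x % P % s) + 1) / 3 = a * x % P % s by omega]
    · rw [add_assoc, h1 _ (by omega)]
      rw [if_pos (by omega), if_neg (by omega), if_neg (by omega),
        show (3 * (a * x % P % s) + 2) / 3 = a * x % P % s by omega]
    · omega
    · rw [← hie]; omega
    · rw [← hie, add_assoc, h2 _ (by omega), h2 _ (by omega), if_pos (by omega), if_neg (by omega),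
        Nat.mul_div_cancel_left _ (by norm_num), show (2 * idx x + 1) / 2 = idx x by omega]
      exact hkey x hx

end WordRAM

section

open Finset

/-! ### Finite probability -/

section FiniteProbability

variable {Ω : Type*}

open Classical in
/-- The indicator of `E`. -/
noncomputable def ind (E : Ω → Prop) (ω : Ω) : ℝ := if E ω then 1 else 0

theorem ind_nonneg (E : Ω → Prop) (ω : Ω) : 0 ≤ ind E ω := by unfold ind; split_ifs <;> norm_num

variable [Fintype Ω]

/-- The mean of `g` under the uniform distribution. -/
noncomputable def mean (g : Ω → ℝ) : ℝ := (∑ ω, g ω) / Fintype.card Ω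

/-- The probability of `E` under the uniform distribution. -/
noncomputable def pr (E : Ω → Prop) : ℝ := mean (ind E)

theorem mean_mono {g h : Ω → ℝ} (hgh : ∀ ω, g ω ≤ h ω) : mean g ≤ mean h :=
  div_le_div_of_nonneg_right (sum_le_sum fun ω _ => hgh ω) (Nat.cast_nonneg _)

theorem mean_nonneg {g : Ω → ℝ} (hg : ∀ ω, 0 ≤ g ω) : 0 ≤ mean g :=
  div_nonneg (sum_nonneg fun ω _ => hg ω) (Nat.cast_nonneg _)

theorem mean_add (g h : Ω → ℝ) : mean (fun ω => g ω + h ω) = mean g + mean h := by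
  simp [mean, sum_add_distrib, add_div]

theorem mean_const_mul (c : ℝ) (g : Ω → ℝ) : mean (fun ω => c * g ω) = c * mean g := by
  simp [mean, ← mul_sum, mul_div_assoc]

theorem mean_sum {ι : Type*} (s : Finset ι) (g : ι → Ω → ℝ) :
    mean (fun ω => ∑ i ∈ s, g i ω) = ∑ i ∈ s, mean (g i) := by
  simp only [mean, ← sum_div]
  rw [sum_comm]

theorem mean_const [Nonempty Ω] (c : ℝ) : mean (fun _ : Ω => c) = c := by
  simp [mean]

theorem pr_nonneg (E : Ω → Prop) : 0 ≤ pr E := mean_nonneg (ind_nonneg E)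

theorem pr_mono {E F : Ω → Prop} (h : ∀ ω, E ω → F ω) : pr E ≤ pr F := by
  refine mean_mono fun ω => ?_
  unfold ind
  split_ifs with h1 h2 <;> norm_num
  exact h2 (h ω h1)

theorem pr_or_le (E F : Ω → Prop) : pr (fun ω => E ω ∨ F ω) ≤ pr E + pr F := by
  rw [pr, pr, pr, ← mean_add]
  refine mean_mono fun ω => ?_
  unfold ind
  split_ifs <;> simp_all

theorem pr_exists_le {ι : Type*} (s : Finset ι) (E : ι → Ω → Prop) :
    pr (fun ω => ∃ i ∈ s, E i ω) ≤ ∑ i ∈ s, pr (E i) := by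
  simp only [pr]
  rw [← mean_sum]
  refine mean_mono fun ω => ?_
  by_cases h : ∃ i ∈ s, E i ω
  · obtain ⟨i, hi, hE⟩ := h
    have h1 : ind (fun ω => ∃ i ∈ s, E i ω) ω = 1 := if_pos ⟨i, hi, hE⟩
    have h2 : ind (E i) ω = 1 := if_pos hE
    rw [h1, ← h2]
    exact single_le_sum (f := fun i => ind (E i) ω) (fun i _ => ind_nonneg _ _) hi
  · have h1 : ind (fun ω => ∃ i ∈ s, E i ω) ω = 0 := if_neg h
    rw [h1]
    exact sum_nonneg fun i _ => ind_nonneg _ _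

theorem pr_add_not [Nonempty Ω] (E : Ω → Prop) : pr E + pr (fun ω => ¬ E ω) = 1 := by
  rw [pr, pr, ← mean_add, ← mean_const (Ω := Ω) 1]
  congr 1
  funext ω
  unfold ind
  split_ifs <;> simp_all

theorem pr_le_one [Nonempty Ω] (E : Ω → Prop) : pr E ≤ 1 := by
  have := pr_add_not E
  have := pr_nonneg (fun ω => ¬ E ω)
  linarith

theorem pr_eq_card (E : Ω → Prop) [DecidablePred E] :
    pr E = ((univ.filter E).card : ℝ) / Fintype.card Ω := by
  simp only [pr, mean, ind]
  congr 1
  rw [← sum_boole]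
  exact sum_congr rfl fun ω _ => by split_ifs <;> rfl

theorem markov {g : Ω → ℝ} (hg : ∀ ω, 0 ≤ g ω) (c : ℝ) : c * pr (fun ω => c ≤ g ω) ≤ mean g := by
  rw [pr, ← mean_const_mul]
  refine mean_mono fun ω => ?_
  unfold ind
  split_ifs with h
  · simpa using h
  · simpa using hg ω

/-- The Cauchy–Schwarz inequality for `g` and the indicator of `g ≠ 0`; it bounds the probability of
`g ≠ 0` from below by two moments. -/
theorem mean_sq_le (g : Ω → ℝ) :
    mean g ^ 2 ≤ mean (fun ω => g ω ^ 2) * pr (fun ω => g ω ≠ 0) := by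
  have h := sum_mul_sq_le_sq_mul_sq univ g (ind fun ω => g ω ≠ 0)
  have h1 : ∀ ω, g ω * ind (fun ω => g ω ≠ 0) ω = g ω := fun ω => by
    unfold ind; split_ifs <;> simp_all
  have h2 : ∀ ω, ind (fun ω => g ω ≠ 0) ω ^ 2 = ind (fun ω => g ω ≠ 0) ω := fun ω => by
    unfold ind; split_ifs <;> simp
  simp only [h1, h2] at h
  rw [pr, mean, mean, mean, div_pow, div_mul_div_comm, ← sq]
  exact div_le_div_of_nonneg_right h (sq_nonneg _)

end FiniteProbability

/-! ### Agreement of min-wise sketches in random bins -/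

section Agree

variable {M : ℕ} {β : Type*} [DecidableEq β]

/-- The randomness of the sketches: every slot has a random bin and a random rank. -/
abbrev Rnd (M : ℕ) (β : Type*) := (Fin M → β) × Equiv.Perm (Fin M)

/-- In the bin `l` the element of `B` of smallest rank exists and lies in `G`. -/
def MinIn (ω : Rnd M β) (B G : Finset (Fin M)) (l : β) : Prop :=
  ∃ x ∈ G, ω.1 x = l ∧ ∀ y ∈ B, ω.1 y = l → ω.2 x ≤ ω.2 y

/-- The sketches of `A` and `Q` agree in the bin `l`. -/
def Agree (ω : Rnd M β) (A Q : Finset (Fin M)) (l : β) : Prop := MinIn ω (A ∪ Q) (A ∩ Q) l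

theorem minIn_self (ω : Rnd M β) (B : Finset (Fin M)) (l : β) :
    MinIn ω B B l ↔ ∃ x ∈ B, ω.1 x = l := by
  constructor
  · rintro ⟨x, hx, h, -⟩; exact ⟨x, hx, h⟩
  · rintro ⟨x, hx, h⟩
    obtain ⟨y, hy, hmin⟩ := exists_min_image (B.filter fun x => ω.1 x = l) ω.2 ⟨x, by simp [hx, h]⟩
    rw [mem_filter] at hy
    exact ⟨y, hy.1, hy.2, fun z hz hzl => hmin z (by simp [hz, hzl])⟩

/-- The bijection between the two images extends to a permutation of `B`, and by the identity
outside `B`. This symmetry makes all choices of the minima equally likely. -/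
theorem exists_perm_of_injective {S : Type*} [Fintype S] {B : Finset (Fin M)} (e e' : S → Fin M)
    (he : Function.Injective e) (he' : Function.Injective e') (heB : ∀ l, e l ∈ B)
    (heB' : ∀ l, e' l ∈ B) :
    ∃ τ : Equiv.Perm (Fin M), (∀ l, τ (e l) = e' l) ∧ ∀ y, τ y ∈ B ↔ y ∈ B := by
  classical
  let f : S → B := fun l => ⟨e l, heB l⟩
  let f' : S → B := fun l => ⟨e' l, heB' l⟩
  have hf : Function.Injective f := fun a b h => he (congrArg Subtype.val h)
  have hf' : Function.Injective f' := fun a b h => he' (congrArg Subtype.val h)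
  let E : {x // x ∈ Set.range f} ≃ {x // x ∈ Set.range f'} :=
    (Equiv.ofInjective f hf).symm.trans (Equiv.ofInjective f' hf')
  let τ : Equiv.Perm B := E.extendSubtype
  refine ⟨Equiv.Perm.ofSubtype τ, fun l => ?_, fun y => ?_⟩
  · have h1 : τ (f l) = f' l := by
      have := E.extendSubtype_apply_of_mem (f l) ⟨l, rfl⟩
      rw [this]
      simp only [E, Equiv.trans_apply]
      have : (Equiv.ofInjective f hf).symm ⟨f l, ⟨l, rfl⟩⟩ = l :=
        Equiv.ofInjective_symm_apply hf l
      rw [this]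
      rfl
    have h2 := Equiv.Perm.ofSubtype_apply_coe τ (f l)
    rw [h1] at h2
    exact h2
  · by_cases hy : y ∈ B
    · have h2 := Equiv.Perm.ofSubtype_apply_coe τ ⟨y, hy⟩
      simp only at h2
      rw [h2]
      simp [hy]
    · rw [Equiv.Perm.ofSubtype_apply_of_not_mem τ hy]

variable [Fintype β]

-- An outcome in the event determines the minimum of every bin of `S`, and minima of different bins
-- are different. So the event is the disjoint union, over the injections of `S` into `G`, of the
-- events with prescribed minima. These all have the same size by symmetry, and that size depends on
-- `B` and `S` alone.
open Classical in
theorem card_minIn_eq (B : Finset (Fin M)) (S : Finset β) :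
    ∃ c : ℕ, ∀ G ⊆ B, (univ.filter fun ω : Rnd M β => ∀ l ∈ S, MinIn ω B G l).card =
      c * G.card.descFactorial S.card := by
  let C : (S → Fin M) → Finset (Rnd M β) := fun e => univ.filter fun ω =>
    ∀ l : S, ω.1 (e l) = l ∧ ∀ y ∈ B, ω.1 y = l → ω.2 (e l) ≤ ω.2 y
  have hC : ∀ e e' : S → Fin M, Function.Injective e → Function.Injective e' → (∀ l, e l ∈ B) →
      (∀ l, e' l ∈ B) → (C e).card = (C e').card := by
    intro e e' he he' heB heB'
    obtain ⟨τ, h1, h2⟩ := exists_perm_of_injective e e' he he' heB heB'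
    have h1' : ∀ l, τ.symm (e' l) = e l := fun l => by rw [← h1, Equiv.symm_apply_apply]
    -- Moving the slots by `τ`, bins and ranks together, carries one event onto the other.
    refine card_equiv ((Equiv.arrowCongr τ (Equiv.refl β)).prodCongr (Equiv.mulRight τ⁻¹)) fun ω => ?_
    simp only [C, mem_filter, mem_univ, true_and, Equiv.prodCongr_apply, Prod.map, Equiv.arrowCongr_apply,
      Function.comp, Equiv.coe_refl, id, Equiv.coe_mulRight, Equiv.Perm.mul_apply, Equiv.Perm.inv_def, h1']
    refine forall_congr' fun l => and_congr_right fun _ => ⟨fun h y hy hl => ?_, fun h y hy hl => ?_⟩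
    · exact h _ ((h2 _).1 (by simpa using hy)) hl
    · simpa using h (τ y) ((h2 y).2 hy) (by simpa using hl)
  have hcount : ∀ G ⊆ B, (univ.filter fun ω : Rnd M β => ∀ l ∈ S, MinIn ω B G l).card =
      ∑ e : S ↪ G, (C fun l => (e l : Fin M)).card := by
    intro G hG
    rw [← card_biUnion]
    · congr 1
      ext ω
      simp only [mem_filter, mem_univ, true_and, mem_biUnion, C]
      constructor
      · intro h
        choose x hxG hxl hmin using fun l : S => h l l.2
        refine ⟨⟨fun l => ⟨x l, hxG l⟩, fun l l' hll => ?_⟩, fun l => ⟨hxl l, hmin l⟩⟩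
        have : x l = x l' := congrArg Subtype.val hll
        exact Subtype.ext (by rw [← hxl l, ← hxl l', this])
      · rintro ⟨e, he⟩ l hl
        exact ⟨e ⟨l, hl⟩, (e ⟨l, hl⟩).2, he ⟨l, hl⟩⟩
    · intro e _ e' _ hne
      rw [Function.onFun, disjoint_left]
      intro ω h h'
      simp only [C, mem_filter, mem_univ, true_and] at h h'
      refine hne (Function.Embedding.ext fun l => Subtype.ext (ω.2.injective (le_antisymm ?_ ?_)))
      · exact (h l).2 _ (hG (e' l).2) (h' l).1
      · exact (h' l).2 _ (hG (e l).2) (h l).1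
  by_cases hemb : Nonempty (S ↪ B)
  · obtain ⟨e₀⟩ := hemb
    refine ⟨(C fun l => (e₀ l : Fin M)).card, fun G hG => ?_⟩
    rw [hcount G hG, sum_congr rfl fun e _ => hC (fun l => (e l : Fin M)) (fun l => (e₀ l : Fin M))
      (Subtype.val_injective.comp e.injective) (Subtype.val_injective.comp e₀.injective)
      (fun l => hG (e l).2) (fun l => (e₀ l).2)]
    simp [Fintype.card_embedding_eq, mul_comm]
  · refine ⟨0, fun G hG => ?_⟩
    rw [hcount G hG, zero_mul]
    refine sum_eq_zero fun e _ => absurd ⟨e.trans ⟨fun x => ⟨x, hG x.2⟩, fun a b h => ?_⟩⟩ hemb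
    exact Subtype.ext (by simpa using h)

theorem pr_minIn_eq (B : Finset (Fin M)) (S : Finset β) :
    ∃ c : ℝ, 0 ≤ c ∧ ∀ G ⊆ B, pr (fun ω : Rnd M β => ∀ l ∈ S, MinIn ω B G l) =
      c * G.card.descFactorial S.card := by
  classical
  obtain ⟨c, hc⟩ := card_minIn_eq B S
  refine ⟨c / Fintype.card (Rnd M β), by positivity, fun G hG => ?_⟩
  rw [pr_eq_card, div_mul_eq_mul_div]
  congr 1
  rw [← Nat.cast_mul, ← hc G hG]

/-- Factor by factor, `(a - i) / (b - i) ≤ a / b`. -/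
theorem descFactorial_mul_pow_le {a b : ℕ} (h : a ≤ b) (k : ℕ) :
    a.descFactorial k * b ^ k ≤ a ^ k * b.descFactorial k := by
  induction k with
  | zero => simp
  | succ k ih =>
    rw [Nat.descFactorial_succ, Nat.descFactorial_succ, pow_succ, pow_succ]
    have h1 : (a - k) * b ≤ a * (b - k) := by
      rcases le_total a k with hk | hk
      · rw [Nat.sub_eq_zero_of_le hk]; simp
      · obtain ⟨c, rfl⟩ := Nat.exists_eq_add_of_le hk
        obtain ⟨d, rfl⟩ := Nat.exists_eq_add_of_le h
        rw [show k + c - k = c by omega, show k + c + d - k = c + d by omega]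
        nlinarith
    calc (a - k) * a.descFactorial k * (b ^ k * b)
        = ((a - k) * b) * (a.descFactorial k * b ^ k) := by ring
      _ ≤ (a * (b - k)) * (a ^ k * b.descFactorial k) := Nat.mul_le_mul h1 ih
      _ = _ := by ring

/-- The constant of `pr_minIn_eq` times the falling factorial of `|A ∪ Q|` is again a probability,
hence at most `1`; passing to `A ∩ Q` multiplies it by at most `J ^ |S|`. There is no error term
because empty bins count as disagreement. -/
theorem pr_agree_le [Nonempty β] (A Q : Finset (Fin M)) (S : Finset β) :
    pr (fun ω : Rnd M β => ∀ l ∈ S, Agree ω A Q l) ≤ jaccard A Q ^ S.card := by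
  obtain ⟨c, hc0, hc⟩ := pr_minIn_eq (A ∪ Q) S
  have hsub : A ∩ Q ⊆ A ∪ Q := inter_subset_left.trans subset_union_left
  have h1 := hc _ hsub
  have h2 := (hc _ (Subset.refl _)).symm.trans_le (pr_le_one _)
  have hle : (A ∩ Q).card ≤ (A ∪ Q).card := card_le_card hsub
  have hD := descFactorial_mul_pow_le hle S.card
  refine h1.trans_le ?_
  rw [jaccard, div_pow]
  rcases Nat.eq_zero_or_pos ((A ∪ Q).card ^ S.card) with h0 | h0
  · have hb0 : (A ∪ Q).card = 0 ∧ S.card ≠ 0 := by simpa only [pow_eq_zero_iff'] using h0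
    rw [Nat.descFactorial_of_lt (by omega)]
    simp only [Nat.cast_zero, mul_zero]
    positivity
  · have h0' : (0 : ℝ) < ((A ∪ Q).card : ℝ) ^ S.card := by exact_mod_cast h0
    rw [le_div_iff₀ h0', mul_assoc]
    have hD' : ((A ∩ Q).card.descFactorial S.card : ℝ) * ((A ∪ Q).card : ℝ) ^ S.card ≤
        ((A ∩ Q).card : ℝ) ^ S.card * (A ∪ Q).card.descFactorial S.card := by exact_mod_cast hD
    calc _ ≤ c * (((A ∩ Q).card : ℝ) ^ S.card * (A ∪ Q).card.descFactorial S.card) :=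
          mul_le_mul_of_nonneg_left hD' hc0
      _ = ((A ∩ Q).card : ℝ) ^ S.card * (c * (A ∪ Q).card.descFactorial S.card) := by ring
      _ ≤ ((A ∩ Q).card : ℝ) ^ S.card * 1 := mul_le_mul_of_nonneg_left h2 (by positivity)
      _ = _ := mul_one _

/-- With `t` bins and `b` elements the probability is `(1 - 1/t) ^ b`. As `(1 - 1/t) (1 + 1/t) ≤ 1`,
it is at most `1 / (1 + 1/t) ^ b`, and Bernoulli's inequality applies. -/
theorem pr_empty_bin_le [Nonempty β] (B : Finset (Fin M)) (hB : 0 < B.card) (l : β) :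
    pr (fun ω : Rnd M β => ¬ ∃ x ∈ B, ω.1 x = l) ≤ Fintype.card β / B.card := by
  classical
  set t := Fintype.card β with ht
  have ht0 : 0 < t := Fintype.card_pos
  have htR : (0 : ℝ) < t := by exact_mod_cast ht0
  have hbR : (0 : ℝ) < B.card := by exact_mod_cast hB
  have hpr := pr_eq_card (fun ω : Rnd M β => ¬ ∃ x ∈ B, ω.1 x = l)
  have h1 : (univ.filter fun ω : Rnd M β => ¬ ∃ x ∈ B, ω.1 x = l) =
      (Fintype.piFinset fun x => if x ∈ B then univ.erase l else univ) ×ˢ univ := by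
    ext ω
    simp only [mem_filter, mem_univ, true_and, mem_product, Fintype.mem_piFinset, and_true]
    push Not
    refine forall_congr' fun x => ?_
    split_ifs with hx <;> simp [hx]
  have hBM : B.card ≤ M := by simpa using card_le_univ B
  have h2 : (univ.filter fun ω : Rnd M β => ¬ ∃ x ∈ B, ω.1 x = l).card =
      (t - 1) ^ B.card * t ^ (M - B.card) * (M.factorial) := by
    rw [h1, card_product, Fintype.card_piFinset]
    congr 1
    · have : ∀ x : Fin M, (if x ∈ B then univ.erase l else (univ : Finset β)).card =
        if x ∈ B then t - 1 else t := fun x => by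
        split_ifs
        · rw [card_erase_of_mem (mem_univ _), card_univ]
        · exact card_univ
      rw [prod_congr rfl fun x _ => this x, prod_ite]
      simp only [prod_const]
      congr 2
      · simp
      · rw [filter_not, card_sdiff_of_subset (filter_subset _ _)]; simp
    · rw [card_univ, Fintype.card_perm, Fintype.card_fin]
  have h3 : Fintype.card (Rnd M β) = t ^ B.card * t ^ (M - B.card) * M.factorial := by
    rw [Fintype.card_prod, Fintype.card_fun, Fintype.card_perm, Fintype.card_fin, ← pow_add,
      Nat.add_sub_cancel' hBM]
  rw [hpr, h2, h3]
  push_cast [Nat.cast_sub (Nat.one_le_iff_ne_zero.2 ht0.ne')]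
  have hp1 : (0 : ℝ) < (t : ℝ) ^ (M - B.card) * M.factorial := by
    have : 0 < t ^ (M - B.card) * M.factorial := by positivity
    exact_mod_cast this
  rw [mul_assoc, mul_assoc, mul_div_mul_right _ _ hp1.ne', ← div_pow, le_div_iff₀ hbR]
  have hx0 : (0 : ℝ) ≤ ((t : ℝ) - 1) / t := div_nonneg (by
    have : (1 : ℝ) ≤ t := by exact_mod_cast ht0
    linarith) htR.le
  have hbern : 1 + (B.card : ℝ) * (1 / t) ≤ (1 + 1 / t) ^ B.card :=
    one_add_mul_le_pow (le_trans (by norm_num) (by positivity : (0 : ℝ) ≤ 1 / t)) _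
  have hprod : (((t : ℝ) - 1) / t) ^ B.card * (1 + 1 / t) ^ B.card ≤ 1 := by
    rw [← mul_pow]
    refine pow_le_one₀ (mul_nonneg hx0 (by positivity)) ?_
    have : ((t : ℝ) - 1) / t * (1 + 1 / t) = 1 - 1 / t ^ 2 := by field_simp; ring
    rw [this]
    have : (0 : ℝ) < 1 / (t : ℝ) ^ 2 := by positivity
    linarith
  have h4 := mul_le_mul_of_nonneg_left hbern (pow_nonneg hx0 B.card)
  have h5 := h4.trans hprod
  have h6 : 0 ≤ (((t : ℝ) - 1) / t) ^ B.card := pow_nonneg hx0 _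
  have h7 : (((t : ℝ) - 1) / t) ^ B.card * ((B.card : ℝ) * (1 / t)) ≤ 1 := by linarith
  have h8 : (((t : ℝ) - 1) / t) ^ B.card * B.card = ((((t : ℝ) - 1) / t) ^ B.card * ((B.card : ℝ) * (1 / t))) * t := by
    field_simp
  rw [h8]
  nlinarith

/-- The first factor bounds the probability that all bins of `S` are hit by `A ∪ Q` (a union bound
over empty bins). The second one is the price of replacing the falling factorial of `|A ∩ Q|` by a
power. -/
theorem le_pr_agree [Nonempty β] (A Q : Finset (Fin M)) (S : Finset β) (ha : 0 < (A ∩ Q).card)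
    (hS : S.card ^ 2 ≤ (A ∩ Q).card) :
    (1 - S.card * (Fintype.card β / (A ∪ Q).card)) * (1 - S.card ^ 2 / (A ∩ Q).card) *
      jaccard A Q ^ S.card ≤ pr (fun ω : Rnd M β => ∀ l ∈ S, Agree ω A Q l) := by
  obtain ⟨c, hc0, hc⟩ := pr_minIn_eq (A ∪ Q) S
  have hsub : A ∩ Q ⊆ A ∪ Q := inter_subset_left.trans subset_union_left
  have h1 := hc _ hsub
  have h2 := hc _ (Subset.refl _)
  have hle : (A ∩ Q).card ≤ (A ∪ Q).card := card_le_card hsub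
  have hb : 0 < (A ∪ Q).card := ha.trans_le hle
  have hhit : 1 - S.card * ((Fintype.card β : ℝ) / (A ∪ Q).card) ≤
      pr (fun ω : Rnd M β => ∀ l ∈ S, MinIn ω (A ∪ Q) (A ∪ Q) l) := by
    have e1 := pr_add_not (fun ω : Rnd M β => ∀ l ∈ S, MinIn ω (A ∪ Q) (A ∪ Q) l)
    have e2 : pr (fun ω : Rnd M β => ¬ ∀ l ∈ S, MinIn ω (A ∪ Q) (A ∪ Q) l) ≤
        ∑ l ∈ S, pr (fun ω : Rnd M β => ¬ ∃ x ∈ A ∪ Q, ω.1 x = l) := by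
      refine le_trans (pr_mono fun ω h => ?_) (pr_exists_le S _)
      simp only [minIn_self] at h
      push Not at h ⊢
      exact h
    have e3 : ∑ l ∈ S, pr (fun ω : Rnd M β => ¬ ∃ x ∈ A ∪ Q, ω.1 x = l) ≤
        S.card * ((Fintype.card β : ℝ) / (A ∪ Q).card) := by
      rw [← nsmul_eq_mul]
      exact sum_le_card_nsmul _ _ _ fun l _ => pr_empty_bin_le _ hb l
    linarith
  rw [h2] at hhit
  refine le_trans ?_ h1.ge
  have hJ : jaccard A Q = ((A ∩ Q).card : ℝ) / (A ∪ Q).card := rfl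
  rw [hJ]
  generalize (A ∩ Q).card = a at *
  generalize (A ∪ Q).card = b at *
  generalize S.card = k at *
  generalize 1 - (k : ℝ) * (Fintype.card β / b) = h at *
  have haR : (0 : ℝ) < a := by exact_mod_cast ha
  have hbR : (0 : ℝ) < b := by exact_mod_cast hb
  have hka : k ≤ a := (Nat.le_self_pow two_ne_zero k).trans hS
  have hkR : (k : ℝ) ≤ a := by exact_mod_cast hka
  have hk2 : (k : ℝ) ^ 2 / a ≤ 1 := by
    rw [div_le_one haR]; exact_mod_cast hS
  -- All factors of the falling factorial are at least `a - k`, and `(1 - k / a) ^ k ≥ 1 - k ^ 2 /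
  -- a` by Bernoulli's inequality.
  have e1 : (1 - (k : ℝ) ^ 2 / a) * a ^ k ≤ a.descFactorial k := by
    have h3 : ((a : ℝ) - k) ^ k ≤ a.descFactorial k := by
      have h4 : (a - k) ^ k ≤ a.descFactorial k :=
        (Nat.pow_le_pow_left (by omega) k).trans (Nat.pow_sub_le_descFactorial a k)
      have h5 : (((a - k) ^ k : ℕ) : ℝ) ≤ a.descFactorial k := by exact_mod_cast h4
      rwa [Nat.cast_pow, Nat.cast_sub hka] at h5
    have h6 : 1 + (k : ℝ) * (-(k / a)) ≤ (1 + -((k : ℝ) / a)) ^ k := by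
      refine one_add_mul_le_pow ?_ k
      have : (k : ℝ) / a ≤ 1 := by rwa [div_le_one haR]
      linarith
    refine le_trans ?_ h3
    have h7 : ((a : ℝ) - k) ^ k = (1 + -((k : ℝ) / a)) ^ k * a ^ k := by
      rw [← mul_pow]; congr 1; field_simp; ring
    rw [h7]
    refine mul_le_mul_of_nonneg_right (le_trans (le_of_eq ?_) h6) (by positivity)
    ring
  have e2 : (b.descFactorial k : ℝ) ≤ b ^ k := by exact_mod_cast Nat.descFactorial_le_pow b k
  have e3 : h ≤ c * (b : ℝ) ^ k := hhit.trans (mul_le_mul_of_nonneg_left e2 hc0)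
  have hbk : (0 : ℝ) < (b : ℝ) ^ k := by positivity
  rw [div_pow, mul_div_assoc', div_le_iff₀ hbk]
  calc h * (1 - (k : ℝ) ^ 2 / a) * a ^ k = h * ((1 - (k : ℝ) ^ 2 / a) * a ^ k) := by ring
    _ ≤ (c * (b : ℝ) ^ k) * ((1 - (k : ℝ) ^ 2 / a) * a ^ k) :=
        mul_le_mul_of_nonneg_right e3 (mul_nonneg (by linarith) (by positivity))
    _ ≤ (c * (b : ℝ) ^ k) * a.descFactorial k := mul_le_mul_of_nonneg_left e1 (by positivity)
    _ = _ := by ring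

end Agree

/-! ### Collisions in tables and verification of candidates -/

theorem ind_mul {Ω : Type*} (E F : Ω → Prop) (ω : Ω) :
    ind E ω * ind F ω = ind (fun ω => E ω ∧ F ω) ω := by
  unfold ind; split_ifs <;> simp_all

theorem ind_prod {Ω ι : Type*} (s : Finset ι) (E : ι → Ω → Prop) (ω : Ω) :
    ∏ i ∈ s, ind (E i) ω = ind (fun ω => ∀ i ∈ s, E i ω) ω := by
  classical
  induction s using Finset.induction_on with
  | empty => simp [ind]
  | insert a s ha ih => rw [prod_insert ha, ih, ind_mul]; simp

theorem jaccard_nonneg {α : Type*} [DecidableEq α] (A B : Finset α) : 0 ≤ jaccard A B := by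
  unfold jaccard; positivity

theorem jaccard_le_one {α : Type*} [DecidableEq α] (A B : Finset α) : jaccard A B ≤ 1 :=
  div_le_one_of_le₀ (Nat.cast_le.2 (card_le_card (inter_subset_left.trans subset_union_left)))
    (Nat.cast_nonneg _)

section

variable {M m K T : ℕ}

/-- The bins: `K` for each of the `m` functions of each of the three chunks, and `T` for the
verification of candidates. -/
abbrev Bin (m K T : ℕ) := (Fin 3 × Fin m × Fin K) ⊕ Fin T

/-- The bins used by the table `φ`. -/
def tableBins (T : ℕ) (φ : Fin 3 → Fin m) : Finset (Bin m K T) :=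
  (univ : Finset (Fin 3 × Fin K)).image fun x => .inl (x.1, φ x.1, x.2)

/-- The sets `A` and `Q` collide in the table `φ`. -/
def Collide (ω : Rnd M (Bin m K T)) (A Q : Finset (Fin M)) (φ : Fin 3 → Fin m) : Prop :=
  ∀ l ∈ tableBins T φ, Agree ω A Q l

open Classical in
/-- The number of verification bins in which `A` and `Q` agree. -/
noncomputable def verCount (ω : Rnd M (Bin m K T)) (A Q : Finset (Fin M)) : ℕ :=
  (univ.filter fun v : Fin T => Agree ω A Q (.inr v)).card

theorem mem_tableBins {φ : Fin 3 → Fin m} {s : Fin 3} {i : Fin m} {l : Fin K} :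
    (.inl (s, i, l) : Bin m K T) ∈ tableBins T φ ↔ φ s = i := by
  simp [tableBins]

theorem inr_notMem_tableBins {φ : Fin 3 → Fin m} {v : Fin T} :
    (.inr v : Bin m K T) ∉ tableBins T φ := by
  simp [tableBins]

theorem card_tableBins (φ : Fin 3 → Fin m) : (tableBins T φ : Finset (Bin m K T)).card = 3 * K := by
  rw [tableBins, card_image_of_injective]
  · simp
  · rintro ⟨a, b⟩ ⟨c, d⟩ h
    simp only [Sum.inl.injEq, Prod.mk.injEq] at h
    rw [h.1, h.2.2]

/-- In each chunk two tables use the same `K` bins if they choose the same function, and disjoint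
sets of `K` bins otherwise. So the power is a product over the chunks. -/
theorem pow_card_union (φ φ' : Fin 3 → Fin m) (J : ℝ) :
    J ^ (tableBins T φ ∪ tableBins T φ' : Finset (Bin m K T)).card =
      ∏ s, if φ s = φ' s then J ^ K else (J ^ K) ^ 2 := by
  have h1 : J ^ (tableBins T φ ∪ tableBins T φ' : Finset (Bin m K T)).card =
      ∏ x : Bin m K T, if x ∈ tableBins T φ ∪ tableBins T φ' then J else 1 := by
    rw [prod_ite_mem, univ_inter, prod_const]
  rw [h1, Fintype.prod_sum_type]
  simp only [mem_union, mem_tableBins, inr_notMem_tableBins, or_self, if_false, prod_const_one, mul_one,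
    Fintype.prod_prod_type, prod_const, card_univ, Fintype.card_fin]
  refine prod_congr rfl fun s _ => ?_
  rw [prod_pow]
  have h2 : (univ.filter fun i : Fin m => φ s = i ∨ φ' s = i) = {φ s, φ' s} := by
    ext i; simp [eq_comm]
  rw [prod_ite, prod_const_one, mul_one, prod_const, h2]
  split_ifs with h
  · simp [h]
  · rw [card_pair h]; ring

/-- The sum over pairs of tables factors into three equal sums over pairs of functions. With `x = m
* J ^ K` each is at most `x + x ^ 2`, and this is at most `2 * x ^ 2` because `x ≥ 1`. -/
theorem second_moment [NeZero T] (A Q : Finset (Fin M)) (hm : 1 ≤ m * jaccard A Q ^ K) :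
    mean (fun ω : Rnd M (Bin m K T) => (∑ φ, ind (fun ω => Collide ω A Q φ) ω) ^ 2) ≤
      8 * ((m * jaccard A Q ^ K) ^ 3) ^ 2 := by
  set J := jaccard A Q with hJ
  have hJ0 : 0 ≤ J := jaccard_nonneg _ _
  set y := J ^ K with hy
  have hy0 : 0 ≤ y := pow_nonneg hJ0 _
  have h1 : ∀ ω : Rnd M (Bin m K T), (∑ φ, ind (fun ω => Collide ω A Q φ) ω) ^ 2 =
      ∑ φ, ∑ φ', ind (fun ω : Rnd M (Bin m K T) => ∀ l ∈ tableBins T φ ∪ tableBins T φ', Agree ω A Q l) ω := by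
    intro ω
    rw [sq, sum_mul_sum]
    refine sum_congr rfl fun φ _ => sum_congr rfl fun φ' _ => ?_
    rw [ind_mul]
    congr 1
    funext ω
    simp only [Collide, mem_union, or_imp, forall_and]
  simp only [h1, mean_sum]
  have h2 : ∀ φ φ' : Fin 3 → Fin m, mean (ind (fun ω : Rnd M (Bin m K T) =>
      ∀ l ∈ tableBins T φ ∪ tableBins T φ', Agree ω A Q l)) ≤
      ∏ s, if φ s = φ' s then y else y ^ 2 := fun φ φ' => by
    rw [← pow_card_union (T := T)]
    have : Nonempty (Bin m K T) := ⟨.inr 0⟩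
    exact pr_agree_le A Q _
  have h3 : ∀ i : Fin m, ∑ i' : Fin m, (if i = i' then y else y ^ 2) ≤ y + m * y ^ 2 := by
    intro i
    calc ∑ i' : Fin m, (if i = i' then y else y ^ 2) ≤ ∑ i' : Fin m, ((if i = i' then y else 0) + y ^ 2) := by
          refine sum_le_sum fun i' _ => ?_
          split_ifs
          · nlinarith
          · simp
      _ = _ := by simp [sum_add_distrib]
  have h3' : ∀ i : Fin m, 0 ≤ ∑ i' : Fin m, (if i = i' then y else y ^ 2) := fun i =>
    sum_nonneg fun i' _ => by split_ifs <;> positivity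
  calc _ ≤ ∑ φ : Fin 3 → Fin m, ∑ φ' : Fin 3 → Fin m, ∏ s, (if φ s = φ' s then y else y ^ 2) :=
        sum_le_sum fun φ _ => sum_le_sum fun φ' _ => h2 φ φ'
    _ = ∑ φ : Fin 3 → Fin m, ∏ s, ∑ i' : Fin m, (if φ s = i' then y else y ^ 2) := by
        refine sum_congr rfl fun φ _ => ?_
        rw [prod_univ_sum]
        simp [Fintype.piFinset_univ]
    _ ≤ ∑ φ : Fin 3 → Fin m, ∏ s : Fin 3, (y + m * y ^ 2) :=
        sum_le_sum fun φ _ => prod_le_prod (fun s _ => h3' _) fun s _ => h3 _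
    _ = (m * y + (m * y) ^ 2) ^ 3 := by
        simp only [prod_const, sum_const, card_univ, Fintype.card_fun, Fintype.card_fin, nsmul_eq_mul]
        push_cast
        ring
    _ ≤ (2 * (m * y) ^ 2) ^ 3 := by
        refine pow_le_pow_left₀ (by positivity) ?_ 3
        nlinarith
    _ = _ := by ring

/-- The mean number of colliding tables is at least `x ^ 3 / 2`, since the two factors lost in
`le_pr_agree` are at least `3/4`. With the second moment `8 * x ^ 6`, `mean_sq_le` gives `(1/4) /
8`. -/
theorem pr_exists_collide [NeZero T] (A Q : Finset (Fin M)) (ha : 0 < (A ∩ Q).card)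
    (hm : 1 ≤ m * jaccard A Q ^ K) (hK : 4 * (3 * K) ^ 2 ≤ (A ∩ Q).card)
    (ht : 4 * (3 * K) * (3 * m * K + T) ≤ (A ∪ Q).card) :
    1 / 32 ≤ pr (fun ω : Rnd M (Bin m K T) => ∃ φ, Collide ω A Q φ) := by
  have : Nonempty (Bin m K T) := ⟨.inr 0⟩
  set x := m * jaccard A Q ^ K with hx
  have hsm := second_moment (T := T) A Q hm
  set X : Rnd M (Bin m K T) → ℝ := fun ω => ∑ φ, ind (fun ω => Collide ω A Q φ) ω with hX
  have haR : (0 : ℝ) < (A ∩ Q).card := by exact_mod_cast ha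
  have hb : 0 < (A ∪ Q).card :=
    ha.trans_le (card_le_card (inter_subset_left.trans subset_union_left))
  have hbR : (0 : ℝ) < (A ∪ Q).card := by exact_mod_cast hb
  have hJ0 := jaccard_nonneg A Q
  have h1 : x ^ 3 / 2 ≤ mean X := by
    rw [hX, mean_sum]
    have e1 : ∀ φ : Fin 3 → Fin m, jaccard A Q ^ (3 * K) / 2 ≤
        mean (ind fun ω : Rnd M (Bin m K T) => Collide ω A Q φ) := by
      intro φ
      have h := le_pr_agree A Q (tableBins T φ : Finset (Bin m K T)) ha (by rw [card_tableBins]; nlinarith)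
      rw [card_tableBins] at h
      refine le_trans ?_ h
      have hcard : (Fintype.card (Bin m K T) : ℝ) = 3 * m * K + T := by
        simp [Fintype.card_sum, Fintype.card_prod]; ring
      rw [hcard]
      have f1 : ((3 * K : ℕ) : ℝ) * ((3 * m * K + T) / (A ∪ Q).card) ≤ 1 / 4 := by
        rw [mul_div_assoc', div_le_iff₀ hbR]
        have : (4 * (3 * K) * (3 * m * K + T) : ℝ) ≤ (A ∪ Q).card := by exact_mod_cast ht
        push_cast
        linarith
      have f2 : ((3 * K : ℕ) : ℝ) ^ 2 / (A ∩ Q).card ≤ 1 / 4 := by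
        rw [div_le_iff₀ haR]
        have : (4 * (3 * K) ^ 2 : ℝ) ≤ (A ∩ Q).card := by exact_mod_cast hK
        push_cast
        linarith
      have f3 : (1 / 2 : ℝ) ≤ (1 - ((3 * K : ℕ) : ℝ) * ((3 * m * K + T) / (A ∪ Q).card)) *
          (1 - ((3 * K : ℕ) : ℝ) ^ 2 / (A ∩ Q).card) := by
        nlinarith
      have := mul_le_mul_of_nonneg_right f3 (pow_nonneg hJ0 (3 * K))
      linarith
    calc x ^ 3 / 2 = ∑ φ : Fin 3 → Fin m, jaccard A Q ^ (3 * K) / 2 := by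
          simp only [sum_const, card_univ, Fintype.card_fun, Fintype.card_fin, nsmul_eq_mul, hx]
          push_cast
          ring
      _ ≤ _ := sum_le_sum fun φ _ => e1 φ
  have h2 := mean_sq_le X
  have h3 : pr (fun ω => X ω ≠ 0) ≤ pr (fun ω : Rnd M (Bin m K T) => ∃ φ, Collide ω A Q φ) := by
    refine pr_mono fun ω h => ?_
    by_contra hne
    push Not at hne
    exact h (sum_eq_zero fun φ _ => if_neg (hne φ))
  have hx3 : 1 ≤ x ^ 3 := one_le_pow₀ hm
  have h4 : (x ^ 3 / 2) ^ 2 ≤ mean X ^ 2 := pow_le_pow_left₀ (by positivity) h1 2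
  have h5 : mean (fun ω => X ω ^ 2) * pr (fun ω => X ω ≠ 0) ≤ 8 * (x ^ 3) ^ 2 * pr (fun ω => X ω ≠ 0) :=
    mul_le_mul_of_nonneg_right hsm (pr_nonneg _)
  have h6 : 0 < (x ^ 3) ^ 2 := by positivity
  have h7 : (x ^ 3) ^ 2 * (1 / 32) ≤ (x ^ 3) ^ 2 * pr (fun ω => X ω ≠ 0) := by nlinarith
  exact (le_of_mul_le_mul_left h7 h6).trans h3

theorem cast_verCount (ω : Rnd M (Bin m K T)) (A Q : Finset (Fin M)) :
    (verCount ω A Q : ℝ) = ∑ v : Fin T, ind (fun ω => Agree ω A Q (.inr v)) ω := by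
  simp [verCount, ind]

/-- A Chernoff bound without independence: `(1 + lam) ^ count` expands into the sum over all sets
`S` of bins of `lam ^ |S|` times the indicator of agreement on `S`, so the bounds of `pr_agree_le`
suffice. Markov's inequality does the rest. -/
theorem pr_le_verCount [NeZero T] (A Q : Finset (Fin M)) {j : ℝ} (hj : jaccard A Q ≤ j) {lam : ℝ}
    (hlam : 0 < lam) (Θ : ℕ) :
    pr (fun ω : Rnd M (Bin m K T) => Θ ≤ verCount ω A Q) ≤ (1 + lam * j) ^ T / (1 + lam) ^ Θ := by
  have : Nonempty (Bin m K T) := ⟨.inr 0⟩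
  have hJ0 := jaccard_nonneg A Q
  have hp : (0 : ℝ) < (1 + lam) ^ Θ := by positivity
  have hg : ∀ ω : Rnd M (Bin m K T), (1 + lam) ^ verCount ω A Q =
      ∑ S ∈ (univ : Finset (Fin T)).powerset, lam ^ S.card *
        ind (fun ω => ∀ l ∈ S.map ⟨Sum.inr, Sum.inr_injective⟩, Agree ω A Q l) ω := by
    intro ω
    have e1 : (1 + lam) ^ verCount ω A Q =
        ∏ v : Fin T, (1 + lam * ind (fun ω => Agree ω A Q (.inr v)) ω) := by
      classical
      rw [verCount, ← prod_const, prod_filter]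
      refine prod_congr rfl fun v _ => ?_
      unfold ind
      split_ifs <;> simp
    rw [e1, prod_one_add]
    refine sum_congr rfl fun S _ => ?_
    rw [prod_mul_distrib, prod_const, ind_prod]
    congr 2
    funext ω
    simp
  have hmean : mean (fun ω : Rnd M (Bin m K T) => (1 + lam) ^ verCount ω A Q) ≤ (1 + lam * j) ^ T := by
    simp only [hg, mean_sum, mean_const_mul]
    calc _ ≤ ∑ S ∈ (univ : Finset (Fin T)).powerset, lam ^ S.card * jaccard A Q ^ S.card := by
          refine sum_le_sum fun S _ => mul_le_mul_of_nonneg_left ?_ (by positivity)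
          have := pr_agree_le A Q (S.map ⟨Sum.inr, Sum.inr_injective⟩ : Finset (Bin m K T))
          rwa [card_map] at this
      _ = (1 + lam * jaccard A Q) ^ T := by
          have := prod_one_add (f := fun _ => lam * jaccard A Q) (univ : Finset (Fin T))
          simp only [prod_const, card_univ, Fintype.card_fin] at this
          rw [this]
          exact sum_congr rfl fun S _ => by rw [mul_pow]
      _ ≤ _ := pow_le_pow_left₀ (by positivity) (by nlinarith) T
  have hmk := markov (g := fun ω : Rnd M (Bin m K T) => (1 + lam) ^ verCount ω A Q)
    (fun ω => by positivity) ((1 + lam) ^ Θ)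
  rw [le_div_iff₀ hp]
  refine le_trans ?_ (hmk.trans hmean)
  rw [mul_comm]
  refine mul_le_mul_of_nonneg_left (pr_mono fun ω h => ?_) hp.le
  exact pow_le_pow_right₀ (by linarith) h

/-- Chebyshev's inequality around `T * J` instead of the true mean. The mean is at least `(1 - δ) *
T * J` and the second moment at most `T * J + (T * J) ^ 2`. -/
theorem pr_verCount_lt [NeZero T] (A Q : Finset (Fin M)) (ha : 0 < (A ∩ Q).card) {d δ : ℝ} (hd : 0 < d)
    (Θ : ℕ) (hΘ : Θ + d ≤ T * jaccard A Q)
    (hδ : (3 * m * K + T : ℝ) / (A ∪ Q).card + 1 / (A ∩ Q).card ≤ δ) :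
    pr (fun ω : Rnd M (Bin m K T) => verCount ω A Q < Θ) ≤ (T + 2 * δ * T ^ 2) / d ^ 2 := by
  have : Nonempty (Bin m K T) := ⟨.inr 0⟩
  set J := jaccard A Q with hJ
  have hJ0 : 0 ≤ J := jaccard_nonneg A Q
  have hJ1 : J ≤ 1 := jaccard_le_one A Q
  have haR : (1 : ℝ) ≤ (A ∩ Q).card := by exact_mod_cast ha
  set Y : Rnd M (Bin m K T) → ℝ := fun ω => ∑ v : Fin T, ind (fun ω => Agree ω A Q (.inr v)) ω with hY
  have h1 : T * ((1 - δ) * J) ≤ mean Y := by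
    rw [hY, mean_sum]
    have e1 : ∀ v : Fin T, (1 - δ) * J ≤ mean (ind fun ω : Rnd M (Bin m K T) => Agree ω A Q (.inr v)) := by
      intro v
      have h := le_pr_agree A Q ({.inr v} : Finset (Bin m K T)) ha (by simpa using ha)
      simp only [card_singleton, mem_singleton, forall_eq, pow_one, Nat.cast_one, one_mul, one_pow] at h
      refine le_trans (mul_le_mul_of_nonneg_right ?_ hJ0) h
      have hcard : (Fintype.card (Bin m K T) : ℝ) = 3 * m * K + T := by
        simp [Fintype.card_sum, Fintype.card_prod]; ring
      rw [hcard]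
      have f1 : 0 ≤ (3 * m * K + T : ℝ) / (A ∪ Q).card := by positivity
      have f2 : 0 ≤ (1 : ℝ) / (A ∩ Q).card := by positivity
      nlinarith
    calc _ = ∑ v : Fin T, (1 - δ) * J := by simp
      _ ≤ _ := sum_le_sum fun v _ => e1 v
  have h2 : mean (fun ω => Y ω ^ 2) ≤ T * J + T ^ 2 * J ^ 2 := by
    have e1 : ∀ ω : Rnd M (Bin m K T), Y ω ^ 2 = ∑ v : Fin T, ∑ v' : Fin T,
        ind (fun ω : Rnd M (Bin m K T) => ∀ l ∈ ({.inr v, .inr v'} : Finset (Bin m K T)), Agree ω A Q l) ω := by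
      intro ω
      rw [hY, sq, sum_mul_sum]
      refine sum_congr rfl fun v _ => sum_congr rfl fun v' _ => ?_
      rw [ind_mul]
      congr 1
      funext ω
      simp
    simp only [e1, mean_sum]
    have e2 : ∀ v v' : Fin T, mean (ind fun ω : Rnd M (Bin m K T) =>
        ∀ l ∈ ({.inr v, .inr v'} : Finset (Bin m K T)), Agree ω A Q l) ≤
        (if v = v' then J else 0) + J ^ 2 := by
      intro v v'
      refine (pr_agree_le A Q _).trans ?_
      split_ifs with h
      · subst h
        simp only [pair_eq_singleton, card_singleton, pow_one]
        nlinarith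
      · rw [card_pair (by simpa using h), zero_add]
    calc _ ≤ ∑ v : Fin T, ∑ v' : Fin T, ((if v = v' then J else 0) + J ^ 2) :=
          sum_le_sum fun v _ => sum_le_sum fun v' _ => e2 v v'
      _ = _ := by simp [sum_add_distrib]; ring
  have h3 : mean (fun ω => (T * J - Y ω) ^ 2) ≤ T + 2 * δ * T ^ 2 := by
    have e1 : (fun ω => (T * J - Y ω) ^ 2) = fun ω => (Y ω ^ 2 + ((-(2 * T * J)) * Y ω + (T * J) ^ 2)) := by
      funext ω; ring
    rw [e1, mean_add, mean_add, mean_const_mul, mean_const]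
    have hδ0 : 0 ≤ δ := le_trans (by positivity) hδ
    have hT0 : (0 : ℝ) ≤ T := Nat.cast_nonneg _
    have e2 := mul_le_mul_of_nonneg_left h1 (by positivity : (0 : ℝ) ≤ 2 * T * J)
    have e3 : δ * T ^ 2 * J ^ 2 ≤ δ * T ^ 2 * 1 :=
      mul_le_mul_of_nonneg_left (pow_le_one₀ hJ0 hJ1) (by positivity)
    have e4 : (T : ℝ) * J ≤ T * 1 := mul_le_mul_of_nonneg_left hJ1 hT0
    nlinarith
  have hmk := markov (g := fun ω => (T * J - Y ω) ^ 2) (fun ω => sq_nonneg _) (d ^ 2)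
  rw [le_div_iff₀ (by positivity), mul_comm]
  refine le_trans (mul_le_mul_of_nonneg_left (pr_mono fun ω h => ?_) (by positivity)) (hmk.trans h3)
  have hYΘ : Y ω ≤ Θ := by
    rw [hY]
    simp only
    rw [← cast_verCount]
    exact_mod_cast h.le
  exact pow_le_pow_left₀ hd.le (by linarith) 2

open Classical in
/-- The number of collisions of `Q` with sets of similarity at most `j`. -/
noncomputable def falseCount {N : ℕ} (ω : Rnd M (Bin m K T)) (A : Fin N → Finset (Fin M))
    (Q : Finset (Fin M)) (j : ℝ) : ℕ :=
  (univ.filter fun x : (Fin 3 → Fin m) × Fin N =>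
    jaccard (A x.2) Q ≤ j ∧ Collide ω (A x.2) Q x.1).card

theorem mean_falseCount_le [NeZero T] {N : ℕ} (A : Fin N → Finset (Fin M)) (Q : Finset (Fin M)) {j : ℝ}
    (hj : 0 ≤ j) :
    mean (fun ω : Rnd M (Bin m K T) => (falseCount ω A Q j : ℝ)) ≤ m ^ 3 * (N * j ^ (3 * K)) := by
  have : Nonempty (Bin m K T) := ⟨.inr 0⟩
  have h1 : ∀ ω : Rnd M (Bin m K T), (falseCount ω A Q j : ℝ) = ∑ x : (Fin 3 → Fin m) × Fin N,
      ind (fun ω => jaccard (A x.2) Q ≤ j ∧ Collide ω (A x.2) Q x.1) ω := by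
    intro ω
    simp only [falseCount, ind, sum_boole]
    congr!
  simp only [h1, mean_sum]
  have h2 : ∀ x : (Fin 3 → Fin m) × Fin N, mean (ind (fun ω : Rnd M (Bin m K T) =>
      jaccard (A x.2) Q ≤ j ∧ Collide ω (A x.2) Q x.1)) ≤ j ^ (3 * K) := by
    intro x
    by_cases hx : jaccard (A x.2) Q ≤ j
    · refine le_trans (pr_mono fun ω h => h.2) ((pr_agree_le (A x.2) Q _).trans ?_)
      rw [card_tableBins]
      exact pow_le_pow_left₀ (jaccard_nonneg _ _) hx _
    · refine le_trans (le_of_eq ?_) (by positivity : (0 : ℝ) ≤ j ^ (3 * K))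
      simp [mean, ind, hx]
  refine (sum_le_sum fun x _ => h2 x).trans (le_of_eq ?_)
  simp [Fintype.card_prod]
  ring

/-- The event that a query for `Q` succeeds, given a set `A i₀` similar to `Q`. -/
def Success {N : ℕ} (ω : Rnd M (Bin m K T)) (A : Fin N → Finset (Fin M)) (Q : Finset (Fin M)) (j : ℝ)
    (Θ Φ : ℕ) (i₀ : Fin N) : Prop :=
  (∃ φ, Collide ω (A i₀) Q φ) ∧ Θ ≤ verCount ω (A i₀) Q ∧
    (∀ i, jaccard (A i) Q ≤ j → verCount ω (A i) Q < Θ) ∧ 2 * falseCount ω A Q j ≤ Φ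

/-- A similar set collides with probability at least `1/32`, and each of the three other
requirements fails with probability at most `1/256`. What remains is `5/256`. -/
theorem pr_success [NeZero T] {N : ℕ} (A : Fin N → Finset (Fin M)) (Q : Finset (Fin M)) {j lam d δ : ℝ}
    (hj : 0 ≤ j) (Θ Φ : ℕ) (i₀ : Fin N) (ha : 0 < (A i₀ ∩ Q).card)
    (hm : 1 ≤ m * jaccard (A i₀) Q ^ K) (hK : 4 * (3 * K) ^ 2 ≤ (A i₀ ∩ Q).card)
    (ht : 4 * (3 * K) * (3 * m * K + T) ≤ (A i₀ ∪ Q).card) (hlam : 0 < lam)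
    (htail : N * ((1 + lam * j) ^ T / (1 + lam) ^ Θ) ≤ 1 / 256) (hd : 0 < d)
    (hΘ : Θ + d ≤ T * jaccard (A i₀) Q)
    (hδ : (3 * m * K + T : ℝ) / (A i₀ ∪ Q).card + 1 / (A i₀ ∩ Q).card ≤ δ)
    (hcheb : (T + 2 * δ * T ^ 2) / d ^ 2 ≤ 1 / 256) (hN : N * j ^ (3 * K) ≤ 2)
    (hΦ : Φ = 1024 * m ^ 3) :
    1 / 64 ≤ pr (fun ω : Rnd M (Bin m K T) => Success ω A Q j Θ Φ i₀) := by
  have : Nonempty (Bin m K T) := ⟨.inr 0⟩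
  have h1 := pr_exists_collide (T := T) (A i₀) Q ha hm hK ht
  have h2 := (pr_verCount_lt (m := m) (K := K) (A i₀) Q ha hd Θ hΘ hδ).trans hcheb
  have h3 : pr (fun ω : Rnd M (Bin m K T) => ∃ i ∈ (univ : Finset (Fin N)),
      jaccard (A i) Q ≤ j ∧ Θ ≤ verCount ω (A i) Q) ≤ 1 / 256 := by
    refine (pr_exists_le _ _).trans (le_trans ?_ htail)
    have e : ∀ i : Fin N, pr (fun ω : Rnd M (Bin m K T) => jaccard (A i) Q ≤ j ∧ Θ ≤ verCount ω (A i) Q) ≤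
        (1 + lam * j) ^ T / (1 + lam) ^ Θ := by
      intro i
      by_cases hi : jaccard (A i) Q ≤ j
      · exact (pr_mono fun ω h => h.2).trans (pr_le_verCount (A i) Q hi hlam Θ)
      · refine le_trans (le_of_eq ?_) (by positivity : (0 : ℝ) ≤ (1 + lam * j) ^ T / (1 + lam) ^ Θ)
        simp [pr, mean, ind, hi]
    refine (sum_le_sum fun i _ => e i).trans (le_of_eq ?_)
    simp
  have hm0 : (0 : ℝ) < m := by
    rcases Nat.eq_zero_or_pos m with h0 | h0
    · rw [h0] at hm; norm_num at hm
    · exact_mod_cast h0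
  -- Markov's inequality: the mean is at most `2 * m ^ 3`, and `512 * m ^ 3` is half of `Φ`.
  have h4 : pr (fun ω : Rnd M (Bin m K T) => (512 * m ^ 3 : ℝ) ≤ (falseCount ω A Q j : ℝ)) ≤ 1 / 256 := by
    have hmk := markov (g := fun ω : Rnd M (Bin m K T) => (falseCount ω A Q j : ℝ))
      (fun ω => Nat.cast_nonneg _) (512 * m ^ 3)
    have hmean := mean_falseCount_le (m := m) (K := K) (T := T) A Q hj
    have e : (m : ℝ) ^ 3 * (N * j ^ (3 * K)) ≤ m ^ 3 * 2 := mul_le_mul_of_nonneg_left hN (by positivity)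
    have hp : (0 : ℝ) < 512 * m ^ 3 := by positivity
    refine le_of_mul_le_mul_left (a := (512 * m ^ 3 : ℝ)) ?_ hp
    linarith
  have hall : pr (fun ω : Rnd M (Bin m K T) => ∃ φ, Collide ω (A i₀) Q φ) ≤
      pr (fun ω : Rnd M (Bin m K T) => Success ω A Q j Θ Φ i₀) +
      (pr (fun ω : Rnd M (Bin m K T) => verCount ω (A i₀) Q < Θ) +
      (pr (fun ω : Rnd M (Bin m K T) => ∃ i ∈ (univ : Finset (Fin N)),
        jaccard (A i) Q ≤ j ∧ Θ ≤ verCount ω (A i) Q) +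
      pr (fun ω : Rnd M (Bin m K T) => (512 * m ^ 3 : ℝ) ≤ (falseCount ω A Q j : ℝ)))) := by
    refine le_trans (pr_mono (F := fun ω : Rnd M (Bin m K T) => Success ω A Q j Θ Φ i₀ ∨
      (verCount ω (A i₀) Q < Θ ∨ ((∃ i ∈ (univ : Finset (Fin N)),
        jaccard (A i) Q ≤ j ∧ Θ ≤ verCount ω (A i) Q) ∨
        (512 * m ^ 3 : ℝ) ≤ (falseCount ω A Q j : ℝ)))) fun ω h => ?_) ?_
    · by_contra hne
      push Not at hne
      obtain ⟨n1, n2, n3, n4⟩ := hne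
      refine n1 ⟨h, n2, fun i hi => n3 i (mem_univ _) hi, ?_⟩
      have : falseCount ω A Q j < 512 * m ^ 3 := by exact_mod_cast n4
      omega
    · refine (pr_or_le _ _).trans (add_le_add_right ((pr_or_le _ _).trans
        (add_le_add_right (pr_or_le _ _) _)) _)
  linarith

end

namespace WordRAM

/-! ### Sketches as arrays of numbers -/

section Sketch

variable {M m K T : ℕ}

/-- The numbering of the bins. -/
def binNum : Bin m K T → ℕ
  | .inl (s, i, l) => (s * m + i) * K + l
  | .inr v => 3 * m * K + v

theorem binNum_lt (b : Bin m K T) : binNum b < 3 * m * K + T := by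
  rcases b with ⟨s, i, l⟩ | v
  · have h1 : (s : ℕ) * m + i + 1 ≤ 3 * m := by
      have : ((s : ℕ) + 1) * m ≤ 3 * m := Nat.mul_le_mul_right _ s.2
      have := i.2
      rw [Nat.succ_mul] at *
      omega
    have h2 : ((s : ℕ) * m + i + 1) * K ≤ 3 * m * K := Nat.mul_le_mul_right _ h1
    have := l.2
    rw [Nat.succ_mul] at h2
    simp only [binNum]
    omega
  · simp only [binNum]; omega

theorem binNum_injective : Function.Injective (binNum : Bin m K T → ℕ) := by
  have hlt : ∀ (s : Fin 3) (i : Fin m) (l : Fin K), (s * m + i) * K + l < 3 * m * K := by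
    intro s i l
    exact (binNum_lt (T := 0) (.inl (s, i, l)))
  have hdm : ∀ {a b c d n : ℕ}, b < n → d < n → a * n + b = c * n + d → a = c ∧ b = d := by
    intro a b c d n hb hd h
    have h1 := congrArg (· % n) h
    have e : ∀ x y, y < n → (x * n + y) % n = y := fun x y hy => by
      rw [mul_comm, Nat.mul_add_mod, Nat.mod_eq_of_lt hy]
    simp only [e _ _ hb, e _ _ hd] at h1
    subst h1
    exact ⟨Nat.eq_of_mul_eq_mul_right (by omega) (Nat.add_right_cancel h), rfl⟩
  rintro (⟨s, i, l⟩ | v) (⟨s', i', l'⟩ | v') h <;> simp only [binNum] at h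
  · obtain ⟨h1, h2⟩ := hdm l.2 l'.2 h
    obtain ⟨h3, h4⟩ := hdm i.2 i'.2 h1
    rw [Fin.ext h2, Fin.ext h3, Fin.ext h4]
  · have := hlt s i l; omega
  · have := hlt s' i' l'; omega
  · rw [Fin.ext (show (v : ℕ) = v' by omega)]

/-- The bin of a slot. -/
def binOf (ω : Rnd M (Bin m K T)) (x : ℕ) : ℕ := if h : x < M then binNum (ω.1 ⟨x, h⟩) else 0

/-- The rank of a slot. -/
def rankOf (ω : Rnd M (Bin m K T)) (x : ℕ) : ℕ := if h : x < M then ω.2 ⟨x, h⟩ else 0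

/-- A set of natural numbers as a subset of `Fin M`. -/
def toFin (M : ℕ) (X : Finset ℕ) : Finset (Fin M) := univ.filter fun x => (x : ℕ) ∈ X

theorem mem_toFin {X : Finset ℕ} {x : Fin M} : x ∈ toFin M X ↔ (x : ℕ) ∈ X := by simp [toFin]

theorem card_toFin {X : Finset ℕ} (hX : X ⊆ range M) : (toFin M X).card = X.card := by
  rw [← card_image_of_injective (toFin M X) Fin.val_injective]
  congr 1
  ext x
  simp only [mem_image, mem_toFin]
  exact ⟨fun ⟨a, h, e⟩ => e ▸ h, fun h => ⟨⟨x, mem_range.1 (hX h)⟩, h, rfl⟩⟩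

theorem toFin_inter (X Y : Finset ℕ) : toFin M X ∩ toFin M Y = toFin M (X ∩ Y) := by
  ext; simp [mem_toFin]

theorem toFin_union (X Y : Finset ℕ) : toFin M X ∪ toFin M Y = toFin M (X ∪ Y) := by
  ext; simp [mem_toFin]

theorem sketch_le_iff (ω : Rnd M (Bin m K T)) {X : Finset ℕ} (hX : X ⊆ range M) (d c : ℕ)
    (l : Bin m K T) : sketch (binOf ω) (rankOf ω) d X (binNum l) ≤ c ↔
      d ≤ c ∨ ∃ x ∈ toFin M X, ω.1 x = l ∧ (ω.2 x : ℕ) ≤ c := by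
  unfold sketch
  rw [fold_min_le]
  refine or_congr_right ⟨?_, ?_⟩
  · rintro ⟨x, hx, hc⟩
    rw [mem_filter] at hx
    have hxM := mem_range.1 (hX hx.1)
    refine ⟨⟨x, hxM⟩, mem_toFin.2 hx.1, binNum_injective ?_, ?_⟩
    · simpa [binOf, hxM] using hx.2
    · simpa [rankOf, hxM] using hc
  · rintro ⟨x, hx, rfl, hc⟩
    exact ⟨x, mem_filter.2 ⟨mem_toFin.1 hx, by simp [binOf]⟩, by simpa [rankOf] using hc⟩

theorem le_sketch_iff (ω : Rnd M (Bin m K T)) {X : Finset ℕ} (hX : X ⊆ range M) (d c : ℕ)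
    (l : Bin m K T) : c ≤ sketch (binOf ω) (rankOf ω) d X (binNum l) ↔
      c ≤ d ∧ ∀ x ∈ toFin M X, ω.1 x = l → c ≤ (ω.2 x : ℕ) := by
  rcases Nat.eq_zero_or_pos c with rfl | hc
  · simp
  · have h := sketch_le_iff ω hX d (c - 1) l
    constructor
    · intro h'
      have h2 := h.not.1 (by omega)
      push Not at h2
      exact ⟨by omega, fun x hx hl => by have := h2.2 x hx hl; omega⟩
    · rintro ⟨h1, h2⟩
      by_contra hlt
      rcases h.1 (by omega) with h3 | ⟨x, hx, hl, h3⟩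
      · omega
      · have := h2 x hx hl; omega

/-- Stored sketches have the default `M + 1` and asked ones `M`. Both exceed all ranks and they
differ, so an empty bin never produces equality. Equal values are the rank of one common element, as
ranks are distinct, and it is minimal in both sets. -/
theorem sketch_eq_iff (ω : Rnd M (Bin m K T)) {X Y : Finset ℕ} (hX : X ⊆ range M)
    (hY : Y ⊆ range M) (l : Bin m K T) :
    sketch (binOf ω) (rankOf ω) (M + 1) X (binNum l) = sketch (binOf ω) (rankOf ω) M Y (binNum l) ↔
      Agree ω (toFin M X) (toFin M Y) l := by
  constructor
  · intro h
    have hM := sketch_le (binOf ω) (rankOf ω) M Y (binNum l)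
    obtain ⟨-, hmX⟩ := (le_sketch_iff ω hX _ _ l).1 h.symm.le
    obtain ⟨-, hmY⟩ := (le_sketch_iff ω hY _ _ l).1 h.le
    rw [h] at hmY
    rcases (sketch_le_iff ω hX _ _ l).1 h.le with h1 | ⟨x, hx, hxl, hxc⟩
    · omega
    have hx2 := hmX x hx hxl
    rcases (sketch_le_iff ω hY _ _ l).1 (le_refl (sketch (binOf ω) (rankOf ω) M Y (binNum l))) with
      h1 | ⟨y, hy, hyl, hyc⟩
    · have := (ω.2 x).2; omega
    have hy2 := hmY y hy hyl
    have hxy : x = y := ω.2.injective (Fin.ext (by omega))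
    subst hxy
    refine ⟨x, mem_inter.2 ⟨hx, hy⟩, hxl, fun z hz hzl => ?_⟩
    rw [Fin.le_def]
    rcases mem_union.1 hz with hz | hz
    · have := hmX z hz hzl; omega
    · have := hmY z hz hzl; omega
  · rintro ⟨x, hx, hxl, hmin⟩
    rw [mem_inter] at hx
    have e : ∀ {Z : Finset ℕ} {d : ℕ}, Z ⊆ range M → M ≤ d → x ∈ toFin M Z →
        toFin M Z ⊆ toFin M X ∪ toFin M Y →
        sketch (binOf ω) (rankOf ω) d Z (binNum l) = ω.2 x := by
      intro Z d hZ hd hxZ hsub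
      refine le_antisymm ((sketch_le_iff ω hZ _ _ l).2 (.inr ⟨x, hxZ, hxl, le_rfl⟩))
        ((le_sketch_iff ω hZ _ _ l).2 ⟨by have := (ω.2 x).2; omega, fun z hz hzl => ?_⟩)
      exact hmin z (hsub hz) hzl
    rw [e hX (by omega) hx.1 subset_union_left, e hY le_rfl hx.2 subset_union_right]

end Sketch

/-! ### Class numbers for groups of bins -/

section Classes

variable {N : ℕ}

open Classical in
/-- One plus the index of a set of class `z` with the value `w` in the next bin, or `0`. -/
noncomputable def nextClass (c v : Fin N → ℕ) (z w : ℕ) : ℕ :=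
  if h : ∃ i, c i = z ∧ v i = w then (h.choose : ℕ) + 1 else 0

theorem nextClass_le (c v : Fin N → ℕ) (z w : ℕ) : nextClass c v z w ≤ N := by
  unfold nextClass
  split_ifs with h
  · exact h.choose.2
  · exact Nat.zero_le _

theorem nextClass_ne_zero {c v : Fin N → ℕ} {z w : ℕ} (h : ∃ i, c i = z ∧ v i = w) :
    nextClass c v z w ≠ 0 := by
  rw [nextClass, dif_pos h]; omega

theorem exists_of_nextClass_ne_zero {c v : Fin N → ℕ} {z w : ℕ} (h : nextClass c v z w ≠ 0) :
    ∃ i, c i = z ∧ v i = w := by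
  by_contra hne
  exact h (dif_neg hne)

/-- A nonzero number names a stored set with the given class and value, and this set determines
both. -/
theorem nextClass_inj {c v : Fin N → ℕ} {z w z' w' : ℕ} (h : nextClass c v z w = nextClass c v z' w')
    (h' : ∃ i, c i = z' ∧ v i = w') : z = z' ∧ w = w' := by
  have h1 := nextClass_ne_zero h'
  obtain ⟨⟩ | hz := em' (∃ i, c i = z ∧ v i = w)
  · rename_i hz
    rw [← h, nextClass, dif_neg hz] at h1
    exact absurd rfl h1
  · rw [nextClass, nextClass, dif_pos hz, dif_pos h'] at h
    have e : hz.choose = h'.choose := Fin.ext (by omega)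
    have a := hz.choose_spec
    have b := h'.choose_spec
    rw [e] at a
    exact ⟨a.1.symm.trans b.1, a.2.symm.trans b.2⟩

/-- The class of the `l`-prefix of the `g`-th chunk of each of the sketches `b i`. -/
noncomputable def setClass (b : Fin N → ℕ → ℕ) (K g : ℕ) : ℕ → Fin N → ℕ
  | 0 => fun _ => 1
  | l + 1 => fun i => nextClass (setClass b K g l) (fun i => b i (g * K + l)) (setClass b K g l i)
      (b i (g * K + l))

theorem setClass_le (b : Fin N → ℕ → ℕ) (K g l : ℕ) (i : Fin N) : setClass b K g l i ≤ N := by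
  cases l with
  | zero => exact i.pos
  | succ l => exact nextClass_le _ _ _ _

/-- The classes are the nodes of a trie of the stored sketches: by induction, equal classes mean
equal prefixes. Thus one word stands for `K` values. A prefix that no set has leads to `0`, the
class of no set. -/
theorem cls_eq_setClass_iff {F : ℕ → ℕ} {Z K g : ℕ} {b : Fin N → ℕ → ℕ} {q : ℕ → ℕ}
    (hF : ∀ l < K, ∀ z < Z, F (enc Z 1 g l z (q (g * K + l)) 0) =
      nextClass (setClass b K g l) (fun i => b i (g * K + l)) z (q (g * K + l)))
    (hFZ : ∀ x, F x < Z) (hZ : 1 < Z) (i : Fin N) :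
    cls F Z q K g K = setClass b K g K i ↔ ∀ l < K, b i (g * K + l) = q (g * K + l) := by
  have key : ∀ l ≤ K, (cls F Z q K g l = setClass b K g l i ↔ ∀ l' < l, b i (g * K + l') = q (g * K + l')) := by
    intro l
    induction l with
    | zero => intro _; simp [cls, setClass]
    | succ l ih =>
      intro hl
      rw [cls, setClass, hF l (by omega) _ (cls_lt hFZ hZ _ _ _ _)]
      constructor
      · intro h
        obtain ⟨h1, h2⟩ := nextClass_inj h ⟨i, rfl, rfl⟩
        intro l' hl'
        rcases Nat.lt_succ_iff_lt_or_eq.1 hl' with h3 | rfl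
        · exact (ih (by omega)).1 h1 l' h3
        · exact h2.symm
      · intro h
        dsimp only
        rw [(ih (by omega)).2 fun l' hl' => h l' (by omega), h l (by omega)]
  exact key K le_rfl

end Classes

/-! ### Buckets and the candidates of a query -/

/-- The sets of classes `z₁, z₂, z₃` in the table `τ`. -/
noncomputable def bucket {N : ℕ} (b : Fin N → ℕ → ℕ) (m K τ z₁ z₂ z₃ : ℕ) : List (Fin N) :=
  (List.finRange N).filter fun i => setClass b K (τ % m) K i = z₁ ∧
    setClass b K (m + τ / m % m) K i = z₂ ∧ setClass b K (m + m + τ / (m * m) % m) K i = z₃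

section

variable {M m K T N : ℕ} (ω : Rnd M (Bin m K T)) (XA : Fin N → Finset ℕ) (XQ : Finset ℕ)
  (F : ℕ → ℕ) (Z : ℕ)

/-- The stored sketches. -/
def storedSketch (i : Fin N) : ℕ → ℕ := sketch (binOf ω) (rankOf ω) (M + 1) (XA i)

/-- The sketch of the query. -/
def askedSketch : ℕ → ℕ := sketch (binOf ω) (rankOf ω) M XQ

/-- The dictionary `F` answers the lookups for classes and candidates. -/
structure Describes : Prop where
  lt : ∀ x, F x < Z
  cls : ∀ g < 3 * m, ∀ l < K, ∀ z < Z, ∀ w < Z, F (enc Z 1 g l z w 0) =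
    nextClass (setClass (storedSketch ω XA) K g l) (fun i => storedSketch ω XA i (g * K + l)) z w
  bucket : ∀ τ < m * m * m, ∀ z₁ < Z, ∀ z₂ < Z, ∀ z₃ < Z, ∀ j ≤ N, F (enc Z 2 τ z₁ z₂ z₃ j) =
    ((bucket (storedSketch ω XA) m K τ z₁ z₂ z₃)[j]?.map fun i : Fin N => (i : ℕ) + 1).getD 0

/-- The candidates of the table `τ`. -/
noncomputable def tableCands (τ : ℕ) : List (Fin N) :=
  bucket (storedSketch ω XA) m K τ (cls F Z (askedSketch ω XQ) K (τ % m) K)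
    (cls F Z (askedSketch ω XQ) K (m + τ / m % m) K)
    (cls F Z (askedSketch ω XQ) K (m + m + τ / (m * m) % m) K)

/-- All candidates. -/
noncomputable def allCands : List (Fin N) := (List.range (m * m * m)).flatMap (tableCands ω XA XQ F Z)

variable {ω XA XQ F Z}

/-- The three base-`m` digits of `τ` are the functions that the table uses in the three chunks.
Equality of each class is agreement in the corresponding `K` bins. -/
theorem mem_tableCands (hF : Describes ω XA F Z) (hZ : M < Z) (hZ1 : 1 < Z)
    (hA : ∀ i, XA i ⊆ range M) (hQ : XQ ⊆ range M) (τ : Fin (m ^ 3)) (i : Fin N) :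
    i ∈ tableCands ω XA XQ F Z τ ↔
      Collide ω (toFin M (XA i)) (toFin M XQ) (finFunctionFinEquiv.symm τ) := by
  have hm : 0 < m := by
    rcases Nat.eq_zero_or_pos m with h | h
    · subst h; exact absurd τ.2 (by simp)
    · exact h
  have key : ∀ (s : Fin 3) (j : Fin m), setClass (storedSketch ω XA) K (s * m + j) K i =
      cls F Z (askedSketch ω XQ) K (s * m + j) K ↔
      ∀ l : Fin K, Agree ω (toFin M (XA i)) (toFin M XQ) (.inl (s, j, l)) := by
    intro s j
    have hg : (s : ℕ) * m + j < 3 * m := by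
      have : ((s : ℕ) + 1) * m ≤ 3 * m := Nat.mul_le_mul_right _ s.2
      have := j.2
      rw [Nat.succ_mul] at *
      omega
    rw [eq_comm, cls_eq_setClass_iff (b := storedSketch ω XA) (q := askedSketch ω XQ) (fun l hl z hz => hF.cls _ hg l hl z hz _
      ((sketch_le _ _ _ _ _).trans_lt hZ)) hF.lt hZ1]
    constructor
    · intro h l
      exact (sketch_eq_iff ω (hA i) hQ _).1 (h l l.2)
    · intro h l hl
      exact (sketch_eq_iff ω (hA i) hQ (.inl (s, j, ⟨l, hl⟩))).2 (h ⟨l, hl⟩)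
  have k0 := key 0 ⟨τ % m, Nat.mod_lt _ hm⟩
  have k1 := key 1 ⟨τ / m % m, Nat.mod_lt _ hm⟩
  have k2 := key 2 ⟨τ / (m * m) % m, Nat.mod_lt _ hm⟩
  simp only [Fin.val_zero, zero_mul, zero_add, Fin.val_one, one_mul, Fin.val_two, two_mul] at k0 k1 k2
  simp only [tableCands, bucket, List.mem_filter, List.mem_finRange, true_and, decide_eq_true_eq, k0, k1, k2]
  have e : ∀ s : Fin 3, finFunctionFinEquiv.symm τ s = ⟨τ / m ^ (s : ℕ) % m, Nat.mod_lt _ hm⟩ :=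
    fun s => Fin.ext (by simp)
  constructor
  · rintro ⟨h0, h1, h2⟩ l hl
    simp only [tableBins, mem_image, mem_univ, true_and, Prod.exists] at hl
    obtain ⟨s, l, rfl⟩ := hl
    rw [e s]
    fin_cases s
    · simpa using h0 l
    · simpa using h1 l
    · simpa [sq] using h2 l
  · intro h
    have h' : ∀ (s : Fin 3) (l : Fin K), Agree ω (toFin M (XA i)) (toFin M XQ)
        (.inl (s, ⟨τ / m ^ (s : ℕ) % m, Nat.mod_lt _ hm⟩, l)) := fun s l =>
      h _ (mem_tableBins.2 (e s))
    refine ⟨fun l => ?_, fun l => ?_, fun l => ?_⟩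
    · simpa using h' 0 l
    · simpa using h' 1 l
    · simpa [sq] using h' 2 l

theorem mem_allCands (hF : Describes ω XA F Z) (hZ : M < Z) (hZ1 : 1 < Z)
    (hA : ∀ i, XA i ⊆ range M) (hQ : XQ ⊆ range M) (i : Fin N) :
    i ∈ allCands ω XA XQ F Z ↔ ∃ φ, Collide ω (toFin M (XA i)) (toFin M XQ) φ := by
  simp only [allCands, List.mem_flatMap, List.mem_range]
  constructor
  · rintro ⟨τ, hτ, h⟩
    exact ⟨_, (mem_tableCands hF hZ hZ1 hA hQ ⟨τ, by rw [pow_succ, sq]; exact hτ⟩ i).1 h⟩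
  · rintro ⟨φ, h⟩
    refine ⟨finFunctionFinEquiv φ, ?_, (mem_tableCands hF hZ hZ1 hA hQ _ i).2 (by simpa using h)⟩
    exact (finFunctionFinEquiv φ).2.trans_eq (by ring)

-- Within one bucket no set repeats; a set met in several tables counts several times on both sides.
open Classical in
theorem countP_allCands (hF : Describes ω XA F Z) (hZ : M < Z) (hZ1 : 1 < Z)
    (hA : ∀ i, XA i ⊆ range M) (hQ : XQ ⊆ range M) (j : ℝ) :
    (allCands ω XA XQ F Z).countP (fun i => decide (jaccard (toFin M (XA i)) (toFin M XQ) ≤ j)) =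
      falseCount ω (fun i => toFin M (XA i)) (toFin M XQ) j := by
  have h1 : ∀ τ : Fin (m ^ 3), (tableCands ω XA XQ F Z τ).countP
      (fun i => decide (jaccard (toFin M (XA i)) (toFin M XQ) ≤ j)) =
      (univ.filter fun i : Fin N => jaccard (toFin M (XA i)) (toFin M XQ) ≤ j ∧
        Collide ω (toFin M (XA i)) (toFin M XQ) (finFunctionFinEquiv.symm τ)).card := by
    intro τ
    have hnd : (tableCands ω XA XQ F Z τ).Nodup := (List.nodup_finRange N).filter _
    rw [List.countP_eq_length_filter, ← List.toFinset_card_of_nodup (hnd.filter _)]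
    congr 1
    ext i
    simp only [List.mem_toFinset, List.mem_filter, mem_tableCands hF hZ hZ1 hA hQ, decide_eq_true_eq,
      mem_filter, mem_univ, true_and]
    exact and_comm
  rw [allCands, List.countP_flatMap]
  have h2 : ((List.range (m * m * m)).map ((List.countP fun i => decide
      (jaccard (toFin M (XA i)) (toFin M XQ) ≤ j)) ∘ tableCands ω XA XQ F Z)).sum =
      ∑ τ ∈ range (m ^ 3), (tableCands ω XA XQ F Z τ).countP
      (fun i => decide (jaccard (toFin M (XA i)) (toFin M XQ) ≤ j)) := by
    rw [show m ^ 3 = m * m * m by ring]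
    rfl
  rw [h2, sum_range, sum_congr rfl fun τ _ => h1 τ,
    Equiv.sum_comp finFunctionFinEquiv.symm (fun φ => (univ.filter fun i : Fin N =>
      jaccard (toFin M (XA i)) (toFin M XQ) ≤ j ∧
        Collide ω (toFin M (XA i)) (toFin M XQ) φ).card)]
  have h3 : falseCount ω (fun i => toFin M (XA i)) (toFin M XQ) j =
      ∑ φ : Fin 3 → Fin m, (univ.filter fun i : Fin N => jaccard (toFin M (XA i)) (toFin M XQ) ≤ j ∧
        Collide ω (toFin M (XA i)) (toFin M XQ) φ).card := by
    simp only [falseCount, card_filter]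
    rw [Fintype.sum_prod_type]
  rw [h3]

theorem card_le_countP {α : Type*} (p : α → Bool) (E : List α) (s : Finset ℕ)
    (hs : ∀ k ∈ s, ∃ x, E[k]? = some x ∧ p x) : s.card ≤ E.countP p := by
  induction E generalizing s with
  | nil =>
    have : s = ∅ := eq_empty_of_forall_notMem fun k hk => by
      obtain ⟨x, hx, -⟩ := hs k hk
      simp at hx
    simp [this]
  | cons a E ih =>
    have h1 := ih ((s.erase 0).image Nat.pred) fun k hk => by
      simp only [mem_image, mem_erase] at hk
      obtain ⟨k', ⟨h0, hk'⟩, rfl⟩ := hk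
      obtain ⟨x, hx, hp⟩ := hs k' hk'
      obtain ⟨k'', rfl⟩ := Nat.exists_eq_succ_of_ne_zero h0
      exact ⟨x, by simpa using hx, hp⟩
    rw [card_image_of_injOn] at h1
    · by_cases h0 : 0 ∈ s
      · obtain ⟨x, hx, hp⟩ := hs 0 h0
        simp only [List.getElem?_cons_zero, Option.some.injEq] at hx
        subst hx
        rw [List.countP_cons_of_pos hp]
        rw [card_erase_of_mem h0] at h1
        omega
      · rw [erase_eq_of_notMem h0] at h1
        exact h1.trans (List.countP_cons ▸ Nat.le_add_right _ _)
    · intro x hx y hy hxy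
      simp only [coe_erase, Set.mem_sdiff, Set.mem_singleton_iff] at hx hy
      simp only [Nat.pred_eq_sub_one] at hxy
      omega

theorem candsFrom_map (L : ℕ) (c : ℕ → List (Fin N)) :
    candsFrom (fun τ => (c τ).map Fin.val) L 0 = ((List.range L).flatMap c).map Fin.val := by
  rw [candsFrom, Nat.sub_zero, ← List.range_eq_range', List.map_flatMap]

theorem agreeCount_eq (hA : ∀ i, XA i ⊆ range M) (hQ : XQ ⊆ range M) {vs : ℕ → ℕ → ℕ} {i : Fin N}
    (hvs : ∀ e < T, vs i e = storedSketch ω XA i (3 * m * K + e)) :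
    agreeCount vs (askedSketch ω XQ) (3 * m * K) T i = verCount ω (toFin M (XA i)) (toFin M XQ) := by
  classical
  rw [agreeCount, verCount, card_filter, card_filter, sum_range]
  refine sum_congr rfl fun v _ => ?_
  rw [hvs _ v.2]
  have := sketch_eq_iff ω (hA i) hQ (.inr v)
  simp only [binNum] at this
  simp only [storedSketch, askedSketch, this]

/-- The outcome of a query whose event `Success` holds. -/
theorem exists_similar (hF : Describes ω XA F Z) (hZ : M < Z) (hZ1 : 1 < Z)
    (hA : ∀ i, XA i ⊆ range M) (hQ : XQ ⊆ range M) {j : ℝ} {Θ Φ ζ out n : ℕ} {i₀ : Fin N}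
    (hS : Success ω (fun i => toFin M (XA i)) (toFin M XQ) j Θ Φ i₀) {vs : ℕ → ℕ → ℕ}
    (hvs : ∀ i : Fin N, ∀ e < T, vs i e = storedSketch ω XA i (3 * m * K + e))
    (hζ : ∀ i : Fin N, (allCands ω XA XQ F Z)[ζ]? = some i →
      ¬ jaccard (toFin M (XA i)) (toFin M XQ) ≤ j) {E : List ℕ}
    (hE : E = (allCands ω XA XQ F Z).map Fin.val)
    (hout : (∃ x ∈ E, Θ ≤ agreeCount vs (askedSketch ω XQ) (3 * m * K) T x ∧ out = x % n) ∨
      (Φ ≤ E.length ∧ ∃ x, E[ζ]? = some x ∧ out = x % n) ∨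
      ∀ x ∈ E, agreeCount vs (askedSketch ω XQ) (3 * m * K) T x < Θ) :
    ∃ i : Fin N, out = i % n ∧ j < jaccard (toFin M (XA i)) (toFin M XQ) := by
  subst hE
  obtain ⟨h1, h2, h3, -⟩ := hS
  rcases hout with ⟨x, hx, hxΘ, rfl⟩ | ⟨-, x, hx, rfl⟩ | hout
  · obtain ⟨i, -, rfl⟩ := List.mem_map.1 hx
    rw [agreeCount_eq hA hQ (hvs i)] at hxΘ
    refine ⟨i, rfl, ?_⟩
    by_contra hle
    have := h3 i (not_lt.1 hle)
    dsimp only at this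
    omega
  · rw [List.getElem?_map, Option.map_eq_some_iff] at hx
    obtain ⟨i, hi, rfl⟩ := hx
    exact ⟨i, rfl, not_le.1 (hζ i hi)⟩
  -- The similar set is itself a candidate with enough agreements, so not all candidates can have
  -- been rejected.
  · have := hout i₀ (List.mem_map.2 ⟨i₀, (mem_allCands hF hZ hZ1 hA hQ i₀).2 h1, rfl⟩)
    rw [agreeCount_eq hA hQ (hvs i₀)] at this
    dsimp only at h2
    omega

-- Different bad positions use up different false collisions, of which there are at most `Φ / 2`.
-- Positions beyond the end of the list are not bad.
open Classical in
theorem card_bad_le (hF : Describes ω XA F Z) (hZ : M < Z) (hZ1 : 1 < Z)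
    (hA : ∀ i, XA i ⊆ range M) (hQ : XQ ⊆ range M) {j : ℝ} {Θ Φ : ℕ} {i₀ : Fin N}
    (hS : Success ω (fun i => toFin M (XA i)) (toFin M XQ) j Θ Φ i₀) :
    2 * ((univ : Finset (Fin Φ)).filter fun ζ : Fin Φ => ∃ i : Fin N,
      (allCands ω XA XQ F Z)[(ζ : ℕ)]? = some i ∧
      jaccard (toFin M (XA i)) (toFin M XQ) ≤ j).card ≤ Φ := by
  have h1 := countP_allCands hF hZ hZ1 hA hQ j
  have h2 := card_le_countP (fun i => decide (jaccard (toFin M (XA i)) (toFin M XQ) ≤ j))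
    (allCands ω XA XQ F Z) (((univ : Finset (Fin Φ)).filter fun ζ : Fin Φ => ∃ i : Fin N,
      (allCands ω XA XQ F Z)[(ζ : ℕ)]? = some i ∧
      jaccard (toFin M (XA i)) (toFin M XQ) ≤ j).image Fin.val) fun k hk => by
    simp only [mem_image, mem_filter, mem_univ, true_and] at hk
    obtain ⟨ζ, ⟨i, hi, hj⟩, rfl⟩ := hk
    exact ⟨i, hi, by simpa using hj⟩
  rw [card_image_of_injective _ Fin.val_injective] at h2
  have := hS.2.2.2
  omega

end

/-! ### The function stored in the dictionary -/

/-- The `i`-th digit of `x` in base `Z`. -/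
def digit (Z x i : ℕ) : ℕ := x / Z ^ i % Z

section

variable {Z k a b c d e : ℕ}

theorem digit_succ (x i : ℕ) : digit Z x (i + 1) = digit Z (x / Z) i := by
  rw [digit, digit, pow_succ', Nat.div_div_eq_div_mul]

theorem digit_step {x y : ℕ} (hy : y < Z) :
    digit Z (x * Z + y) 0 = y ∧ ∀ i, digit Z (x * Z + y) (i + 1) = digit Z x i := by
  constructor
  · rw [digit, pow_zero, Nat.div_one, mul_comm, Nat.mul_add_mod, Nat.mod_eq_of_lt hy]
  · intro i
    rw [digit_succ, mul_comm, Nat.mul_add_div (by omega), Nat.div_eq_of_lt hy, add_zero]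

theorem digit_enc (hk : k < Z) (ha : a < Z) (hb : b < Z) (hc : c < Z) (hd : d < Z) (he : e < Z) :
    digit Z (enc Z k a b c d e) 0 = e ∧ digit Z (enc Z k a b c d e) 1 = d ∧
    digit Z (enc Z k a b c d e) 2 = c ∧ digit Z (enc Z k a b c d e) 3 = b ∧
    digit Z (enc Z k a b c d e) 4 = a ∧ digit Z (enc Z k a b c d e) 5 = k := by
  have hk' : digit Z k 0 = k := by rw [digit, pow_zero, Nat.div_one, Nat.mod_eq_of_lt hk]
  unfold enc
  simp only [(digit_step he).1, (digit_step he).2, (digit_step hd).1, (digit_step hd).2,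
    (digit_step hc).1, (digit_step hc).2, (digit_step hb).1, (digit_step hb).2,
    (digit_step ha).1, (digit_step ha).2, hk', and_self]

end

section

variable {N : ℕ} (Z m K : ℕ) (V : Finset (ℕ × ℕ)) (id : ℕ → ℕ → ℕ) (b : Fin N → ℕ → ℕ)

/-- The meaning of the keys of the dictionary. -/
noncomputable def keyValue (x : ℕ) : ℕ :=
  if digit Z x 5 = 0 then id (digit Z x 4) (digit Z x 3)
  else if digit Z x 5 = 1 then nextClass (setClass b K (digit Z x 4) (digit Z x 3))
    (fun i => b i (digit Z x 4 * K + digit Z x 3)) (digit Z x 2) (digit Z x 1)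
  else ((bucket b m K (digit Z x 4) (digit Z x 3) (digit Z x 2) (digit Z x 1))[digit Z x 0]?.map
    fun i : Fin N => (i : ℕ) + 1).getD 0

/-- The bucket of the set `i` in the table `τ`. -/
noncomputable def ownBucket (τ : ℕ) (i : Fin N) : List (Fin N) :=
  bucket b m K τ (setClass b K (τ % m) K i) (setClass b K (m + τ / m % m) K i)
    (setClass b K (m + m + τ / (m * m) % m) K i)

/-- The keys for the elements with an own block of slots. -/
def elementKeys : Finset ℕ := V.image fun v => enc Z 0 v.1 v.2 0 0 0

/-- The keys for the classes. -/
noncomputable def classKeys : Finset ℕ :=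
  (range (3 * m) ×ˢ range K ×ˢ (univ : Finset (Fin N))).image fun v =>
    enc Z 1 v.1 v.2.1 (setClass b K v.1 v.2.1 v.2.2) (b v.2.2 (v.1 * K + v.2.1)) 0

/-- The keys for the buckets. -/
noncomputable def bucketKeys : Finset ℕ :=
  (range (m * m * m) ×ˢ (univ : Finset (Fin N))).image fun v =>
    enc Z 2 v.1 (setClass b K (v.1 % m) K v.2) (setClass b K (m + v.1 / m % m) K v.2)
      (setClass b K (m + m + v.1 / (m * m) % m) K v.2) ((ownBucket m K b v.1 v.2).idxOf v.2)

/-- The keys of the dictionary. -/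
noncomputable def keys : Finset ℕ := elementKeys Z V ∪ (classKeys Z m K b ∪ bucketKeys Z m K b)

theorem card_keys_le : (keys Z m K V b).card ≤ V.card + (3 * m * K * N + m * m * m * N) := by
  refine (card_union_le _ _).trans (add_le_add card_image_le ((card_union_le _ _).trans
    (add_le_add (card_image_le.trans (le_of_eq ?_)) (card_image_le.trans (le_of_eq ?_)))))
  · simp [mul_assoc]
  · simp

open Classical in
/-- The function stored in the dictionary. -/
noncomputable def dictFun (x : ℕ) : ℕ := if x ∈ keys Z m K V b then keyValue Z m K id b x else 0

variable {Z m K V id b}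

theorem length_bucket_le (τ z₁ z₂ z₃ : ℕ) : (bucket b m K τ z₁ z₂ z₃).length ≤ N :=
  (List.length_filter_le _ _).trans (by simp)

theorem keys_lt (hN : N < Z) (hZ : 2 < Z) (hm : 3 * m < Z) (hmm : m * m * m < Z) (hK : K < Z)
    (hV : ∀ v ∈ V, v.1 < Z ∧ v.2 < Z) (hb : ∀ i l, b i l < Z) : ∀ x ∈ keys Z m K V b, x < Z ^ 6 := by
  intro x hx
  simp only [keys, elementKeys, classKeys, bucketKeys, mem_union, mem_image, mem_product, mem_range,
    mem_univ, and_true] at hx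
  have hc : ∀ g l i, setClass b K g l i < Z := fun g l i => (setClass_le _ _ _ _ _).trans_lt hN
  rcases hx with ⟨v, hv, rfl⟩ | ⟨v, ⟨h1, h2⟩, rfl⟩ | ⟨v, h, rfl⟩
  · exact enc_lt (by omega) (hV v hv).1 (hV v hv).2 (by omega) (by omega) (by omega)
  · exact enc_lt (by omega) (by omega) (by omega) (hc _ _ _) (hb _ _) (by omega)
  · exact enc_lt (by omega) (by omega) (hc _ _ _) (hc _ _ _) (hc _ _ _)
      ((List.idxOf_le_length.trans (length_bucket_le _ _ _ _)).trans_lt hN)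

theorem keyValue_lt (hN : N < Z) (hid : ∀ a x, id a x < Z) (x : ℕ) : keyValue Z m K id b x < Z := by
  unfold keyValue
  split_ifs
  · exact hid _ _
  · exact (nextClass_le _ _ _ _).trans_lt hN
  · generalize (bucket b m K (digit Z x 4) (digit Z x 3) (digit Z x 2) (digit Z x 1))[digit Z x 0]? = o
    rcases o with _ | i
    · exact Nat.zero_lt_of_lt hN
    · exact (Nat.succ_le_of_lt i.2).trans_lt hN

theorem dictFun_lt (hN : N < Z) (hid : ∀ a x, id a x < Z) (x : ℕ) : dictFun Z m K V id b x < Z := by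
  unfold dictFun
  split_ifs
  · exact keyValue_lt hN hid x
  · exact Nat.zero_lt_of_lt hN

open Classical in
theorem dictFun_element (hN : N < Z) (hZ : 2 < Z) (hm : 3 * m < Z) (hmm : m * m * m < Z) (hK : K < Z)
    (hV : ∀ v ∈ V, v.1 < Z ∧ v.2 < Z) (hb : ∀ i l, b i l < Z) {a x : ℕ} (ha : a < Z) (hx : x < Z) :
    dictFun Z m K V id b (enc Z 0 a x 0 0 0) = if (a, x) ∈ V then id a x else 0 := by
  have hc : ∀ g l i, setClass b K g l i < Z := fun g l i => (setClass_le _ _ _ _ _).trans_lt hN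
  obtain ⟨-, -, -, d3, d4, d5⟩ := digit_enc (k := 0) (c := 0) (d := 0) (e := 0) (by omega) ha hx
    (by omega) (by omega) (by omega)
  have hiff : enc Z 0 a x 0 0 0 ∈ keys Z m K V b ↔ (a, x) ∈ V := by
    constructor
    · intro h
      simp only [keys, elementKeys, classKeys, bucketKeys, mem_union, mem_image, mem_product,
        mem_range, mem_univ, and_true] at h
      rcases h with ⟨v, hv, h⟩ | ⟨v, ⟨h1, h2⟩, h⟩ | ⟨v, h1, h⟩
      · obtain ⟨-, -, -, e3, e4, -⟩ := digit_enc (k := 0) (c := 0) (d := 0) (e := 0) (by omega)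
          (hV v hv).1 (hV v hv).2 (by omega) (by omega) (by omega)
        rw [h] at e3 e4
        rw [d3] at e3
        rw [d4] at e4
        rwa [e3, e4]
      · obtain ⟨-, -, -, -, -, e5⟩ := digit_enc (Z := Z) (k := 1) (e := 0) (by omega)
          (show v.1 < Z by omega) (show v.2.1 < Z by omega) (hc v.1 v.2.1 v.2.2)
          (hb v.2.2 (v.1 * K + v.2.1)) (by omega)
        rw [h, d5] at e5
        omega
      · obtain ⟨-, -, -, -, -, e5⟩ := digit_enc (Z := Z) (k := 2) (by omega)
          (show v.1 < Z by omega) (hc (v.1 % m) K v.2) (hc (m + v.1 / m % m) K v.2)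
          (hc (m + m + v.1 / (m * m) % m) K v.2)
          ((List.idxOf_le_length (a := v.2) (l := ownBucket m K b v.1 v.2).trans
            (length_bucket_le _ _ _ _)).trans_lt hN)
        rw [h, d5] at e5
        omega
    · intro h
      exact mem_union_left _ (mem_image_of_mem (fun v : ℕ × ℕ => enc Z 0 v.1 v.2 0 0 0) h)
  unfold dictFun
  rw [if_congr hiff rfl rfl, keyValue, d5, d4, d3, if_pos rfl]

/-- Only keys that arise from stored sets are in the dictionary. For all other keys the value is
`0`, which is also the answer for a missing key, so the equation holds for every `z` and `w`. -/
theorem dictFun_class (hZ : 2 < Z) (hm : 3 * m < Z) (hK : K < Z) {g l z w : ℕ}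
    (hg : g < 3 * m) (hl : l < K) (hz : z < Z) (hw : w < Z) :
    dictFun Z m K V id b (enc Z 1 g l z w 0) =
      nextClass (setClass b K g l) (fun i => b i (g * K + l)) z w := by
  obtain ⟨-, d1, d2, d3, d4, d5⟩ := digit_enc (Z := Z) (k := 1) (a := g) (b := l) (c := z) (d := w)
    (e := 0) (by omega) (by omega) (by omega) hz hw (by omega)
  have hv : keyValue Z m K id b (enc Z 1 g l z w 0) =
      nextClass (setClass b K g l) (fun i => b i (g * K + l)) z w := by
    rw [keyValue, d5, d4, d3, d2, d1, if_neg one_ne_zero, if_pos rfl]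
  unfold dictFun
  split_ifs with h
  · exact hv
  · by_contra hne
    obtain ⟨i, rfl, rfl⟩ := exists_of_nextClass_ne_zero (Ne.symm hne)
    refine h (mem_union_right _ (mem_union_left _ (mem_image.2 ⟨(g, l, i), ?_, rfl⟩)))
    simp [hg, hl]

theorem dictFun_bucket (hN : N < Z) (hZ : 2 < Z) (hmm : m * m * m < Z) {τ z₁ z₂ z₃ j : ℕ}
    (hτ : τ < m * m * m) (h₁ : z₁ < Z) (h₂ : z₂ < Z) (h₃ : z₃ < Z) (hj : j ≤ N) :
    dictFun Z m K V id b (enc Z 2 τ z₁ z₂ z₃ j) =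
      ((bucket b m K τ z₁ z₂ z₃)[j]?.map fun i : Fin N => (i : ℕ) + 1).getD 0 := by
  obtain ⟨d0, d1, d2, d3, d4, d5⟩ := digit_enc (Z := Z) (k := 2) (a := τ) (b := z₁) (c := z₂)
    (d := z₃) (e := j) (by omega) (by omega) h₁ h₂ h₃ (by omega)
  have hv : keyValue Z m K id b (enc Z 2 τ z₁ z₂ z₃ j) =
      ((bucket b m K τ z₁ z₂ z₃)[j]?.map fun i : Fin N => (i : ℕ) + 1).getD 0 := by
    rw [keyValue, d5, d4, d3, d2, d1, d0, if_neg two_ne_zero, if_neg (by norm_num)]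
  unfold dictFun
  split_ifs with h
  · exact hv
  · rcases hg : (bucket b m K τ z₁ z₂ z₃)[j]? with _ | i
    · rfl
    · exfalso
      have hi := List.mem_of_getElem? hg
      simp only [bucket, List.mem_filter, List.mem_finRange, true_and, decide_eq_true_eq] at hi
      obtain ⟨rfl, rfl, rfl⟩ := hi
      refine h (mem_union_right _ (mem_union_right _ (mem_image.2 ⟨(τ, i), by simp [hτ], ?_⟩)))
      -- Without repetitions the position `j` is the first index of `i`, which is the one used in
      -- the stored keys.
      have hnd : (ownBucket m K b τ i).Nodup := (List.nodup_finRange N).filter _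
      have e : (ownBucket m K b τ i).idxOf i = j := by
        have key : ∀ l : List (Fin N), l.Nodup → l[j]? = some i → l.idxOf i = j := by
          intro l hl h
          obtain ⟨hlt, rfl⟩ := List.getElem?_eq_some_iff.1 h
          exact hl.idxOf_getElem j hlt
        exact key _ hnd hg
      rw [e]

end

theorem describes_dictFun {M m K T N Z : ℕ} (ω : Rnd M (Bin m K T)) (XA : Fin N → Finset ℕ)
    {V : Finset (ℕ × ℕ)} {id : ℕ → ℕ → ℕ} (hN : N < Z) (hZ : 2 < Z) (hm : 3 * m < Z)
    (hmm : m * m * m < Z) (hK : K < Z) (hid : ∀ a x, id a x < Z) :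
    Describes ω XA (dictFun Z m K V id (storedSketch ω XA)) Z where
  lt := dictFun_lt hN hid
  cls _ hg _ hl _ hz _ hw := dictFun_class hZ hm hK hg hl hz hw
  bucket _ hτ _ h₁ _ h₂ _ h₃ _ hj := dictFun_bucket hN hZ hmm hτ h₁ h₂ h₃ hj

/-! ### Blocks of slots -/

/-- The position of `x` in the increasing enumeration of `V`. -/
def position (V : Finset ℕ) (x : ℕ) : ℕ := (V.filter (· < x)).card

theorem position_le (V : Finset ℕ) (x : ℕ) : position V x ≤ V.card := card_filter_le _ _

theorem position_lt {V : Finset ℕ} {x : ℕ} (hx : x ∈ V) : position V x < V.card :=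
  card_lt_card (filter_ssubset.2 ⟨x, hx, lt_irrefl x⟩)

theorem position_lt_position {V : Finset ℕ} {x y : ℕ} (hx : x ∈ V) (hxy : x < y) :
    position V x < position V y := by
  refine card_lt_card ⟨fun z hz => ?_, fun h => ?_⟩
  · rw [mem_filter] at *
    exact ⟨hz.1, hz.2.trans hxy⟩
  · have := h (mem_filter.2 ⟨hx, hxy⟩)
    exact lt_irrefl x (mem_filter.1 this).2

theorem position_injOn (V : Finset ℕ) : Set.InjOn (position V) V := by
  intro x hx y hy h
  rcases lt_trichotomy x y with h' | h' | h'
  · exact absurd h (position_lt_position hx h').ne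
  · exact h'
  · exact absurd h (position_lt_position hy h').ne'

/-- The number of the block of `x`: elements of `V` have their own blocks, elements of the query `q`
outside of `V` get further blocks. -/
def blockIdx (V : Finset ℕ) (q : List ℕ) (x : ℕ) : ℕ :=
  if x ∈ V then position V x else V.card + q.idxOf x

theorem blockIdx_injOn (V : Finset ℕ) (q : List ℕ) :
    Set.InjOn (blockIdx V q) {x | x ∈ V ∨ x ∈ q} := by
  intro x hx y hy h
  unfold blockIdx at h
  split_ifs at h with h1 h2 h2
  · exact position_injOn V h1 h2 h
  · have := position_lt h1; omega
  · have := position_lt h2; omega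
  · exact (List.idxOf_inj (hx.resolve_left h1)).1 (by omega)

theorem blockIdx_lt {V : Finset ℕ} {q : List ℕ} {x : ℕ} (hx : x ∈ V ∨ x ∈ q) :
    blockIdx V q x < V.card + q.length := by
  unfold blockIdx
  split_ifs with h
  · have := position_lt h; omega
  · have := List.idxOf_lt_length_iff.2 (hx.resolve_left h); omega

theorem image_blockIdx {V A : Finset ℕ} (h : A ⊆ V) (q : List ℕ) :
    A.image (blockIdx V q) = A.image (position V) :=
  image_congr fun x hx => by rw [blockIdx, if_pos (h hx)]

/-- The union of the blocks `off + R * y, …, off + R * y + R - 1` for `y` in `Y`. -/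
def expand (off R : ℕ) (Y : Finset ℕ) : Finset ℕ :=
  Y.biUnion fun y => Ico (off + R * y) (off + R * y + R)

section

variable {off R : ℕ}

theorem mem_expand (hR : 0 < R) {Y : Finset ℕ} {x : ℕ} :
    x ∈ expand off R Y ↔ off ≤ x ∧ (x - off) / R ∈ Y := by
  simp only [expand, mem_biUnion, mem_Ico]
  constructor
  · rintro ⟨y, hy, h1, h2⟩
    refine ⟨by omega, ?_⟩
    have h3 : (x - off) / R = y := by
      refine Nat.div_eq_of_lt_le ?_ ?_
      · rw [mul_comm]; omega
      · rw [mul_comm, Nat.mul_succ]; omega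
    rwa [h3]
  · rintro ⟨h1, h2⟩
    refine ⟨_, h2, ?_⟩
    have h3 := Nat.div_add_mod (x - off) R
    have h4 := Nat.mod_lt (x - off) hR
    omega

theorem expand_inter (hR : 0 < R) (X Y : Finset ℕ) :
    expand off R X ∩ expand off R Y = expand off R (X ∩ Y) := by
  ext x
  simp only [mem_inter, mem_expand hR]
  tauto

theorem expand_union (hR : 0 < R) (X Y : Finset ℕ) :
    expand off R X ∪ expand off R Y = expand off R (X ∪ Y) := by
  ext x
  simp only [mem_union, mem_expand hR]
  tauto

theorem card_expand (Y : Finset ℕ) : (expand off R Y).card = R * Y.card := by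
  unfold expand
  rw [card_biUnion]
  · simp [mul_comm]
  · intro x _ y _ hxy
    rw [Function.onFun, disjoint_left]
    intro z hz hz'
    rw [mem_Ico] at hz hz'
    rcases lt_or_gt_of_ne hxy with h | h
    · have : R * (x + 1) ≤ R * y := Nat.mul_le_mul_left _ h
      rw [mul_add] at this
      omega
    · have : R * (y + 1) ≤ R * x := Nat.mul_le_mul_left _ h
      rw [mul_add] at this
      omega

theorem expand_subset {Y : Finset ℕ} {c : ℕ} (h : ∀ y ∈ Y, y < c) :
    expand off R Y ⊆ Ico off (off + R * c) := by
  intro x hx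
  simp only [expand, mem_biUnion, mem_Ico] at *
  obtain ⟨y, hy, h1, h2⟩ := hx
  have : R * (y + 1) ≤ R * c := Nat.mul_le_mul_left _ (h y hy)
  rw [mul_add] at this
  omega

/-- Blowing up elements to disjoint blocks scales the sizes of intersections and unions. -/
theorem card_toFin_expand {M : ℕ} {g : ℕ → ℕ} {X Y : Finset ℕ} (hR : 0 < R)
    (hg : Set.InjOn g (X ∪ Y : Finset ℕ)) (hX : expand off R (X.image g) ⊆ range M)
    (hY : expand off R (Y.image g) ⊆ range M) :
    (toFin M (expand off R (X.image g)) ∩ toFin M (expand off R (Y.image g))).card =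
      R * (X ∩ Y).card ∧
    (toFin M (expand off R (X.image g)) ∪ toFin M (expand off R (Y.image g))).card =
      R * (X ∪ Y).card := by
  rw [toFin_inter, toFin_union, card_toFin (inter_subset_left.trans hX),
    card_toFin (union_subset hX hY), expand_inter hR, expand_union hR, card_expand, card_expand,
    ← image_union, ← image_inter_of_injOn _ _ (by rwa [← coe_union]), card_image_of_injOn hg,
    card_image_of_injOn (hg.mono (coe_subset.2 (inter_subset_left.trans subset_union_left)))]
  exact ⟨rfl, rfl⟩

theorem jaccard_eq_zero {α : Type*} [DecidableEq α] {X Y : Finset α} (h : Disjoint X Y) :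
    jaccard X Y = 0 := by
  rw [jaccard, disjoint_iff_inter_eq_empty.1 h]; simp

theorem jaccard_image {α β : Type*} [DecidableEq α] [DecidableEq β] {f : α → β}
    (hf : Function.Injective f) (X Y : Finset α) : jaccard (X.image f) (Y.image f) = jaccard X Y := by
  rw [jaccard, jaccard, ← image_inter _ _ hf, ← image_union, card_image_of_injective _ hf,
    card_image_of_injective _ hf]

/-- The program numbers fresh blocks by the position in the query. In a list without repetitions
this is `idxOf`, so the slots depend on the element alone, as `blockIdx` requires. -/
theorem slotsOf_eq {F : ℕ → ℕ} {Z a : ℕ} {V : Finset ℕ} {q : List ℕ} (hq : q.Nodup)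
    (hF : ∀ x ∈ q, F (enc Z 0 a x 0 0 0) = if x ∈ V then off + R * position V x + 1 else 0) :
    (∀ i (h : i < q.length), blockBase F Z a (off + R * V.card) R q i = off + R * blockIdx V q q[i]) ∧
    slotsOf F Z a (off + R * V.card) R q q.length = expand off R (q.toFinset.image (blockIdx V q)) := by
  have h1 : ∀ i (h : i < q.length),
      blockBase F Z a (off + R * V.card) R q i = off + R * blockIdx V q q[i] := by
    intro i hi
    have e : q.getD i 0 = q[i] := by simp [hi]
    rw [blockBase, e, hF _ (List.getElem_mem hi), blockIdx]
    by_cases hV : q[i] ∈ V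
    · simp [hV]
    · simp only [hV, if_false, hq.idxOf_getElem i hi]
      rw [if_pos trivial]
      ring
  refine ⟨h1, ?_⟩
  ext x
  simp only [slotsOf, expand, mem_biUnion, mem_range, mem_image, List.mem_toFinset]
  constructor
  · rintro ⟨i, hi, hx⟩
    rw [h1 i hi] at hx
    exact ⟨_, ⟨_, List.getElem_mem hi, rfl⟩, hx⟩
  · rintro ⟨_, ⟨y, hy, rfl⟩, hx⟩
    obtain ⟨i, hi, rfl⟩ := List.getElem_of_mem hy
    exact ⟨i, hi, by rwa [h1 i hi]⟩

end

/-! ### The layout of the memory -/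

/-- The constants of a query when the sections of the memory are put one after the other: header,
two-level hash table for `k` keys, slots, verification sketches, sketch and classes of the query. -/
def layout (M m K T N Z k n thr pool0 qmax0 pool1 Θ Φ ζ P a s : ℕ) : Params where
  P := P
  a := a
  s := s
  D1 := 24
  D2 := 24 + 3 * (k + 1)
  Z := Z
  -- Three words for each first-level bucket and two for each of at most `7 * (k + 1)` cells.
  hs := 24 + 17 * (k + 1)
  wb := 24 + 17 * (k + 1) + 2 * M + N * T
  cb := 24 + 17 * (k + 1) + 2 * M + N * T + (3 * m * K + T)
  m := m
  K := K
  L := m * m * m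
  Φ := Φ
  ζ := ζ
  T := T
  Θ := Θ
  ver := 24 + 17 * (k + 1) + 2 * M
  n := n
  thr := thr
  pool0 := pool0
  qmax0 := qmax0
  pool1 := pool1
  G := 3 * m
  vb := 3 * m * K

/-- The contents of the memory. -/
def contents (p : Params) (top cell bin rk : ℕ → ℕ) (vs : ℕ → ℕ → ℕ) (M : ℕ) (a : ℕ) : ℕ :=
  if a < 24 then p.hdr.getD a 0
  else if a < p.D2 then top (a - 24)
  else if a < p.hs then cell (a - p.D2)
  else if a < p.ver then
    if (a - p.hs) % 2 = 0 then bin ((a - p.hs) / 2) else rk ((a - p.hs) / 2)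
  else if a < p.wb then vs ((a - p.ver) / p.T) ((a - p.ver) % p.T)
  else M

/-- The verification sketches. -/
def verSketch {M m K T N : ℕ} (ω : Rnd M (Bin m K T)) (XA : Fin N → Finset ℕ) (i e : ℕ) : ℕ :=
  if h : i < N then storedSketch ω XA ⟨i, h⟩ (3 * m * K + e) else 0

theorem binOf_lt {M m K T : ℕ} (ω : Rnd M (Bin m K T)) {x : ℕ} (hx : x < M) :
    binOf ω x < 3 * m * K + T := by
  rw [binOf, dif_pos hx]; exact binNum_lt _

theorem verSketch_le {M m K T N : ℕ} (ω : Rnd M (Bin m K T)) (XA : Fin N → Finset ℕ) (i e : ℕ) :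
    verSketch ω XA i e ≤ M + 1 := by
  unfold verSketch
  split_ifs
  · exact sketch_le _ _ _ _ _
  · omega

/-- The sections of `contents` are disjoint by construction, so each requirement of `Img` is read
off from one of them; the rest is checking that all numbers fit into a word. -/
theorem exists_img {M m K T N Z k n thr pool0 qmax0 pool1 Θ Φ ζ S W : ℕ} (ω : Rnd M (Bin m K T))
    (XA : Fin N → Finset ℕ) {V : Finset (ℕ × ℕ)} {id : ℕ → ℕ → ℕ}
    (hS : S = 24 + 17 * (k + 1) + 2 * M + N * T + (3 * m * K + T) + 3 * m) (hSZ : S < Z)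
    (hW : 4 * Z ^ 12 < W) (hk : V.card + (3 * m * K * N + m * m * m * N) ≤ k) (hN : N < Z)
    (hmm : m * m * m < Z) (hK : K < Z) (hid : ∀ a x, id a x < Z) (hV : ∀ v ∈ V, v.1 < Z ∧ v.2 < Z)
    (hn : n < Z) (hthr : thr < Z) (hpool0 : pool0 < Z) (hqmax0 : qmax0 < Z) (hpool1 : pool1 < Z)
    (hΘ : Θ < Z) (hΦ : Φ < Z) (hζ : ζ < Φ) :
    ∃ P a s μ, Img (layout M m K T N Z k n thr pool0 qmax0 pool1 Θ Φ ζ P a s) W S M (3 * m * K + T) N μ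
      (dictFun Z m K V id (storedSketch ω XA)) (binOf ω) (rankOf ω) (verSketch ω XA) ∧
      ∀ a, μ a < W := by
  classical
  have hst : ∀ i l, storedSketch ω XA i l < Z := fun i l =>
    (sketch_le _ _ _ _ _).trans_lt (by omega)
  have hmZ : 3 * m < Z := by omega
  -- Bertrand's postulate: `P` exceeds every key, and `P * P ≤ 4 * Z ^ 12 < W` leaves room for the
  -- products in the hash functions.
  obtain ⟨P, hP, hZP, hPZ⟩ := Nat.exists_prime_lt_and_le_two_mul (Z ^ 6)
    (pow_ne_zero _ (by omega))
  have : Fact P.Prime := ⟨hP⟩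
  have hX := card_keys_le Z m K V (storedSketch ω XA)
  have hXlt := keys_lt hN (by omega) hmZ hmm hK hV hst
  set X := keys Z m K V (storedSketch ω XA) with hXdef
  obtain ⟨a, c, top, cell, ha, hc, htop, hcell, hdict⟩ := exists_dict P X
    (fun x hx => (hXlt x hx).trans hZP) (keyValue Z m K id (storedSketch ω XA))
  set p := layout M m K T N Z k n thr pool0 qmax0 pool1 Θ Φ ζ P a (X.card + 1) with hp
  set μ := contents p top cell (binOf ω) (rankOf ω) (verSketch ω XA) M with hμ
  have hPP : P * P < W := by
    calc P * P ≤ (2 * Z ^ 6) * (2 * Z ^ 6) := Nat.mul_le_mul hPZ hPZ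
      _ = 4 * Z ^ 12 := by ring
      _ < W := hW
  have hZle : Z ≤ Z ^ 6 := Nat.le_self_pow (by norm_num) _
  have h2P : 2 * P ≤ P * P := Nat.mul_le_mul_right _ hP.two_le
  have e1 : p.D2 = 24 + 3 * (k + 1) := rfl
  have e2 : p.hs = 24 + 17 * (k + 1) := rfl
  have e3 : p.ver = 24 + 17 * (k + 1) + 2 * M := rfl
  have e4 : p.wb = 24 + 17 * (k + 1) + 2 * M + N * T := rfl
  have e5 : p.T = T := rfl
  have e6 : p.cb = 24 + 17 * (k + 1) + 2 * M + N * T + (3 * m * K + T) := rfl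
  refine ⟨P, a, X.card + 1, μ, ⟨?_, ?_, ?_, ?_, ?_, hSZ, hZP.le, hPP, ?_, ?_, ?_, rfl, rfl, rfl, rfl, hmm,
    ?_, dictFun_lt hN hid, hΦ, hζ, hK⟩, ?_⟩
  · refine hdict μ p.wb 24 p.D2 ?_ ?_ ?_ ?_
    · intro i hi
      rw [hμ, contents, if_neg (by omega), if_pos (by omega)]
      congr 1
      omega
    · intro i hi
      rw [hμ, contents, if_neg (by omega), if_neg (by omega), if_pos (by omega)]
      congr 1
      omega
    · omega
    · omega
  · intro i hi
    rw [hμ, contents, if_pos hi]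
  · change 24 ≤ p.wb
    omega
  · exact le_rfl
  · change p.cb + 3 * m ≤ S
    omega
  · intro x hx
    refine ⟨?_, ?_, ?_, binOf_lt ω hx⟩
    · change μ (p.hs + 2 * x) = _
      rw [hμ, contents, if_neg (by omega), if_neg (by omega), if_neg (by omega), if_pos (by omega),
        if_pos (by omega)]
      congr 1
      omega
    · change μ (p.hs + 2 * x + 1) = _
      rw [hμ, contents, if_neg (by omega), if_neg (by omega), if_neg (by omega), if_pos (by omega),
        if_neg (by omega)]
      congr 1
      omega
    · change p.hs + 2 * x + 1 < p.wb
      omega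
  · change M < Z
    omega
  · intro l hl
    change μ (p.wb + l) = M
    rw [hμ, contents, if_neg (by omega), if_neg (by omega), if_neg (by omega), if_neg (by omega),
      if_neg (by omega)]
  · intro i hi e he
    replace he : e < T := he
    have h1 : (i + 1) * T ≤ N * T := Nat.mul_le_mul_right _ hi
    rw [Nat.succ_mul] at h1
    refine ⟨?_, ?_⟩
    · change μ (p.ver + (i * T + e)) = _
      rw [hμ, contents, if_neg (by omega), if_neg (by omega), if_neg (by omega), if_neg (by omega),
        if_pos (by omega), e5, Nat.add_sub_cancel_left, mul_comm i, Nat.mul_add_div (by omega),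
        Nat.div_eq_of_lt he, Nat.mul_add_mod, Nat.mod_eq_of_lt he, add_zero]
    · change p.ver + (i * T + e) < p.wb
      omega
  · intro x
    have hb : ∀ y, binOf ω y < W := fun y => by
      by_cases h : y < M
      · have := binOf_lt ω h; omega
      · rw [binOf, dif_neg h]; omega
    have hr : ∀ y, rankOf ω y < W := fun y => by
      unfold rankOf
      split_ifs with h
      · exact (ω.2 ⟨y, h⟩).2.trans (by omega)
      · omega
    have hh : ∀ v ∈ p.hdr, v < W := by
      intro v hv
      simp only [Params.hdr, List.mem_cons, List.not_mem_nil, or_false, hp, layout] at hv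
      have : m ≤ 3 * m := by omega
      have : T ≤ 3 * m * K + T := by omega
      rcases hv with h|h|h|h|h|h|h|h|h|h|h|h|h|h|h|h|h|h|h|h|h|h|h|h <;> omega
    rw [hμ, contents]
    split_ifs with h1
    · rw [List.getD_eq_getElem _ _ (by exact h1)]
      exact hh _ (List.getElem_mem _)
    · have := htop (x - 24); omega
    · rcases hcell (x - p.D2) with h | ⟨y, -, h⟩
      · omega
      · have := keyValue_lt (Z := Z) (m := m) (K := K) (b := storedSketch ω XA) hN hid y
        omega
    · exact hb _
    · exact hr _
    · have := verSketch_le ω XA ((x - p.ver) / p.T) ((x - p.ver) % p.T)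
      omega
    · omega

/-! ### Two modes for small and large queries -/

section

variable {n : ℕ} (A : Fin n → Finset ℕ) (s q₀ r : ℕ)

/-- In mode `0` the sets themselves are stored, in the other modes only the sets of size at
most `s`. -/
def modeSet (a : ℕ) (i : Fin n) : Finset ℕ := if a = 0 ∨ (A i).card ≤ s then A i else ∅

/-- The elements of the sets stored in mode `a`. -/
def modeElems (a : ℕ) : Finset ℕ := univ.biUnion (modeSet A s a)

/-- The size of the blocks in mode `a`. -/
def modeSize (a : ℕ) : ℕ := if a = 0 then 1 else r

/-- The largest size of a query in mode `a`. -/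
def modeMax (a : ℕ) : ℕ := if a = 0 then q₀ else r

/-- The number of slots used by mode `0`. -/
def split : ℕ := (modeElems A s 0).card + q₀

/-- The first slot of mode `a`. -/
def modeOff (a : ℕ) : ℕ := if a = 0 then 0 else split A s q₀

/-- The number of slots. -/
def slotCount : ℕ := split A s q₀ + r * ((modeElems A s 1).card + r)

/-- One plus the first slot of the block of an element in mode `a`. -/
def blockId (a x : ℕ) : ℕ :=
  modeOff A s q₀ a + modeSize r a * position (modeElems A s a) x + 1

/-- The elements with an own block of slots. -/
def ownBlocks : Finset (ℕ × ℕ) := (range 2).biUnion fun a => (modeElems A s a).image (Prod.mk a)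

/-- The slots of the stored sets: first all sets in mode `0`, then all sets in mode `1`. -/
def storedSlots (x : Fin (n + n)) : Finset ℕ :=
  expand (modeOff A s q₀ (x / n)) (modeSize r (x / n))
    ((modeSet A s (x / n) ⟨x % n, Nat.mod_lt _ (by have := x.2; omega)⟩).image
      (position (modeElems A s (x / n))))

/-- The slots of a query. -/
def askedSlots (a : ℕ) (q : List ℕ) : Finset ℕ :=
  expand (modeOff A s q₀ a) (modeSize r a) (q.toFinset.image (blockIdx (modeElems A s a) q))

variable {A s q₀ r}

theorem modeSet_subset (a : ℕ) (i : Fin n) : modeSet A s a i ⊆ modeElems A s a :=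
  subset_biUnion_of_mem (modeSet A s a) (mem_univ i)

theorem mem_ownBlocks {a x : ℕ} : (a, x) ∈ ownBlocks A s ↔ a < 2 ∧ x ∈ modeElems A s a := by
  simp only [ownBlocks, mem_biUnion, mem_range, mem_image, Prod.mk.injEq]
  constructor
  · rintro ⟨b, hb, y, hy, rfl, rfl⟩; exact ⟨hb, hy⟩
  · rintro ⟨h1, h2⟩; exact ⟨a, h1, x, h2, rfl, rfl⟩

theorem card_ownBlocks_le :
    (ownBlocks A s).card ≤ (modeElems A s 0).card + (modeElems A s 1).card := by
  refine card_biUnion_le.trans ?_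
  rw [sum_range_succ, sum_range_one]
  exact add_le_add card_image_le card_image_le

theorem modeElems_succ (a : ℕ) : modeElems A s (a + 1) = modeElems A s 1 := by
  have : modeSet A s (a + 1) = modeSet A s 1 := by funext i; simp [modeSet]
  rw [modeElems, modeElems, this]

theorem blockId_le (a x : ℕ) : blockId A s q₀ r a x ≤ slotCount A s q₀ r + 1 := by
  have h := position_le (modeElems A s a) x
  rcases a with _ | a
  · simp only [blockId, modeOff, modeSize, if_true, slotCount, split]
    omega
  · rw [modeElems_succ] at h
    have h2 : r * position (modeElems A s 1) x ≤ r * ((modeElems A s 1).card + r) :=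
      Nat.mul_le_mul_left _ (by omega)
    simp only [blockId, modeOff, modeSize, modeElems_succ, slotCount]
    simp only [Nat.add_eq_zero_iff, one_ne_zero, and_false, if_false]
    omega

theorem expand_mode_subset {a c : ℕ} {Y : Finset ℕ} (hY : ∀ y ∈ Y, y < (modeElems A s a).card + c)
    (hc : c ≤ modeMax q₀ r a) :
    expand (modeOff A s q₀ a) (modeSize r a) Y ⊆ range (slotCount A s q₀ r) ∧
      if a = 0 then expand (modeOff A s q₀ a) (modeSize r a) Y ⊆ range (split A s q₀)
      else Disjoint (expand (modeOff A s q₀ a) (modeSize r a) Y) (range (split A s q₀)) := by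
  have h := expand_subset (off := modeOff A s q₀ a) (R := modeSize r a) hY
  rcases a with _ | a
  · simp only [if_true]
    have h1 : expand (modeOff A s q₀ 0) (modeSize r 0) Y ⊆ range (split A s q₀) := by
      refine h.trans fun x hx => ?_
      simp only [modeMax, if_true] at hc
      simp only [modeOff, modeSize, if_true, mem_Ico] at hx
      rw [mem_range, split]
      omega
    exact ⟨h1.trans (range_mono (Nat.le_add_right _ _)), h1⟩
  · simp only [Nat.add_eq_zero_iff, one_ne_zero, and_false, if_false]
    simp only [modeOff, modeSize, modeMax, Nat.add_eq_zero_iff, one_ne_zero, and_false, if_false,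
      modeElems_succ] at *
    have h2 : r * ((modeElems A s 1).card + c) ≤ r * ((modeElems A s 1).card + r) :=
      Nat.mul_le_mul_left _ (by omega)
    refine ⟨h.trans fun x hx => ?_, disjoint_left.2 fun x hx hx' => ?_⟩
    · rw [mem_Ico] at hx
      rw [mem_range, slotCount]
      omega
    · have := mem_Ico.1 (h hx)
      rw [mem_range] at hx'
      omega

theorem position_image_lt {a : ℕ} {i : Fin n} :
    ∀ y ∈ (modeSet A s a i).image (position (modeElems A s a)), y < (modeElems A s a).card + 0 := by
  intro y hy
  obtain ⟨x, hx, rfl⟩ := mem_image.1 hy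
  exact position_lt (modeSet_subset a i hx)

theorem blockIdx_image_lt {a : ℕ} {q : List ℕ} :
    ∀ y ∈ q.toFinset.image (blockIdx (modeElems A s a) q), y < (modeElems A s a).card + q.length := by
  intro y hy
  obtain ⟨x, hx, rfl⟩ := mem_image.1 hy
  exact blockIdx_lt (.inr (List.mem_toFinset.1 hx))

theorem storedSlots_subset (x : Fin (n + n)) :
    storedSlots A s q₀ r x ⊆ range (slotCount A s q₀ r) :=
  (expand_mode_subset position_image_lt (Nat.zero_le _)).1

theorem askedSlots_subset {a : ℕ} {q : List ℕ} (hq : q.length ≤ modeMax q₀ r a) :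
    askedSlots A s q₀ r a q ⊆ range (slotCount A s q₀ r) :=
  (expand_mode_subset blockIdx_image_lt hq).1

/-- Mode `0` uses the slots below `split` and mode `1` those above, so the copies of sets for the
other mode have similarity `0` and can share the tables. -/
theorem disjoint_slots {a : ℕ} {q : List ℕ} (hq : q.length ≤ modeMax q₀ r a) (ha : a < 2)
    (x : Fin (n + n)) (hx : (x : ℕ) / n ≠ a) :
    Disjoint (toFin (slotCount A s q₀ r) (storedSlots A s q₀ r x))
      (toFin (slotCount A s q₀ r) (askedSlots A s q₀ r a q)) := by
  rw [disjoint_iff_inter_eq_empty, toFin_inter]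
  have h1 := (expand_mode_subset (A := A) (s := s) (q₀ := q₀) (r := r)
    (position_image_lt (A := A) (s := s) (a := x / n)
      (i := ⟨x % n, Nat.mod_lt _ (by have := x.2; omega)⟩)) (Nat.zero_le _)).2
  have h2 := (expand_mode_subset (A := A) (s := s) (blockIdx_image_lt (a := a) (q := q)) hq).2
  have hx2 : (x : ℕ) / n < 2 := Nat.div_lt_of_lt_mul (by have := x.2; omega)
  have hd : Disjoint (storedSlots A s q₀ r x) (askedSlots A s q₀ r a q) := by
    unfold storedSlots askedSlots
    by_cases h : (x : ℕ) / n = 0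
    · rw [if_pos h] at h1
      rw [if_neg (by omega)] at h2
      exact (disjoint_of_subset_right h1 h2).symm
    · rw [if_neg h] at h1
      have h0 : ∀ y : ℕ, y < 2 → y ≠ 0 → y ≠ a → a = 0 := by omega
      rw [if_pos (h0 _ hx2 h hx)] at h2
      exact disjoint_of_subset_right h2 h1
  rw [disjoint_iff_inter_eq_empty.1 hd]
  ext
  simp [mem_toFin]

theorem card_slots {a : ℕ} {q : List ℕ} (hq : q.length ≤ modeMax q₀ r a) (hr : 0 < r)
    (x : Fin (n + n)) (i : Fin n) (hi : (i : ℕ) = x % n) (hx : (x : ℕ) / n = a) :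
    (toFin (slotCount A s q₀ r) (storedSlots A s q₀ r x) ∩
      toFin (slotCount A s q₀ r) (askedSlots A s q₀ r a q)).card =
        modeSize r a * (modeSet A s a i ∩ q.toFinset).card ∧
    (toFin (slotCount A s q₀ r) (storedSlots A s q₀ r x) ∪
      toFin (slotCount A s q₀ r) (askedSlots A s q₀ r a q)).card =
        modeSize r a * (modeSet A s a i ∪ q.toFinset).card := by
  subst hx
  have hi' : i = ⟨x % n, Nat.mod_lt _ (by have := x.2; omega)⟩ := Fin.ext hi
  have hR : 0 < modeSize r ((x : ℕ) / n) := by unfold modeSize; split_ifs <;> omega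
  have hs := storedSlots_subset (A := A) (s := s) (q₀ := q₀) (r := r) x
  have ha := askedSlots_subset (A := A) (s := s) hq
  unfold storedSlots askedSlots at *
  rw [← hi', ← image_blockIdx (modeSet_subset _ i) q] at *
  refine card_toFin_expand hR ((blockIdx_injOn _ q).mono fun y hy => ?_) hs ha
  rw [mem_coe, mem_union, List.mem_toFinset] at hy
  exact hy.imp (fun h => modeSet_subset _ i h) fun h => h

theorem jaccard_slots {a : ℕ} {q : List ℕ} (hq : q.length ≤ modeMax q₀ r a) (hr : 0 < r)
    (x : Fin (n + n)) (i : Fin n) (hi : (i : ℕ) = x % n) (hx : (x : ℕ) / n = a) :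
    jaccard (toFin (slotCount A s q₀ r) (storedSlots A s q₀ r x))
      (toFin (slotCount A s q₀ r) (askedSlots A s q₀ r a q)) =
      jaccard (modeSet A s a i) q.toFinset := by
  obtain ⟨h1, h2⟩ := card_slots hq hr x i hi hx
  have hR : 0 < modeSize r a := by unfold modeSize; split_ifs <;> omega
  rw [jaccard, jaccard, h1, h2, Nat.cast_mul, Nat.cast_mul]
  exact mul_div_mul_left _ _ (by positivity)

/-- Similar pairs of slot sets come from similar sets. -/
theorem jaccard_lt_of_slots {a : ℕ} {q : List ℕ} (hq : q.length ≤ modeMax q₀ r a) (hr : 0 < r)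
    (ha : a < 2) {j : ℝ} (hj : 0 ≤ j) (x : Fin (n + n)) (i : Fin n) (hi : (i : ℕ) = x % n)
    (h : j < jaccard (toFin (slotCount A s q₀ r) (storedSlots A s q₀ r x))
      (toFin (slotCount A s q₀ r) (askedSlots A s q₀ r a q))) :
    j < jaccard (A i) q.toFinset := by
  by_cases hx : (x : ℕ) / n = a
  · rw [jaccard_slots hq hr x i hi hx] at h
    unfold modeSet at h
    split_ifs at h
    · exact h
    · rw [jaccard_eq_zero (disjoint_empty_left _)] at h
      linarith
  · rw [jaccard_eq_zero (disjoint_slots hq ha x hx)] at h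
    linarith

end

/-! ### Correctness for fixed random choices -/

section

variable {n : ℕ} (A : Fin n → Finset ℕ) (s q₀ r m K T Z : ℕ)

/-- The mode of a query with `c` elements. -/
def modeOf (r c : ℕ) : ℕ := if c < r then 1 else 0

theorem modeOf_lt (r c : ℕ) : modeOf r c < 2 := by unfold modeOf; split_ifs <;> omega

/-- An upper bound for the number of keys in the dictionary. -/
def keyBound : ℕ := (modeElems A s 0).card + (modeElems A s 1).card +
  (3 * m * K * (n + n) + m * m * m * (n + n))

/-- The size of the memory. -/
def memSize : ℕ := 24 + 17 * (keyBound A s m K + 1) + 2 * slotCount A s q₀ r + (n + n) * T +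
  (3 * m * K + T) + 3 * m

/-- The time of a query with `c` elements. -/
def timeBound (q₀ r m K T Φ c : ℕ) : ℕ :=
  200 + (if c ≤ modeMax q₀ r (modeOf r c) then
    (c + 1) * (150 + (modeSize r (modeOf r c) + 1) * 50) else 0) +
    (3 * m + 1) * (40 + (K + 1) * 100) + (m * m * m + Φ + 1) * (300 + (T + 1) * 40)

variable {m K T}

/-- The dictionary. -/
noncomputable def dict (ω : Rnd (slotCount A s q₀ r) (Bin m K T)) : ℕ → ℕ :=
  dictFun Z m K (ownBlocks A s) (blockId A s q₀ r) (storedSketch ω (storedSlots A s q₀ r))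

/-- The `ζ`-th candidate for the query `q` is not similar to it. -/
def BadAt (ω : Rnd (slotCount A s q₀ r) (Bin m K T)) (j : ℝ) (q : List ℕ) (ζ : ℕ) : Prop :=
  ∃ i : Fin (n + n), (allCands ω (storedSlots A s q₀ r) (askedSlots A s q₀ r (modeOf r q.length) q)
    (dict A s q₀ r Z ω) Z)[ζ]? = some i ∧
    jaccard (toFin (slotCount A s q₀ r) (storedSlots A s q₀ r i))
      (toFin (slotCount A s q₀ r) (askedSlots A s q₀ r (modeOf r q.length) q)) ≤ j

/-- The event that a query succeeds, up to the choice of the candidate in case of too many. -/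
def SlotSuccess (ω : Rnd (slotCount A s q₀ r) (Bin m K T)) (j : ℝ) (Θ Φ : ℕ) (q : List ℕ)
    (i₀ : Fin (n + n)) : Prop :=
  Success ω (fun i => toFin (slotCount A s q₀ r) (storedSlots A s q₀ r i))
    (toFin (slotCount A s q₀ r) (askedSlots A s q₀ r (modeOf r q.length) q)) j Θ Φ i₀

/-- All numbers that occur are smaller than the base `Z` of the keys. -/
structure Fits (u Θ Φ W : ℕ) (m K T : ℕ) : Prop where
  mem : memSize A s q₀ r m K T < Z
  word : 4 * Z ^ 12 < W
  sets : n + n < Z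
  tables : m * m * m < Z
  depth : K < Z
  univ : u < Z
  elems : ∀ i, ∀ x ∈ A i, x < u
  small : r < Z
  large : q₀ < Z
  thr : Θ < Z
  scan : Φ < Z
  r_pos : 0 < r
  n_pos : 0 < n

variable {A s q₀ r Z}

theorem Fits.describes {u Θ Φ W : ℕ} (h : Fits A s q₀ r Z u Θ Φ W m K T)
    (ω : Rnd (slotCount A s q₀ r) (Bin m K T)) :
    Describes ω (storedSlots A s q₀ r) (dict A s q₀ r Z ω) Z := by
  have h1 := h.mem
  unfold memSize at h1
  exact describes_dictFun ω _ h.sets (by omega) (by omega) h.tables h.depth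
    fun a x => (blockId_le a x).trans_lt (by omega)

theorem Fits.slots_lt {u Θ Φ W : ℕ} (h : Fits A s q₀ r Z u Θ Φ W m K T) :
    slotCount A s q₀ r < Z ∧ 2 < Z := by
  have h1 := h.mem
  unfold memSize at h1
  omega

/-- For fixed `ω` and `ζ` all is deterministic: the same image serves all queries, and time and
safety hold for each of them. Randomness enters only through the two events in the hypotheses of the
last claim. -/
theorem exists_memory {u Θ Φ W : ℕ} (h : Fits A s q₀ r Z u Θ Φ W m K T)
    (ω : Rnd (slotCount A s q₀ r) (Bin m K T)) {ζ : ℕ} (hζ : ζ < Φ) {j : ℝ} (hj : 0 ≤ j) :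
    ∃ μ : Fin (memSize A s q₀ r m K T) → Fin W, ∀ q : List (Fin u), q.Nodup →
      ∃ out t, Answers queryProg μ q out t ∧ t ≤ timeBound q₀ r m K T Φ q.length ∧
        (q.length ≤ modeMax q₀ r (modeOf r q.length) →
          (∃ i₀, SlotSuccess A s q₀ r ω j Θ Φ (q.map Fin.val) i₀) →
          ¬ BadAt A s q₀ r Z ω j (q.map Fin.val) ζ →
          ∃ i : Fin n, out = i ∧ j < jaccard (A i) (q.map Fin.val).toFinset) := by
  classical
  have hmem := h.mem
  have hSdef : memSize A s q₀ r m K T = 24 + 17 * (keyBound A s m K + 1) + 2 * slotCount A s q₀ r +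
    (n + n) * T + (3 * m * K + T) + 3 * m := rfl
  obtain ⟨hMZ, hZ2⟩ := h.slots_lt
  have hr := h.r_pos
  have hD := h.describes ω
  set F := dict A s q₀ r Z ω with hFdef
  have hxV : ∀ a, ∀ x ∈ modeElems A s a, x < u := by
    intro a x hx
    obtain ⟨i, -, hi⟩ := mem_biUnion.1 hx
    unfold modeSet at hi
    split_ifs at hi
    · exact h.elems i x hi
    · simp at hi
  have hV : ∀ v ∈ ownBlocks A s, v.1 < Z ∧ v.2 < Z := by
    rintro ⟨a, x⟩ hv
    obtain ⟨h1, h2⟩ := mem_ownBlocks.1 hv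
    exact ⟨by omega, (hxV a x h2).trans h.univ⟩
  have hid : ∀ a x, blockId A s q₀ r a x < Z := fun a x => (blockId_le a x).trans_lt (by omega)
  have hsp : slotCount A s q₀ r = split A s q₀ + r * ((modeElems A s 1).card + r) := rfl
  have hsp2 : split A s q₀ = (modeElems A s 0).card + q₀ := rfl
  have hrm : r * (modeElems A s 1).card ≤ r * ((modeElems A s 1).card + r) :=
    Nat.mul_le_mul_left _ (Nat.le_add_right _ _)
  obtain ⟨P, a, sz, μ, hI, hμ⟩ := exists_img (n := n) (thr := r) (Z := Z)
    (pool0 := modeOff A s q₀ 0 + modeSize r 0 * (modeElems A s 0).card) (qmax0 := q₀)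
    (pool1 := modeOff A s q₀ 1 + modeSize r 1 * (modeElems A s 1).card) (Θ := Θ) (Φ := Φ) (ζ := ζ)
    (W := W) ω (storedSlots A s q₀ r) hSdef hmem h.word (add_le_add card_ownBlocks_le le_rfl) h.sets h.tables h.depth
    hid hV (by have := h.sets; omega) h.small (by simp [modeOff, modeSize]; omega) h.large
    (by simp [modeOff, modeSize]; omega) h.thr h.scan hζ
  refine ⟨fun x => ⟨μ x, hμ x⟩, fun q hq => ?_⟩
  set inp := q.map Fin.val with hinp
  have hlen : inp.length = q.length := by simp [hinp]
  have hnd : inp.Nodup := hq.map Fin.val_injective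
  have hlt : ∀ x ∈ inp, x < Z := by
    intro x hx
    obtain ⟨y, -, rfl⟩ := List.mem_map.1 hx
    exact y.2.trans h.univ
  have hqu : q.length < Z := by
    have h1 : q.length ≤ u := by simpa using hq.length_le_card
    exact h1.trans_lt h.univ
  set md := modeOf r inp.length with hmd
  have hmd2 : md < 2 := modeOf_lt _ _
  set XQ := askedSlots A s q₀ r md inp with hXQ
  have hst : ∀ i l, storedSketch ω (storedSlots A s q₀ r) i l < Z := fun i l =>
    (sketch_le _ _ _ _ _).trans_lt (by omega)
  have hE : ∀ x ∈ inp, F (enc Z 0 md x 0 0 0) = if x ∈ modeElems A s md then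
      modeOff A s q₀ md + modeSize r md * position (modeElems A s md) x + 1 else 0 := by
    intro x hx
    rw [hFdef, dict, dictFun_element h.sets hZ2 (by omega) h.tables h.depth hV
      hst (by omega) (hlt x hx)]
    simp only [mem_ownBlocks, hmd2, true_and]
    rfl
  obtain ⟨hbase, hslots⟩ := slotsOf_eq hnd hE
  have hsk : askedSketch ω XQ = querySketch (layout (slotCount A s q₀ r) m K T (n + n) Z (keyBound A s m K) n r
      (modeOff A s q₀ 0 + modeSize r 0 * (modeElems A s 0).card) q₀
      (modeOff A s q₀ 1 + modeSize r 1 * (modeElems A s 1).card) Θ Φ ζ P a sz) F (binOf ω) (rankOf ω)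
      (slotCount A s q₀ r) md
      (modeOff A s q₀ md + modeSize r md * (modeElems A s md).card) (modeSize r md) inp := by
    unfold querySketch askedSketch
    rw [hXQ, askedSlots, ← hslots]
    rfl
  have hR : 0 < modeSize r md := by unfold modeSize; split_ifs <;> omega
  have hTr := queryProg_spec hI (inp := inp) (f := μ) (fun _ _ => rfl) (hlen.trans_lt hqu) hlt hr
    (mode := md) (pool := modeOff A s q₀ md + modeSize r md * (modeElems A s md).card)
    (R := modeSize r md) (qmax := modeMax q₀ r md) (by
      change _ = if inp.length < r then (1, r, modeOff A s q₀ 1 + modeSize r 1 * (modeElems A s 1).card, r)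
        else (0, 1, modeOff A s q₀ 0 + modeSize r 0 * (modeElems A s 0).card, q₀)
      rw [hmd]
      unfold modeOf
      split_ifs <;> simp [modeSize, modeMax])
    (by
      intro hle i hi
      have h1 := askedSlots_subset (A := A) (s := s) hle
      -- The last slot of the block belongs to the query's slots, hence is below `slotCount`.
      have h2 : blockBase F Z md (modeOff A s q₀ md + modeSize r md * (modeElems A s md).card)
          (modeSize r md) inp i + modeSize r md - 1 ∈ askedSlots A s q₀ r md inp := by
        rw [askedSlots, ← hslots, slotsOf, mem_biUnion]
        exact ⟨i, mem_range.2 hi, mem_Ico.2 ⟨by omega, by omega⟩⟩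
      have h3 := mem_range.1 (h1 h2)
      change blockBase F Z md _ _ inp i + _ ≤ _
      omega)
    hsk rfl (cands := fun τ => (tableCands ω (storedSlots A s q₀ r) XQ F Z τ).map Fin.val)
    (by
      intro τ _ x hx
      obtain ⟨y, -, rfl⟩ := List.mem_map.1 hx
      exact y.2)
    (by
      intro τ _
      rw [List.length_map]
      exact (length_bucket_le _ _ _ _).trans_lt h.sets)
    (by
      intro τ hτ i hi
      rw [List.length_map] at hi
      have hc : ∀ g, cls F Z (askedSketch ω XQ) K g K < Z := fun g =>
        cls_lt hD.lt (by omega) _ _ _ _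
      refine (hD.bucket τ hτ _ (hc _) _ (hc _) _ (hc _) i
        (hi.trans (length_bucket_le _ _ _ _))).trans ?_
      rw [List.getElem?_map, Option.map_map]
      rfl)
  obtain ⟨out, t, h1, h2, r', f', h3, h4⟩ := hTr.answers q rfl (fun x => ⟨μ x, hμ x⟩) fun _ => rfl
  refine ⟨out, t, h1, h2.trans (le_of_eq ?_), fun hle hS hB => ?_⟩
  · rw [hlen] at hmd ⊢
    rw [hmd]
    rfl
  · obtain ⟨i₀, hS⟩ := hS
    rw [← hlen] at hle
    have h5 := h3 hle
    rw [h4] at h5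
    obtain ⟨x, hx, hj'⟩ := exists_similar hD hMZ (by omega) storedSlots_subset (askedSlots_subset hle) hS
      (vs := verSketch ω (storedSlots A s q₀ r)) (fun i e _ => by rw [verSketch, dif_pos i.2])
      (ζ := ζ) (fun i hi hle' => hB ⟨i, hi, hle'⟩)
      (candsFrom_map _ _) h5
    exact ⟨⟨x % n, Nat.mod_lt _ h.n_pos⟩, hx, jaccard_lt_of_slots hle hr hmd2 hj x _ rfl hj'⟩

end

/-! ### The probability of success -/

/-- The conditions on the parameters of the search structure under which a query succeeds with
constant probability. -/
structure Tuned (j₁ j₂ lam δ : ℝ) (n m K T Θ r : ℕ) : Prop where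
  lam_pos : 0 < lam
  T_pos : 0 < T
  r_pos : 0 < r
  collide : 1 ≤ m * j₁ ^ K
  few : n * j₂ ^ (3 * K) ≤ 1
  tail : (n + n : ℕ) * ((1 + lam * j₂) ^ T / (1 + lam) ^ Θ) ≤ 1 / 256
  thr : Θ + T * ((j₁ - j₂) / 4) ≤ T * j₁
  cheb : (T + 2 * δ * T ^ 2) / (T * ((j₁ - j₂) / 4)) ^ 2 ≤ 1 / 256
  inter : 4 * (3 * K) ^ 2 ≤ j₁ * r
  union : 4 * (3 * K) * (3 * m * K + T) ≤ r
  error : (3 * m * K + T : ℝ) / r + 1 / (j₁ * r) ≤ δ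

section

variable {n : ℕ} {A : Fin n → Finset ℕ} {s q₀ r m K T Θ : ℕ} {j₁ j₂ lam δ : ℝ}

/-- Similarity at least `j₁` forces `j₁ |Q| ≤ |A|` and `j₁ |A| ≤ |Q|`. The first shows that the
query fits into the pool, the second that a small query meets only sets stored in mode `1`. In both
modes the union has at least `r` slots and the intersection at least `j₁ * r`, which is what the
sketches need. -/
theorem pr_slotSuccess (h : Tuned j₁ j₂ lam δ n m K T Θ r) (hj₂ : 0 < j₂) (hj : j₂ < j₁)
    (hs : (r : ℝ) ≤ j₁ * (s + 1)) (hq₀ : ∀ i, ((A i).card : ℝ) < j₁ * (q₀ + 1))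
    {q : List ℕ} (hq : q.Nodup) (hq0 : q ≠ []) (i : Fin n) (hi : j₁ ≤ jaccard (A i) q.toFinset) :
    q.length ≤ modeMax q₀ r (modeOf r q.length) ∧
      1 / 64 ≤ pr fun ω : Rnd (slotCount A s q₀ r) (Bin m K T) =>
        ∃ i₀, SlotSuccess A s q₀ r ω j₂ Θ (1024 * m ^ 3) q i₀ := by
  have hj₁ : 0 < j₁ := hj₂.trans hj
  have hr : (0 : ℝ) < r := Nat.cast_pos.2 h.r_pos
  have hcard : q.toFinset.card = q.length := List.toFinset_card_of_nodup hq
  have hlen : 0 < q.length := List.length_pos_of_ne_nil hq0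
  have hU : 0 < (A i ∪ q.toFinset).card :=
    (hcard ▸ hlen).trans_le (card_le_card subset_union_right)
  have hU' : (0 : ℝ) < (A i ∪ q.toFinset).card := Nat.cast_pos.2 hU
  have hI : j₁ * (A i ∪ q.toFinset).card ≤ ((A i ∩ q.toFinset).card : ℝ) := by
    rwa [jaccard, le_div_iff₀ hU'] at hi
  have hUA : ((A i).card : ℝ) ≤ (A i ∪ q.toFinset).card :=
    Nat.cast_le.2 (card_le_card subset_union_left)
  have hUQ : (q.length : ℝ) ≤ (A i ∪ q.toFinset).card := by
    rw [← hcard]; exact Nat.cast_le.2 (card_le_card subset_union_right)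
  have hIA : ((A i ∩ q.toFinset).card : ℝ) ≤ (A i).card :=
    Nat.cast_le.2 (card_le_card inter_subset_left)
  have hIQ : ((A i ∩ q.toFinset).card : ℝ) ≤ q.length := by
    rw [← hcard]; exact Nat.cast_le.2 (card_le_card inter_subset_right)
  have hle : q.length ≤ modeMax q₀ r (modeOf r q.length) := by
    by_cases h1 : q.length < r
    · simpa only [modeOf, modeMax, h1, if_true, one_ne_zero, if_false] using h1.le
    · simp only [modeOf, modeMax, h1, if_true, if_false]
      have h3 : j₁ * q.length < j₁ * (q₀ + 1) := by
        have := mul_le_mul_of_nonneg_left hUQ hj₁.le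
        have := hq₀ i
        linarith
      have h4 := lt_of_mul_lt_mul_left h3 hj₁.le
      exact Nat.lt_succ_iff.1 (by exact_mod_cast h4)
  have hset : modeSet A s (modeOf r q.length) i = A i := by
    by_cases h1 : q.length < r
    · refine if_pos (.inr ?_)
      by_contra h2
      have h3 : ((s : ℝ) + 1) ≤ (A i).card := by exact_mod_cast not_le.1 h2
      have h4 : (q.length : ℝ) < r := Nat.cast_lt.2 h1
      have := mul_le_mul_of_nonneg_left (h3.trans hUA) hj₁.le
      linarith
    · exact if_pos (.inl (if_neg h1))
  -- A small query has blocks of size `r`; a large one has at least `r` elements.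
  have hsize : r ≤ modeSize r (modeOf r q.length) * (A i ∪ q.toFinset).card := by
    by_cases h1 : q.length < r
    · simp only [modeOf, modeSize, h1, if_true, one_ne_zero, if_false]
      exact Nat.le_mul_of_pos_right _ hU
    · simp only [modeOf, modeSize, h1, if_true, if_false, one_mul]
      have : q.length ≤ (A i ∪ q.toFinset).card := by exact_mod_cast hUQ
      omega
  refine ⟨hle, ?_⟩
  have : NeZero T := ⟨h.T_pos.ne'⟩
  have ha2 := modeOf_lt r q.length
  set a := modeOf r q.length with ha
  have hn : 0 < n := i.pos
  -- The copy of the set `i` that belongs to the mode of the query.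
  let x : Fin (n + n) := ⟨a * n + i, by
    have := i.2
    have : a * n ≤ 1 * n := Nat.mul_le_mul_right _ (by omega)
    omega⟩
  have hx1 : (x : ℕ) / n = a := by
    rw [show (x : ℕ) = n * a + i by simp only [x]; ring, Nat.mul_add_div hn, Nat.div_eq_of_lt i.2,
      add_zero]
  have hx2 : (i : ℕ) = x % n := by
    rw [show (x : ℕ) = n * a + i by simp only [x]; ring, Nat.mul_add_mod, Nat.mod_eq_of_lt i.2]
  obtain ⟨c1, c2⟩ := card_slots (A := A) (s := s) hle h.r_pos x i hx2 hx1
  have c3 := jaccard_slots (A := A) (s := s) hle h.r_pos x i hx2 hx1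
  rw [hset] at c1 c2 c3
  have c4 : j₁ * r ≤ ((modeSize r a * (A i ∩ q.toFinset).card : ℕ) : ℝ) := by
    have h1 : (r : ℝ) ≤ modeSize r a * (A i ∪ q.toFinset).card := by exact_mod_cast hsize
    have h2 := mul_le_mul_of_nonneg_left hI (Nat.cast_nonneg (α := ℝ) (modeSize r a))
    push_cast
    nlinarith
  have c5 : (r : ℝ) ≤ ((modeSize r a * (A i ∪ q.toFinset).card : ℕ) : ℝ) := Nat.cast_le.2 hsize
  have hj₁r : 0 < j₁ * r := mul_pos hj₁ hr
  refine (pr_success (m := m) (K := K) (T := T) (fun y => toFin (slotCount A s q₀ r) (storedSlots A s q₀ r y))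
    (toFin (slotCount A s q₀ r) (askedSlots A s q₀ r a q)) (j := j₂) (lam := lam)
    (d := T * ((j₁ - j₂) / 4)) (δ := δ) hj₂.le Θ (1024 * m ^ 3) x ?_ ?_ ?_ ?_ h.lam_pos h.tail ?_ ?_ ?_
    h.cheb ?_ rfl).trans (pr_mono fun ω hω => ⟨x, hω⟩)
  · rw [c1]
    exact Nat.cast_pos.1 (hj₁r.trans_le c4)
  · rw [c3]
    exact h.collide.trans (mul_le_mul_of_nonneg_left (pow_le_pow_left₀ hj₁.le hi _) (Nat.cast_nonneg _))
  · rw [c1]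
    exact_mod_cast h.inter.trans c4
  · rw [c2]
    exact h.union.trans hsize
  · exact mul_pos (Nat.cast_pos.2 h.T_pos) (by linarith)
  · rw [c3]
    exact h.thr.trans (mul_le_mul_of_nonneg_left hi (Nat.cast_nonneg _))
  · rw [c1, c2]
    refine le_trans (add_le_add ?_ ?_) h.error
    · exact div_le_div_of_nonneg_left (by positivity) hr c5
    · exact div_le_div_of_nonneg_left zero_le_one hj₁r c4
  · have := h.few
    push_cast
    linarith

end

/-- The random index is independent of the sketches, so one may average over it first, for a fixed
`ω` that determines which indices are bad. -/
theorem le_pr_prod {Ω₁ Ω₂ : Type*} [Fintype Ω₁] [Fintype Ω₂] [Nonempty Ω₂] (E : Ω₁ → Prop)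
    (B : Ω₁ → Ω₂ → Prop) {a b : ℝ} (hb : 0 ≤ b) (hE : a ≤ pr E)
    (hB : ∀ ω, E ω → b ≤ pr fun ζ => ¬ B ω ζ) :
    b * a ≤ pr fun x : Ω₁ × Ω₂ => E x.1 ∧ ¬ B x.1 x.2 := by
  have h1 : pr (fun x : Ω₁ × Ω₂ => E x.1 ∧ ¬ B x.1 x.2) =
      mean fun ω => pr fun ζ => E ω ∧ ¬ B ω ζ := by
    simp only [pr, mean, Fintype.sum_prod_type, Fintype.card_prod, Nat.cast_mul, ← sum_div]
    rw [div_div, mul_comm]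
    rfl
  rw [h1]
  refine (mul_le_mul_of_nonneg_left hE hb).trans ?_
  rw [pr, ← mean_const_mul]
  refine mean_mono fun ω => ?_
  by_cases h : E ω
  · simpa [ind, h] using hB ω h
  · simpa [ind, h] using pr_nonneg _

theorem le_toOuterMeasure_map {Ω α : Type*} [Fintype Ω] [Nonempty Ω] (f : Ω → α) (E : Ω → Prop)
    (s : Set α) (h : ∀ ω, E ω → f ω ∈ s) :
    ENNReal.ofReal (pr E) ≤ ((PMF.uniformOfFintype Ω).map f).toOuterMeasure s := by
  classical
  rw [PMF.toOuterMeasure_map_apply, PMF.toOuterMeasure_uniformOfFintype_apply, pr_eq_card,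
    ENNReal.ofReal_div_of_pos (Nat.cast_pos.2 Fintype.card_pos), ENNReal.ofReal_natCast,
    ENNReal.ofReal_natCast]
  refine ENNReal.div_le_div_right (Nat.cast_le.2 ?_) _
  rw [Fintype.card_subtype]
  exact card_le_card fun ω hω => by
    rw [mem_filter] at *
    exact ⟨hω.1, h ω hω.2⟩

section

variable {n : ℕ} {A : Fin n → Finset ℕ} {s q₀ r m K T Θ Z u Φ W : ℕ} {j : ℝ}

theorem le_pr_not_badAt (h : Fits A s q₀ r Z u Θ Φ W m K T) (hΦ : 0 < Φ)
    (ω : Rnd (slotCount A s q₀ r) (Bin m K T)) {q : List ℕ}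
    (hq : q.length ≤ modeMax q₀ r (modeOf r q.length)) {i₀ : Fin (n + n)}
    (hS : SlotSuccess A s q₀ r ω j Θ Φ q i₀) :
    1 / 2 ≤ pr fun ζ : Fin Φ => ¬ BadAt A s q₀ r Z ω j q ζ := by
  classical
  have : Nonempty (Fin Φ) := ⟨⟨0, hΦ⟩⟩
  have h1 := card_bad_le (h.describes ω) h.slots_lt.1 (by have := h.slots_lt.2; omega) storedSlots_subset
    (askedSlots_subset hq) hS
  have h2 := pr_add_not fun ζ : Fin Φ => BadAt A s q₀ r Z ω j q ζ
  have h3 : pr (fun ζ : Fin Φ => BadAt A s q₀ r Z ω j q ζ) ≤ 1 / 2 := by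
    rw [pr_eq_card, Fintype.card_fin, div_le_iff₀ (Nat.cast_pos.2 hΦ)]
    have h4 : (2 : ℝ) * ((univ.filter fun ζ : Fin Φ => BadAt A s q₀ r Z ω j q ζ).card : ℝ) ≤ Φ := by
      have := h1
      exact_mod_cast (by
        convert this using 3
        ext ζ
        simp only [mem_filter, mem_univ, true_and]
        rfl)
    linarith
  linarith

end

/-! ### The choice of the parameters -/

theorem one_add_log_le_rpow {ε x : ℝ} (hε : 0 < ε) (hx : 1 ≤ x) :
    1 + Real.log x ≤ (1 + 1 / ε) * x ^ ε := by
  have h1 := Real.log_le_rpow_div (zero_le_one.trans hx) hε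
  have h2 := Real.one_le_rpow hx hε.le
  rw [div_eq_mul_one_div] at h1
  nlinarith

/-- A weight that separates the expected numbers of agreements. -/
theorem exists_weight {j θ : ℝ} (hj : 0 < j) (hθ : j < θ) :
    ∃ lam : ℝ, 0 < lam ∧ 1 + lam * j < (1 + lam) ^ θ := by
  have h1 : 1 < θ / j := (one_lt_div hj).2 hθ
  -- Any `lam > 0` with `1 + lam < θ / j` works: `log (1 + lam) ≥ lam / (1 + lam)` yields `(1 + lam)
  -- ^ θ ≥ 1 + lam * θ / (1 + lam) > 1 + lam * j`.
  refine ⟨(θ / j - 1) / 2, by linarith, ?_⟩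
  set lam := (θ / j - 1) / 2 with hl
  have hl0 : 0 < lam := by linarith
  have h2 : 1 + lam < θ / j := by linarith
  have h3 : j < θ / (1 + lam) := by
    rw [lt_div_iff₀ (by linarith)]
    rw [lt_div_iff₀ hj] at h2
    linarith
  have h4 := Real.one_sub_inv_le_log_of_pos (show 0 < 1 + lam by linarith)
  have h5 := Real.add_one_le_exp (Real.log (1 + lam) * θ)
  rw [Real.rpow_def_of_pos (by linarith)]
  have h6 : 1 - (1 + lam)⁻¹ = lam / (1 + lam) := by field_simp; ring
  rw [h6] at h4
  have h7 : lam * j < lam * (θ / (1 + lam)) := mul_lt_mul_of_pos_left h3 hl0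
  have h8 : lam * (θ / (1 + lam)) = lam / (1 + lam) * θ := by ring
  have h9 := mul_le_mul_of_nonneg_right h4 (hj.le.trans hθ.le)
  linarith

/-- The ratio of the two bases has logarithm `g`, so its `T`-th power is at least `exp 9 * n ≥ 512 *
n`, against the `2 * n` stored sets. -/
theorem tail_le {j θ lam g : ℝ} (hlam : 0 < lam) (hj : 0 < j)
    (hg : g = Real.log ((1 + lam) ^ θ / (1 + lam * j))) {n T Θ : ℕ} (hn : 1 ≤ n)
    (hT : 9 + Real.log n ≤ g * T) (hΘ : θ * T ≤ Θ) :
    (n + n : ℕ) * ((1 + lam * j) ^ T / (1 + lam) ^ Θ) ≤ 1 / 256 := by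
  have h0 : 0 < 1 + lam := by linarith
  have h1 : 0 < 1 + lam * j := by positivity
  have hn0 : (0 : ℝ) < n := Nat.cast_pos.2 hn
  have h2 : ((1 + lam) ^ θ) ^ T ≤ (1 + lam) ^ Θ := by
    rw [← Real.rpow_natCast, ← Real.rpow_natCast, ← Real.rpow_mul h0.le]
    exact Real.rpow_le_rpow_of_exponent_le (by linarith) hΘ
  have h3 : 512 * (n : ℝ) ≤ ((1 + lam) ^ θ / (1 + lam * j)) ^ T := by
    have h4 : 0 < (1 + lam) ^ θ / (1 + lam * j) := by positivity
    rw [← Real.exp_log h4, ← hg, ← Real.exp_nat_mul]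
    have h5 : Real.exp (9 + Real.log n) ≤ Real.exp (T * g) :=
      Real.exp_le_exp.2 (by rw [mul_comm]; exact hT)
    rw [Real.exp_add, Real.exp_log hn0] at h5
    refine le_trans (mul_le_mul_of_nonneg_right ?_ hn0.le) h5
    have h6 : (2 : ℝ) ≤ Real.exp 1 := by have := Real.add_one_le_exp (1 : ℝ); linarith
    calc (512 : ℝ) = 2 ^ 9 := by norm_num
      _ ≤ Real.exp 1 ^ 9 := pow_le_pow_left₀ (by norm_num) h6 _
      _ = Real.exp 9 := by rw [← Real.exp_nat_mul]; norm_num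
  rw [div_pow, le_div_iff₀ (by positivity)] at h3
  rw [← mul_div_assoc, div_le_iff₀ (by positivity)]
  push_cast
  linarith

theorem exists_nat_near {y : ℝ} (hy : 0 ≤ y) : ∃ k : ℕ, y ≤ k ∧ (k : ℝ) < y + 1 :=
  ⟨_, Nat.le_ceil y, Nat.ceil_lt_add_one hy⟩

/-- The depth `K` of the tables and their number. -/
theorem exists_depth {j₁ j₂ ρ : ℝ} (hj₂ : 0 < j₂) (hj : j₂ < j₁) (hj₁ : j₁ < 1)
    (hρ : ρ = Real.log (1 / j₁) / Real.log (1 / j₂)) :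
    ∃ c : ℝ, 0 < c ∧ ∀ n : ℕ, 1 ≤ n → ∃ m K : ℕ, 1 ≤ m * j₁ ^ K ∧ n * j₂ ^ (3 * K) ≤ 1 ∧
      m ≤ c * (n : ℝ) ^ (ρ / 3) ∧ (K : ℝ) + 1 ≤ c * (1 + Real.log n) := by
  have hj₁0 : 0 < j₁ := hj₂.trans hj
  obtain ⟨a, ha⟩ : ∃ y, y = Real.log (1 / j₁) := ⟨_, rfl⟩
  obtain ⟨b, hb⟩ : ∃ y, y = Real.log (1 / j₂) := ⟨_, rfl⟩
  have ha0 : 0 < a := ha ▸ Real.log_pos ((one_lt_div hj₁0).2 hj₁)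
  have hb0 : 0 < b := hb ▸ Real.log_pos ((one_lt_div hj₂).2 (hj.trans hj₁))
  rw [← ha, ← hb] at hρ
  have hρ0 : 0 < ρ := hρ ▸ div_pos ha0 hb0
  have hab : a = ρ * b := by rw [hρ]; field_simp
  have ea : Real.log j₁ = -a := by rw [ha, one_div, Real.log_inv, neg_neg]
  have eb : Real.log j₂ = -b := by rw [hb, one_div, Real.log_inv, neg_neg]
  refine ⟨1 / j₁ + 1 + (1 / (3 * b) + 2), by positivity, fun n hn => ?_⟩
  have hn0 : (0 : ℝ) < n := Nat.cast_pos.2 hn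
  have hn1 : (1 : ℝ) ≤ n := Nat.one_le_cast.2 hn
  have hlog : 0 ≤ Real.log n := Real.log_nonneg hn1
  obtain ⟨x, hx⟩ : ∃ y, y = (n : ℝ) ^ (ρ / 3) := ⟨_, rfl⟩
  have hx1 : 1 ≤ x := hx ▸ Real.one_le_rpow hn1 (by positivity)
  -- The least depth with `n * j₂ ^ (3 * K) ≤ 1`. Then `j₁ ^ (-K)` is at most `n ^ (ρ / 3) / j₁`,
  -- where the division by `j₁` pays for rounding `K` up; this dictates `m`.
  obtain ⟨K, hK1, hK2⟩ := exists_nat_near (y := Real.log n / (3 * b)) (by positivity)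
  obtain ⟨m, hm1, hm2⟩ := exists_nat_near (y := x / j₁) (by positivity)
  refine ⟨m, K, ?_, ?_, ?_, ?_⟩
  · have h1 : j₁ ^ K = Real.exp (-(a * K)) := by
      rw [← Real.exp_log hj₁0, ← Real.exp_nat_mul, ea]; congr 1; ring
    have h2 : a * K ≤ Real.log n * (ρ / 3) + a := by
      have h3 : a * (Real.log n / (3 * b)) = Real.log n * (ρ / 3) := by rw [hab]; field_simp
      have h4 := mul_le_mul_of_nonneg_left hK2.le ha0.le
      linarith
    have h3 : x * Real.exp a = x / j₁ := by
      rw [ha, Real.exp_log (by positivity)]; ring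
    rw [h1, Real.exp_neg, ← div_eq_mul_inv, le_div_iff₀ (Real.exp_pos _), one_mul]
    refine (Real.exp_le_exp.2 h2).trans (le_trans (le_of_eq ?_) hm1)
    rw [Real.exp_add, ← h3, hx, Real.rpow_def_of_pos hn0]
  · have h1 : j₂ ^ (3 * K) = Real.exp (-(3 * K * b)) := by
      rw [← Real.exp_log hj₂, ← Real.exp_nat_mul, eb]; congr 1; push_cast; ring
    rw [h1, Real.exp_neg, ← div_eq_mul_inv, div_le_iff₀ (Real.exp_pos _), one_mul]
    rw [div_le_iff₀ (by positivity)] at hK1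
    calc (n : ℝ) = Real.exp (Real.log n) := (Real.exp_log hn0).symm
      _ ≤ _ := Real.exp_le_exp.2 (by linarith)
  · rw [← hx]
    have h1 : x / j₁ = 1 / j₁ * x := by ring
    have h2 : 0 ≤ (1 / (3 * b) + 2) * x := by positivity
    linarith
  · have h1 : Real.log n / (3 * b) = 1 / (3 * b) * Real.log n := by ring
    have h2 : 0 ≤ (1 / j₁ + 1) * (1 + Real.log n) := by positivity
    have h3 : 0 < 1 / (3 * b) := by positivity
    linarith

/-- The number `T` of verification bins and the threshold `Θ`. -/
theorem exists_length {j₁ j₂ : ℝ} (hj₂ : 0 < j₂) (hj : j₂ < j₁) (hj₁ : j₁ < 1) :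
    ∃ lam δ c : ℝ, 0 < lam ∧ 0 < δ ∧ 0 < c ∧ ∀ n : ℕ, 1 ≤ n → ∃ T Θ : ℕ, 0 < T ∧
      (n + n : ℕ) * ((1 + lam * j₂) ^ T / (1 + lam) ^ Θ) ≤ 1 / 256 ∧
      Θ + T * ((j₁ - j₂) / 4) ≤ T * j₁ ∧
      (T + 2 * δ * T ^ 2) / (T * ((j₁ - j₂) / 4)) ^ 2 ≤ 1 / 256 ∧ T ≤ c * (1 + Real.log n) := by
  obtain ⟨η, hη⟩ : ∃ y, y = j₁ - j₂ := ⟨_, rfl⟩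
  have hη0 : 0 < η := by linarith
  have hη1 : η < 1 := by linarith
  obtain ⟨θ, hθ⟩ : ∃ y, y = (j₁ + j₂) / 2 := ⟨_, rfl⟩
  obtain ⟨lam, hlam, hw⟩ := exists_weight hj₂ (show j₂ < θ by linarith)
  obtain ⟨g, hg⟩ : ∃ y, y = Real.log ((1 + lam) ^ θ / (1 + lam * j₂)) := ⟨_, rfl⟩
  have hg0 : 0 < g := hg ▸ Real.log_pos ((one_lt_div (by positivity)).2 hw)
  -- The first summand serves the Chernoff bound, the second one Chebyshev's inequality and the
  -- rounding of `Θ`.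
  obtain ⟨C, hC⟩ : ∃ y, y = 9 / g + 16384 / η ^ 2 := ⟨_, rfl⟩
  have hC0 : 0 < C := by rw [hC]; positivity
  have hC1 : 16384 ≤ C * η ^ 2 := by
    have h1 : C * η ^ 2 = 9 / g * η ^ 2 + 16384 := by rw [hC]; field_simp
    rw [h1]
    exact le_add_of_nonneg_left (by positivity)
  have hC2 : 9 ≤ g * C := by
    have h1 : g * C = 9 + g * (16384 / η ^ 2) := by rw [hC]; field_simp
    rw [h1]
    exact le_add_of_nonneg_right (by positivity)
  -- In units of `(T * η) ^ 2 / 16384`, the variance bound is at most `1 + 2` and the allowance `(T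
  -- * η / 4) ^ 2 / 256` is `4`.
  refine ⟨lam, η ^ 2 / 16384, C + 1, hlam, by positivity, by positivity, fun n hn => ?_⟩
  have hlog : 0 ≤ Real.log n := Real.log_nonneg (Nat.one_le_cast.2 hn)
  obtain ⟨Y, hY⟩ : ∃ y, y = 1 + Real.log n := ⟨_, rfl⟩
  have hY1 : 1 ≤ Y := by linarith
  obtain ⟨T, hT1, hT2⟩ := exists_nat_near (y := C * Y) (by positivity)
  obtain ⟨Θ, hΘ1, hΘ2⟩ := exists_nat_near (y := θ * T)
    (mul_nonneg (by linarith) (Nat.cast_nonneg _))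
  have hCT : C ≤ T := le_trans (le_mul_of_one_le_right hC0.le hY1) hT1
  have hT0 : (0 : ℝ) < T := hC0.trans_le hCT
  have hTη : 16384 ≤ T * η ^ 2 := hC1.trans (mul_le_mul_of_nonneg_right hCT (by positivity))
  have hTη1 : 16384 ≤ T * η := by
    refine hTη.trans (mul_le_mul_of_nonneg_left ?_ hT0.le)
    rw [sq]
    exact mul_le_of_le_one_left hη0.le hη1.le
  refine ⟨T, Θ, Nat.cast_pos.1 hT0, ?_, ?_, ?_, ?_⟩
  · refine tail_le hlam hj₂ hg hn ?_ hΘ1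
    have h1 := mul_le_mul_of_nonneg_left hT1 hg0.le
    have h2 := mul_le_mul_of_nonneg_right hC2 (zero_le_one.trans hY1)
    rw [← mul_assoc] at h1
    linarith
  · have h1 : θ * T = T * j₁ - T * η / 2 := by rw [hθ, hη]; ring
    rw [← hη]
    linarith
  · rw [← hη, div_le_iff₀ (by positivity)]
    have h1 := mul_le_mul_of_nonneg_left hTη hT0.le
    have h2 : 1 / 256 * (T * (η / 4)) ^ 2 = (T : ℝ) * (T * η ^ 2) / 4096 := by ring
    have h3 : 2 * (η ^ 2 / 16384) * (T : ℝ) ^ 2 = T * (T * η ^ 2) / 8192 := by ring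
    rw [h2, h3]
    linarith
  · rw [← hY]
    linarith

/-- The size `r` below which a query counts as small. -/
theorem exists_small {j₁ δ : ℝ} (hj₁ : 0 < j₁) (hj₁1 : j₁ < 1) (hδ : 0 < δ) :
    ∃ c : ℕ, ∀ m K T r : ℕ, r = c * ((K + 1) * (m * K + T + K + 1)) →
      4 * (3 * (K : ℝ)) ^ 2 ≤ j₁ * r ∧ 4 * (3 * K) * (3 * m * K + T) ≤ r ∧
      (3 * m * K + T : ℝ) / r + 1 / (j₁ * r) ≤ δ ∧ m * K + T + K + 1 ≤ r := by
  -- `36 / j₁` takes care of the sizes of intersection and union, the second summand of the error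
  -- `δ`.
  obtain ⟨c, hc⟩ := exists_nat_ge (36 / j₁ + (3 + 1 / j₁) / δ)
  have hq1 : 0 < (3 + 1 / j₁) / δ := by positivity
  have hq2 : 36 < 36 / j₁ := by rw [lt_div_iff₀ hj₁]; linarith
  have hc36 : 36 ≤ c := by exact_mod_cast (by linarith : (36 : ℝ) ≤ c)
  refine ⟨c, fun m K T r hr => ?_⟩
  obtain ⟨E, hE⟩ : ∃ y, y = m * K + T + K + 1 := ⟨_, rfl⟩
  rw [← hE] at hr ⊢
  have hE1 : 1 ≤ E := by omega
  have hEr : E ≤ r := by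
    rw [hr]
    calc E ≤ (K + 1) * E := Nat.le_mul_of_pos_left _ (by omega)
      _ ≤ c * ((K + 1) * E) := Nat.le_mul_of_pos_left _ (by omega)
  have hr0 : (0 : ℝ) < r := Nat.cast_pos.2 (by omega)
  have hr' : (r : ℝ) = c * ((K + 1) * E) := by rw [hr]; push_cast; ring
  have h3E : 3 * m * K + T ≤ 3 * E := by rw [hE, mul_assoc]; omega
  refine ⟨?_, ?_, ?_, hEr⟩
  · have h1 : (36 : ℝ) ≤ j₁ * c := by
      have : 36 / j₁ ≤ c := by linarith
      rw [div_le_iff₀ hj₁] at this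
      linarith
    have h2 : (K : ℝ) ^ 2 ≤ (K + 1) * E := by
      rw [sq]
      exact mul_le_mul (by linarith) (by exact_mod_cast (by omega : K ≤ E)) (Nat.cast_nonneg _)
        (by positivity)
    rw [hr', ← mul_assoc]
    calc 4 * (3 * (K : ℝ)) ^ 2 = 36 * K ^ 2 := by ring
      _ ≤ (j₁ * c) * ((K + 1) * E) := mul_le_mul h1 h2 (by positivity) (by positivity)
  · calc 4 * (3 * K) * (3 * m * K + T) ≤ 4 * (3 * (K + 1)) * (3 * E) :=
          Nat.mul_le_mul (by omega) h3E
      _ = 36 * ((K + 1) * E) := by ring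
      _ ≤ r := hr ▸ Nat.mul_le_mul_right _ hc36
  · have h1 : (3 * m * K + T : ℝ) + 1 / j₁ ≤ (3 + 1 / j₁) * E := by
      have h2 : (3 * m * K + T : ℝ) ≤ 3 * E := by exact_mod_cast h3E
      have h3 : 1 / j₁ ≤ 1 / j₁ * E := le_mul_of_one_le_right (by positivity) (by exact_mod_cast hE1)
      linarith
    have h2 : (3 * m * K + T : ℝ) / r + 1 / (j₁ * r) = ((3 * m * K + T : ℝ) + 1 / j₁) / r := by
      field_simp
    rw [h2, div_le_iff₀ hr0]
    refine h1.trans ?_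
    have h3 : (3 + 1 / j₁) ≤ δ * c := by
      have : (3 + 1 / j₁) / δ ≤ c := by linarith
      rw [div_le_iff₀ hδ] at this
      linarith
    have h4 : (E : ℝ) ≤ (K + 1) * E :=
      le_mul_of_one_le_left (Nat.cast_nonneg _) (by have := Nat.cast_nonneg (α := ℝ) K; linarith)
    rw [hr', ← mul_assoc]
    exact mul_le_mul h3 h4 (Nat.cast_nonneg _) (by positivity)

/-- The growth of the parameters. -/
theorem growth_le {ρ c c' : ℝ} (hρ : 0 < ρ) (hc : 0 < c) (hc' : 0 < c') (k n m K T : ℕ) (hn : 1 ≤ n)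
    (hm : m ≤ c * (n : ℝ) ^ (ρ / 3)) (hK : (K : ℝ) + 1 ≤ c * (1 + Real.log n))
    (hT : T ≤ c' * (1 + Real.log n)) :
    (m : ℝ) ^ 3 ≤ c ^ 3 * n ^ ρ ∧ ((k * ((K + 1) * (m * K + T + K + 1)) : ℕ) : ℝ) ^ 2 ≤
      (k * c * (c * c + c' + c)) ^ 2 * (1 + 1 / (ρ / 12)) ^ 4 * n ^ ρ := by
  have hn0 : (0 : ℝ) < n := Nat.cast_pos.2 hn
  have hn1 : (1 : ℝ) ≤ n := Nat.one_le_cast.2 hn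
  have hlog : 0 ≤ Real.log n := Real.log_nonneg hn1
  -- The square of `r` is of order `x ^ 2 * (1 + log n) ^ 4` with `x = n ^ (ρ / 3)`, and the four
  -- logarithms are absorbed by the third factor `x`.
  have h2 := pow_le_pow_left₀ (by linarith) (one_add_log_le_rpow (show 0 < ρ / 12 by positivity) hn1) 4
  rw [mul_pow, ← Real.rpow_natCast ((n : ℝ) ^ (ρ / 12)), ← Real.rpow_mul hn0.le,
    show ρ / 12 * (4 : ℕ) = ρ / 3 by push_cast; ring] at h2
  obtain ⟨x, hx⟩ : ∃ y, y = (n : ℝ) ^ (ρ / 3) := ⟨_, rfl⟩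
  obtain ⟨Y, hY⟩ : ∃ y, y = 1 + Real.log n := ⟨_, rfl⟩
  have hx1 : 1 ≤ x := hx ▸ Real.one_le_rpow hn1 (by positivity)
  have hY1 : 1 ≤ Y := by linarith
  have hx3 : x ^ 3 = (n : ℝ) ^ ρ := by
    rw [hx, ← Real.rpow_natCast, ← Real.rpow_mul hn0.le]; congr 1; push_cast; ring
  rw [← hx] at hm h2
  rw [← hY] at hK hT h2
  rw [← hx3]
  constructor
  · rw [← mul_pow]
    exact pow_le_pow_left₀ (Nat.cast_nonneg _) hm 3
  · have hYx : Y ≤ x * Y := le_mul_of_one_le_left (by linarith) hx1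
    have h3 : (m : ℝ) * K ≤ (c * x) * (c * Y) :=
      mul_le_mul hm (by linarith) (Nat.cast_nonneg _) (by positivity)
    have h4 := mul_le_mul_of_nonneg_left hYx hc.le
    have h5 := mul_le_mul_of_nonneg_left hYx hc'.le
    have h6 : (m : ℝ) * K + T + K + 1 ≤ (c * c + c' + c) * (x * Y) := by linarith
    have h7 : ((k * ((K + 1) * (m * K + T + K + 1)) : ℕ) : ℝ) ≤
        k * c * (c * c + c' + c) * (x * Y ^ 2) := by
      push_cast
      calc (k : ℝ) * ((K + 1) * (m * K + T + K + 1)) ≤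
          k * ((c * Y) * ((c * c + c' + c) * (x * Y))) :=
            mul_le_mul_of_nonneg_left (mul_le_mul hK h6 (by positivity) (by positivity))
              (Nat.cast_nonneg _)
        _ = _ := by ring
    calc ((k * ((K + 1) * (m * K + T + K + 1)) : ℕ) : ℝ) ^ 2 ≤
        (k * c * (c * c + c' + c) * (x * Y ^ 2)) ^ 2 := pow_le_pow_left₀ (Nat.cast_nonneg _) h7 2
      _ = (k * c * (c * c + c' + c)) ^ 2 * x ^ 2 * Y ^ 4 := by ring
      _ ≤ (k * c * (c * c + c' + c)) ^ 2 * x ^ 2 * ((1 + 1 / (ρ / 12)) ^ 4 * x) :=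
        mul_le_mul_of_nonneg_left h2 (by positivity)
      _ = _ := by ring

theorem exists_tuned {j₁ j₂ ρ : ℝ} (hj₂ : 0 < j₂) (hj : j₂ < j₁) (hj₁ : j₁ < 1) (hρ0 : 0 < ρ)
    (hρ : ρ = Real.log (1 / j₁) / Real.log (1 / j₂)) :
    ∃ lam δ c : ℝ, 0 < c ∧ ∀ n : ℕ, 1 ≤ n → ∃ m K T Θ r : ℕ, Tuned j₁ j₂ lam δ n m K T Θ r ∧
      (m : ℝ) ^ 3 ≤ c * n ^ ρ ∧ (r : ℝ) ^ 2 ≤ c * n ^ ρ ∧ T ≤ c * (1 + Real.log n) ∧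
      K ≤ c * (1 + Real.log n) ∧ m * K + T + K + 1 ≤ r := by
  obtain ⟨c, hc, h1⟩ := exists_depth hj₂ hj hj₁ hρ
  obtain ⟨lam, δ, c', hlam, hδ, hc', h2⟩ := exists_length hj₂ hj hj₁
  obtain ⟨k, h3⟩ := exists_small (hj₂.trans hj) hj₁ hδ
  obtain ⟨D, hD⟩ : ∃ y, y = (k * c * (c * c + c' + c)) ^ 2 * (1 + 1 / (ρ / 12)) ^ 4 := ⟨_, rfl⟩
  have hD0 : 0 ≤ D := by rw [hD]; positivity
  have hc3 : 0 < c ^ 3 := by positivity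
  refine ⟨lam, δ, c + c' + c ^ 3 + D, by positivity, fun n hn => ?_⟩
  obtain ⟨m, K, d1, d2, d3, d4⟩ := h1 n hn
  obtain ⟨T, Θ, e1, e2, e3, e4, e5⟩ := h2 n hn
  obtain ⟨f1, f2, f3, f4⟩ := h3 m K T _ rfl
  obtain ⟨g1, g2⟩ := growth_le hρ0 hc hc' k n m K T hn d3 d4 e5
  have hlog : 0 ≤ Real.log n := Real.log_nonneg (Nat.one_le_cast.2 hn)
  have hn0 : 0 ≤ (n : ℝ) ^ ρ := by positivity
  rw [← hD] at g2
  refine ⟨m, K, T, Θ, _, ⟨hlam, e1, by omega, d1, d2, e2, e3, e4, f1, f2, f3⟩, ?_, ?_, ?_, ?_, f4⟩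
  · exact g1.trans (mul_le_mul_of_nonneg_right (by linarith) hn0)
  · exact g2.trans (mul_le_mul_of_nonneg_right (by linarith) hn0)
  · exact e5.trans (mul_le_mul_of_nonneg_right (by linarith) (by linarith))
  · exact (by linarith : (K : ℝ) ≤ c * (1 + Real.log n)).trans
      (mul_le_mul_of_nonneg_right (by linarith) (by linarith))

/-! ### Space, time and word length -/

section

variable {n : ℕ} {A : Fin n → Finset ℕ} {s q₀ r m K T : ℕ}

theorem card_modeElems_le (a : ℕ) : (modeElems A s a).card ≤ ∑ i, (A i).card := by
  refine card_biUnion_le.trans (sum_le_sum fun i _ => ?_)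
  unfold modeSet
  split_ifs <;> simp

theorem card_modeElems_one_le : (modeElems A s 1).card ≤ n * s := by
  refine card_biUnion_le.trans ((sum_le_card_nsmul _ _ s fun i _ => ?_).trans (by simp))
  by_cases h : (A i).card ≤ s
  · rwa [modeSet, if_pos (.inr h)]
  · rw [modeSet, if_neg (by simpa using h)]
    exact Nat.zero_le _

/-- The critical term is `r` times the number of elements in mode `1`, which is at most `n * s ≤ n *
r / j`; this is affordable because `r ^ 2 ≤ c * P`. The tables need `O(n * m ^ 3)` keys. -/
theorem memSize_le {j c P B : ℝ} (hj : 0 < j) (hc : 0 ≤ c) (hP : 1 ≤ P) (hn : 1 ≤ n)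
    (hB : B = ∑ i, ((A i).card : ℝ)) (hs : (s : ℝ) ≤ r / j) (hq₀ : (q₀ : ℝ) ≤ B / j)
    (hm : (m : ℝ) ^ 3 ≤ c * P) (hr : (r : ℝ) ^ 2 ≤ c * P) (hle : m * K + T + K + 1 ≤ r) :
    (memSize A s q₀ r m K T : ℝ) ≤ (77 + 2 / j + c * (147 + 2 / j)) * (n * P + B) := by
  have hn1 : (1 : ℝ) ≤ n := Nat.one_le_cast.2 hn
  have hB0 : 0 ≤ B := by rw [hB]; positivity
  obtain ⟨R, hR⟩ : ∃ y, y = (r : ℝ) ^ 2 := ⟨_, rfl⟩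
  obtain ⟨G, hG⟩ : ∃ y, y = n * P := ⟨_, rfl⟩
  have hG1 : 1 ≤ G := by rw [hG]; nlinarith
  have hPG : P ≤ G := by rw [hG]; exact le_mul_of_one_le_left (by linarith) hn1
  have hr0 : (0 : ℝ) ≤ r := Nat.cast_nonneg _
  have hrR : (r : ℝ) ≤ R := by
    rw [hR, sq]
    exact le_mul_of_one_le_left hr0 (by exact_mod_cast (by omega : 1 ≤ r))
  have h1 : ((modeElems A s 0).card : ℝ) ≤ B := by
    rw [hB]; exact_mod_cast card_modeElems_le (A := A) (s := s) 0
  have h2 : ((modeElems A s 1).card : ℝ) ≤ B := by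
    rw [hB]; exact_mod_cast card_modeElems_le (A := A) (s := s) 1
  have h3 : r * ((modeElems A s 1).card : ℝ) ≤ n * R / j := by
    have h : ((modeElems A s 1).card : ℝ) ≤ n * s := by
      exact_mod_cast card_modeElems_one_le (A := A) (s := s)
    calc r * ((modeElems A s 1).card : ℝ) ≤ r * (n * (r / j)) :=
          mul_le_mul_of_nonneg_left (h.trans (mul_le_mul_of_nonneg_left hs (Nat.cast_nonneg _))) hr0
      _ = n * R / j := by rw [hR]; ring
  have h4 : ((m : ℝ) * K + T) ≤ R := by
    refine le_trans ?_ hrR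
    exact_mod_cast (by omega : m * K + T ≤ r)
  have hmK : 0 ≤ (m : ℝ) * K := by positivity
  have hT0 : (0 : ℝ) ≤ T := Nat.cast_nonneg _
  have h5 : (m : ℝ) ≤ m ^ 3 := by exact_mod_cast Nat.le_self_pow (by norm_num) m
  have hnR : n * R ≤ c * G := by
    rw [hG, ← mul_assoc, mul_comm c, mul_assoc]
    exact mul_le_mul_of_nonneg_left (hR ▸ hr) (by linarith)
  have hnm : n * (m : ℝ) ^ 3 ≤ c * G := by
    rw [hG, ← mul_assoc, mul_comm c, mul_assoc]
    exact mul_le_mul_of_nonneg_left hm (by linarith)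
  have hcPG := mul_le_mul_of_nonneg_left hPG hc
  have hRG : R ≤ c * G := by rw [hR]; linarith
  have hnmK : n * ((m : ℝ) * K + T) ≤ n * R := mul_le_mul_of_nonneg_left h4 (by linarith)
  have hnT : 0 ≤ (n : ℝ) * T := by positivity
  have hnRj : n * R / j ≤ c * G / j := div_le_div_of_nonneg_right hnR hj.le
  have hnmK0 : 0 ≤ (n : ℝ) * (m * K) := by positivity
  have e : (memSize A s q₀ r m K T : ℝ) = 41 + 17 * ((modeElems A s 0).card +
      (modeElems A s 1).card + (6 * (n * (m * K)) + 2 * (n * (m : ℝ) ^ 3))) +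
      2 * ((modeElems A s 0).card + q₀ + (r * ((modeElems A s 1).card : ℝ) + R)) + 2 * (n * T) +
      (3 * (m * K) + T) + 3 * m := by
    rw [memSize, keyBound, slotCount, split, hR]
    push_cast
    ring
  have e2 : (77 + 2 / j + c * (147 + 2 / j)) * (G + B) = 77 * G + 77 * B + 2 * (G / j) +
      2 * (B / j) + 147 * (c * G) + 147 * (c * B) + 2 * (c * G / j) + 2 * (c * B / j) := by ring
  have p1 : 0 ≤ G / j := by positivity
  have p2 : 0 ≤ c * B := by positivity
  have p3 : 0 ≤ c * B / j := by positivity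
  rw [e, ← hG, e2]
  linarith

/-- Sketching costs `O(r ^ 2)` for a query shorter than `r` and `O(ℓ)` otherwise. The classes need
`O(m * K)` lookups, and the scan has `O(m ^ 3)` rounds of length `O(T)`. -/
theorem timeBound_le {c P Y : ℝ} (hc : 0 ≤ c) (hP : 1 ≤ P) (hY : 1 ≤ Y) (hm : (m : ℝ) ^ 3 ≤ c * P)
    (hr : (r : ℝ) ^ 2 ≤ c * P) (hT : T ≤ c * Y) (hK : K ≤ c * Y) {ℓ : ℕ} (hℓ : 1 ≤ ℓ) :
    (timeBound q₀ r m K T (1024 * m ^ 3) ℓ : ℝ) ≤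
      (700 + 250 * c + (3 * c + 1) * (140 + 100 * c) + (1025 * c + 1) * (340 + 40 * c)) *
        (P * Y + ℓ) := by
  have hPY : P ≤ P * Y := le_mul_of_one_le_right (by linarith) hY
  have hℓ1 : (1 : ℝ) ≤ ℓ := Nat.one_le_cast.2 hℓ
  have h5 : (m : ℝ) ≤ m ^ 3 := by exact_mod_cast Nat.le_self_pow (by norm_num) m
  have hm0 : (0 : ℝ) ≤ m := Nat.cast_nonneg _
  have h1 : (((if ℓ ≤ modeMax q₀ r (modeOf r ℓ) then
      (ℓ + 1) * (150 + (modeSize r (modeOf r ℓ) + 1) * 50) else 0) : ℕ) : ℝ) ≤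
      250 * (c * P) + 500 * ℓ := by
    by_cases h : ℓ < r
    · have h2 : (if ℓ ≤ modeMax q₀ r (modeOf r ℓ) then
          (ℓ + 1) * (150 + (modeSize r (modeOf r ℓ) + 1) * 50) else 0) ≤ 250 * r ^ 2 := by
        simp only [modeOf, modeMax, modeSize, h, if_true, one_ne_zero, if_false, h.le]
        calc (ℓ + 1) * (150 + (r + 1) * 50) ≤ r * (250 * r) := Nat.mul_le_mul h (by omega)
          _ = _ := by ring
      have h3 : (((if ℓ ≤ modeMax q₀ r (modeOf r ℓ) then
          (ℓ + 1) * (150 + (modeSize r (modeOf r ℓ) + 1) * 50) else 0) : ℕ) : ℝ) ≤ 250 * (r : ℝ) ^ 2 := by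
        exact_mod_cast h2
      linarith
    · have h2 : (if ℓ ≤ modeMax q₀ r (modeOf r ℓ) then
          (ℓ + 1) * (150 + (modeSize r (modeOf r ℓ) + 1) * 50) else 0) ≤ 500 * ℓ := by
        simp only [modeOf, modeMax, modeSize, h, if_true, if_false]
        split_ifs <;> omega
      have h3 : (((if ℓ ≤ modeMax q₀ r (modeOf r ℓ) then
          (ℓ + 1) * (150 + (modeSize r (modeOf r ℓ) + 1) * 50) else 0) : ℕ) : ℝ) ≤ 500 * (ℓ : ℝ) := by
        exact_mod_cast h2
      have : 0 ≤ c * P := by positivity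
      linarith
  have h2 : (3 * m + 1 : ℝ) * (40 + (K + 1) * 100) ≤ ((3 * c + 1) * P) * ((140 + 100 * c) * Y) :=
    mul_le_mul (by linarith) (by linarith) (by positivity) (by positivity)
  have h3 : ((m : ℝ) ^ 3 + 1024 * (m : ℝ) ^ 3 + 1) * (300 + (T + 1) * 40) ≤
      ((1025 * c + 1) * P) * ((340 + 40 * c) * Y) :=
    mul_le_mul (by linarith) (by linarith) (by positivity) (by positivity)
  have e : (timeBound q₀ r m K T (1024 * m ^ 3) ℓ : ℝ) =
      200 + (((if ℓ ≤ modeMax q₀ r (modeOf r ℓ) then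
      (ℓ + 1) * (150 + (modeSize r (modeOf r ℓ) + 1) * 50) else 0) : ℕ) : ℝ) +
      (3 * m + 1) * (40 + (K + 1) * 100) +
      ((m : ℝ) ^ 3 + 1024 * (m : ℝ) ^ 3 + 1) * (300 + (T + 1) * 40) := by
    rw [timeBound]
    push_cast
    ring
  obtain ⟨X, hX⟩ : ∃ y, y = P * Y := ⟨_, rfl⟩
  rw [e, ← hX]
  rw [← hX] at hPY
  have e2 : ((3 * c + 1) * P) * ((140 + 100 * c) * Y) = ((3 * c + 1) * (140 + 100 * c)) * X := by
    rw [hX]; ring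
  have e3 : ((1025 * c + 1) * P) * ((340 + 40 * c) * Y) = ((1025 * c + 1) * (340 + 40 * c)) * X := by
    rw [hX]; ring
  rw [e2] at h2
  rw [e3] at h3
  have hcX := mul_le_mul_of_nonneg_left hPY hc
  obtain ⟨c₁, hc₁⟩ : ∃ y, y = (3 * c + 1) * (140 + 100 * c) := ⟨_, rfl⟩
  obtain ⟨c₂, hc₂⟩ : ∃ y, y = (1025 * c + 1) * (340 + 40 * c) := ⟨_, rfl⟩
  have hc₁0 : 0 ≤ c₁ := by rw [hc₁]; positivity
  have hc₂0 : 0 ≤ c₂ := by rw [hc₂]; positivity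
  rw [← hc₁] at h2 ⊢
  rw [← hc₂] at h3 ⊢
  have q1 : 0 ≤ c₁ * ℓ := by positivity
  have q2 : 0 ≤ c₂ * ℓ := by positivity
  have q3 : 0 ≤ c * ℓ := by positivity
  have e4 : (700 + 250 * c + c₁ + c₂) * (X + ℓ) = 700 * X + 250 * (c * X) + c₁ * X + c₂ * X +
      700 * ℓ + 250 * (c * ℓ) + c₁ * ℓ + c₂ * ℓ := by ring
  rw [e4]
  linarith

/-- For `n ≥ 2` the logarithm is at least `1/2`; for `n = 1` it vanishes and the size of the query
pays. -/
theorem mul_one_add_log_le {ρ : ℝ} (hn : 1 ≤ n) {ℓ : ℝ} (hℓ : 1 ≤ ℓ) :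
    (n : ℝ) ^ ρ * (1 + Real.log n) ≤ 3 * ((n : ℝ) ^ ρ * Real.log n + ℓ) := by
  rcases hn.lt_or_eq with h | rfl
  · have h1 : Real.log 2 ≤ Real.log n := Real.log_le_log (by norm_num) (by exact_mod_cast h)
    have h2 := Real.log_two_gt_d9
    have h3 : 0 ≤ (n : ℝ) ^ ρ := by positivity
    nlinarith
  · simp
    linarith

/-- The bounds on the sizes hold for words of length proportional to `log (n + u)`. -/
theorem fits_of_le {u Θ e : ℕ} {c : ℝ} (hn : 1 ≤ n) (hu : ∀ i, ∀ x ∈ A i, x < u)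
    (hle : m * K + T + K + 1 ≤ r) (hm : 1 ≤ m) (hΘ : Θ ≤ T) (hc : 0 ≤ c)
    (hS : (memSize A s q₀ r m K T : ℝ) ≤ c * (n * n + n * u)) (he : 1024 * (c + 1) + 1 ≤ 2 ^ e) :
    Fits A s q₀ r (2 ^ ((e + 2) * Nat.size (n + u))) u Θ (1024 * m ^ 3)
      (2 ^ ((12 * (e + 2) + 3) * Nat.size (n + u))) m K T := by
  obtain ⟨X, hX⟩ : ∃ y, y = 2 ^ Nat.size (n + u) := ⟨_, rfl⟩
  obtain ⟨S, hSd⟩ : ∃ y, y = memSize A s q₀ r m K T := ⟨_, rfl⟩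
  have hlt : n + u < X := hX ▸ Nat.lt_size_self (n + u)
  have hX2 : 2 ≤ X := by omega
  have hZ : (2 ^ ((e + 2) * Nat.size (n + u)) : ℕ) = X ^ (e + 2) := by
    rw [hX, ← pow_mul, mul_comm]
  have hW : (2 ^ ((12 * (e + 2) + 3) * Nat.size (n + u)) : ℕ) = X ^ (12 * (e + 2) + 3) := by
    rw [hX, ← pow_mul, mul_comm]
  rw [hZ, hW]
  have hmain : 1024 * (S + 1) + u < X ^ (e + 2) := by
    have h1 : (n * n + n * u : ℝ) ≤ X ^ 2 := by
      have h2 : n * n + n * u ≤ X ^ 2 := by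
        rw [sq, ← mul_add]; exact Nat.mul_le_mul (by omega) (by omega)
      exact_mod_cast h2
    have h2 : (u : ℝ) < X ^ 2 := by
      have : u < X ^ 2 := (by omega : u < X).trans_le (Nat.le_self_pow (by norm_num) X)
      exact_mod_cast this
    have h3 : (1 : ℝ) ≤ (X : ℝ) ^ 2 := by exact_mod_cast Nat.one_le_pow _ _ (by omega)
    have h4 : (S : ℝ) ≤ c * X ^ 2 := (hSd ▸ hS).trans (mul_le_mul_of_nonneg_left h1 hc)
    have h5 : (1024 * (c + 1) + 1) * (X : ℝ) ^ 2 ≤ (X : ℝ) ^ (e + 2) := by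
      rw [pow_add]
      refine mul_le_mul_of_nonneg_right (he.trans ?_) (by positivity)
      exact pow_le_pow_left₀ (by norm_num) (by exact_mod_cast hX2) e
    have h6 : (1024 * ((S : ℝ) + 1) + u) < (X : ℝ) ^ (e + 2) := by linarith
    exact_mod_cast h6
  have hsplit : memSize A s q₀ r m K T = 24 + 17 * (keyBound A s m K + 1) + 2 * slotCount A s q₀ r +
    (n + n) * T + (3 * m * K + T) + 3 * m := rfl
  have hkey : m * m * m * (n + n) ≤ keyBound A s m K := by unfold keyBound; omega
  have hmmm : 1 ≤ m * m * m := Nat.mul_pos (Nat.mul_pos hm hm) hm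
  have hk1 : m * m * m ≤ m * m * m * (n + n) := Nat.le_mul_of_pos_right _ (by omega)
  have hk2 : n + n ≤ m * m * m * (n + n) := Nat.le_mul_of_pos_left _ hmmm
  have hslot : slotCount A s q₀ r = (modeElems A s 0).card + q₀ + (r * (modeElems A s 1).card + r * r) := by
    rw [slotCount, split, mul_add]
  have hrr : r ≤ r * r := Nat.le_mul_self r
  have hm3 : m ^ 3 = m * m * m := by ring
  constructor
  · omega
  -- The three additional factors `X ≥ 2` of the word bound outweigh the factor `4`.
  · rw [pow_add X (12 * (e + 2)), mul_comm 12, pow_mul, mul_comm]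
    refine Nat.mul_lt_mul_of_pos_left ?_ (by positivity)
    calc 4 < 2 ^ 3 := by norm_num
      _ ≤ X ^ 3 := Nat.pow_le_pow_left hX2 3
  · omega
  · omega
  · omega
  · omega
  · exact hu
  · omega
  · omega
  · omega
  · omega
  · omega
  · omega

end

end WordRAM

end

/-! ### The main theorem -/

theorem mainTheorem2 (j₁ j₂ ρ : ℝ) (hj₂ : 0 < j₂) (hj : j₂ < j₁) (hj₁ : j₁ < 1)
    (hρ : ρ = Real.log (1 / j₁) / Real.log (1 / j₂)) :
    -- one query program and constants, depending only on `j₁` and `j₂`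
    ∃ (P : WordRAM.Prog) (k : ℕ) (c p : ℝ), 0 < k ∧ 0 < c ∧ 0 < p ∧
      -- a nonempty collection of `n` sets from a universe of `u` elements; `w` is the word length
      ∀ (n u : ℕ) (C : Fin n → Finset (Fin u)), 1 ≤ n →
        ∀ w : ℕ, w = k * Nat.size (n + u) →
        -- the number of memory words, and the random memory contents after preprocessing
        ∃ (S : ℕ) (D : PMF (Fin S → Fin (2 ^ w))),
          (S : ℝ) ≤ c * ((n : ℝ) ^ (1 + ρ) + ∑ i, ((C i).card : ℝ)) ∧
          -- every nonempty query, its elements being listed in any order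
          ∀ (Q : Finset (Fin u)) (q : List (Fin u)), Q.Nonempty → q.Nodup → q.toFinset = Q →
            (∀ M ∈ D.support, ∃ out t : ℕ, WordRAM.Answers P M q out t ∧
              (t : ℝ) ≤ c * ((n : ℝ) ^ ρ * Real.log n + (Q.card : ℝ))) ∧
            ((∃ i₀ : Fin n, j₁ ≤ jaccard (C i₀) Q) →
              ENNReal.ofReal p ≤ D.toOuterMeasure
                {M | ∃ (i : Fin n) (t : ℕ), WordRAM.Answers P M q (i : ℕ) t ∧
                  j₂ < jaccard (C i) Q}) := by
  open WordRAM in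
  have hj₁0 : 0 < j₁ := hj₂.trans hj
  have ha0 : 0 < Real.log (1 / j₁) := Real.log_pos ((one_lt_div hj₁0).2 hj₁)
  have hab : Real.log (1 / j₁) ≤ Real.log (1 / j₂) :=
    Real.log_le_log (by positivity) (one_div_le_one_div_of_le hj₂ hj.le)
  have hρ0 : 0 < ρ := hρ ▸ div_pos ha0 (ha0.trans_le hab)
  have hρ1 : ρ ≤ 1 := hρ ▸ (div_le_one (ha0.trans_le hab)).2 hab
  obtain ⟨lam, δ, c, hc, htuned⟩ := exists_tuned hj₂ hj hj₁ hρ0 hρ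
  obtain ⟨cS, hcS⟩ : ∃ y, y = 77 + 2 / j₁ + c * (147 + 2 / j₁) := ⟨_, rfl⟩
  obtain ⟨cT, hcT⟩ : ∃ y, y = 700 + 250 * c + (3 * c + 1) * (140 + 100 * c) +
    (1025 * c + 1) * (340 + 40 * c) := ⟨_, rfl⟩
  have hcS0 : 0 < cS := by rw [hcS]; positivity
  have hcT0 : 0 < cT := by rw [hcT]; positivity
  obtain ⟨e, he⟩ := pow_unbounded_of_one_lt (1024 * (cS + 1) + 1) (one_lt_two (α := ℝ))
  -- The probability is `1/64` for the sketches times `1/2` for the random index. The factor `4`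
  -- comes from replacing `1 + log n` by `log n` in the time bound.
  refine ⟨queryProg, 12 * (e + 2) + 3, cS + 4 * cT, 1 / 128, by omega, by positivity, by norm_num,
    fun n u C hn w hw => ?_⟩
  obtain ⟨m, K, T, Θ, r, ht, hm, hr, hT, hK, hle⟩ := htuned n hn
  have hn0 : (0 : ℝ) < n := Nat.cast_pos.2 hn
  have hn1 : (1 : ℝ) ≤ n := Nat.one_le_cast.2 hn
  have hP1 : 1 ≤ (n : ℝ) ^ ρ := Real.one_le_rpow hn1 hρ0.le
  have hlog : 0 ≤ Real.log n := Real.log_nonneg hn1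
  obtain ⟨A, hA⟩ : ∃ A : Fin n → Finset ℕ, A = fun i => (C i).image Fin.val := ⟨_, rfl⟩
  have hAC : ∀ i, (A i).card = (C i).card := fun i => by
    rw [hA]; exact Finset.card_image_of_injective _ Fin.val_injective
  obtain ⟨B, hB⟩ : ∃ B, B = ∑ i, ((A i).card : ℝ) := ⟨_, rfl⟩
  have hB0 : 0 ≤ B := by rw [hB]; positivity
  have hBC : ∑ i, ((C i).card : ℝ) = B := by rw [hB]; simp only [hAC]
  -- `s` is the largest size of a set similar to a small query, and `q₀` the largest size of a query
  -- similar to some set, up to the factor `1 / j₁` allowed by similarity.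
  obtain ⟨s, hs1, hs2⟩ : ∃ s : ℕ, (s : ℝ) ≤ r / j₁ ∧ r / j₁ < s + 1 :=
    ⟨_, Nat.floor_le (by positivity), Nat.lt_floor_add_one _⟩
  obtain ⟨q₀, hq1, hq2⟩ : ∃ s : ℕ, (s : ℝ) ≤ B / j₁ ∧ B / j₁ < s + 1 :=
    ⟨_, Nat.floor_le (by positivity), Nat.lt_floor_add_one _⟩
  rw [div_lt_iff₀ hj₁0, mul_comm] at hs2 hq2
  have hSle := memSize_le (A := A) (K := K) (T := T) hj₁0 hc.le hP1 hn hB hs1 hq1 hm hr hle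
  rw [← hcS] at hSle
  have hm1 : 1 ≤ m := by
    rcases Nat.eq_zero_or_pos m with h | h
    · have := ht.collide
      rw [h, Nat.cast_zero, zero_mul] at this
      linarith
    · exact h
  have hΘT : Θ ≤ T := by
    have h1 := ht.thr
    have h2 : 0 ≤ T * ((j₁ - j₂) / 4) := mul_nonneg (Nat.cast_nonneg _) (by linarith)
    have h3 : T * j₁ ≤ T := mul_le_of_le_one_right (Nat.cast_nonneg _) hj₁.le
    exact_mod_cast (by linarith : (Θ : ℝ) ≤ T)
  have hAu : ∀ i, ∀ x ∈ A i, x < u := by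
    intro i x hx
    rw [hA] at hx
    obtain ⟨y, -, rfl⟩ := Finset.mem_image.1 hx
    exact y.2
  have hBu : B ≤ n * u := by
    have h1 : ∀ i, ((A i).card : ℝ) ≤ u := fun i => by
      rw [hAC]; exact_mod_cast (Finset.card_le_univ (C i)).trans_eq (Fintype.card_fin u)
    rw [hB]
    refine (Finset.sum_le_card_nsmul _ _ _ fun i _ => h1 i).trans (le_of_eq ?_)
    simp
  have hPn : (n : ℝ) ^ ρ ≤ n := by
    simpa using Real.rpow_le_rpow_of_exponent_le hn1 hρ1
  have hfit := fits_of_le hn hAu hle hm1 hΘT hcS0.le (hSle.trans (mul_le_mul_of_nonneg_left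
    (add_le_add (mul_le_mul_of_nonneg_left hPn hn0.le) hBu) hcS0.le)) he.le
  rw [← hw] at hfit
  have hΦ : 0 < 1024 * m ^ 3 := by positivity
  have : Nonempty (Fin (1024 * m ^ 3)) := ⟨⟨0, hΦ⟩⟩
  have : Nonempty (Bin m K T) := ⟨.inr ⟨0, ht.T_pos⟩⟩
  -- The memory image is a function of the bins, the ranks and the index `ζ`, which are all uniform
  -- and independent.
  choose f hf using fun x : Rnd (slotCount A s q₀ r) (Bin m K T) × Fin (1024 * m ^ 3) =>
    exists_memory hfit x.1 x.2.2 hj₂.le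
  refine ⟨memSize A s q₀ r m K T, (PMF.uniformOfFintype _).map f, ?_, ?_⟩
  · rw [hBC, Real.rpow_add hn0, Real.rpow_one]
    refine hSle.trans (mul_le_mul_of_nonneg_right (by linarith) (by positivity))
  intro Q q hQ hq hqQ
  have hcard : Q.card = q.length := by rw [← hqQ]; exact List.toFinset_card_of_nodup hq
  have hlen : 1 ≤ q.length := hcard ▸ hQ.card_pos
  have himg : (q.map Fin.val).toFinset = Q.image Fin.val := by
    ext x; simp [← hqQ]
  have hjac : ∀ i, jaccard (A i) (q.map Fin.val).toFinset = jaccard (C i) Q := fun i => by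
    rw [himg, hA]; exact jaccard_image Fin.val_injective _ _
  constructor
  · intro M hM
    rw [PMF.support_map] at hM
    obtain ⟨x, -, rfl⟩ := hM
    obtain ⟨out, t, h1, h2, -⟩ := hf x q hq
    refine ⟨out, t, h1, ?_⟩
    have h3 := timeBound_le (q₀ := q₀) hc.le hP1 (by linarith : 1 ≤ 1 + Real.log n) hm hr hT hK hlen
    rw [← hcT] at h3
    have h4 : (t : ℝ) ≤ timeBound q₀ r m K T (1024 * m ^ 3) q.length := Nat.cast_le.2 h2
    have h5 := mul_one_add_log_le (ρ := ρ) hn (ℓ := q.length) (Nat.one_le_cast.2 hlen)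
    have h6 : 0 ≤ (n : ℝ) ^ ρ * Real.log n := by positivity
    have h7 : (n : ℝ) ^ ρ * (1 + Real.log n) + q.length ≤
        4 * ((n : ℝ) ^ ρ * Real.log n + q.length) := by linarith
    have h8 := mul_le_mul_of_nonneg_left h7 hcT0.le
    have h9 : 0 ≤ cS * ((n : ℝ) ^ ρ * Real.log n + q.length) := by positivity
    rw [hcard]
    linarith
  · rintro ⟨i₀, hi₀⟩
    have hqn : (q.map Fin.val) ≠ [] := by
      intro h
      rw [List.map_eq_nil_iff] at h
      simp [h] at hlen
    obtain ⟨hmax, hpr⟩ := pr_slotSuccess (A := A) (s := s) (q₀ := q₀) ht hj₂ hj hs2.le (fun i => by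
        refine lt_of_le_of_lt ?_ hq2
        rw [hB]
        exact Finset.single_le_sum (f := fun i => ((A i).card : ℝ)) (fun i _ => Nat.cast_nonneg _)
          (Finset.mem_univ i)) (hq.map Fin.val_injective) hqn i₀ (by rwa [hjac])
    have hprod := le_pr_prod _ (fun ω ζ => BadAt A s q₀ r (2 ^ ((e + 2) * Nat.size (n + u))) ω j₂
      (q.map Fin.val) ((ζ : Fin (1024 * m ^ 3)) : ℕ)) one_half_pos.le hpr fun ω hω =>
        le_pr_not_badAt hfit hΦ ω hmax hω.choose_spec
    refine (ENNReal.ofReal_le_ofReal (le_trans (by norm_num) hprod)).trans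
      (le_toOuterMeasure_map f _ _ fun x hx => ?_)
    obtain ⟨out, t, h1, -, h2⟩ := hf x q hq
    rw [List.length_map] at hmax
    obtain ⟨i, rfl, hi⟩ := h2 hmax hx.1 hx.2
    exact ⟨i, t, h1, by rwa [hjac] at hi⟩
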